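/- Let $d\in\{2,3\}$ and let $D\subset\mathbb R^d$ be a bounded domain. Let $A\in\mathbb R^{d\times d}$ be a constant symmetric positive definite matrix and $n>0$ a constant. Let $M\ge 0$, let $A_1,\dots,A_M\in\mathbb R^{d\times d}$ be constant symmetric positive definite matrices, let $B_1,\dots,B_M\subset\mathbb R^d$ be images of open balls centered at the origin under $C^\infty$ diffeomorphisms of $\mathbb R^d$, and let $z_1,\dots,z_M\in D$ satisfy $|z_i-z_j|\ge c_0$ for $i\ne j$ and $\operatorname{dist}(z_m,\partial D)\ge c_0$ for some $c_0>0$. For $\varepsilon>0$ small let $A_\varepsilon=A_m$ in $z_m+\varepsilon B_m$ $(m=1,\dots,M)$ and $A_\varepsilon=A$ elsewhere in $D$; let $A_0=A$ in $D$. For a symmetric matrix $S$ let $S_{\min}=\inf_{|\xi|=1}\overline\xi\cdot S\xi$ and $S_{\max}=\sup_{|\xi|=1}\overline\xi\cdot S\xi$. Assume that either $A_{\min}>1$ and $(A_m)_{\min}>1$ for all $m$, and put $\kappa=A_{\min}$; or $A_{\max}<1$ and $(A_m)_{\max}<1$ for all $m$, and put $\kappa=A_{\max}$. All functions are complex valued.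 Let $X(D)=\{(w,v)\in H^1(D)\times H^1(D): w-v\in H^1_0(D)\}$ with the inner product of $H^1(D)\times H^1(D)$, where $H^1_0(D)$ is the closure of $C_c^\infty(D)$ in $H^1(D)$. Let $\mathbf A_\varepsilon$ ($\varepsilon\ge0$), $\mathbf B_0$ and $\mathbf C$ be the bounded operators on $X(D)$ that represent, by the Riesz theorem, the sesquilinear forms $$\mathcal A_\varepsilon\big((w,v);(\varphi_1,\varphi_2)\big)=\int_D A_\varepsilon\nabla w\cdot\nabla\overline{\varphi}_1+\kappa\, w\overline{\varphi}_1\,dx-\int_D\nabla v\cdot\nabla\overline{\varphi}_2+v\overline{\varphi}_2\,dx,$$ $$\mathcal B_0\big((w,v);(\varphi_1,\varphi_2)\big)=\int_D n\,w\overline{\varphi}_1-v\overline{\varphi}_2\,dx,\qquad \mathcal C\big((w,v);(\varphi_1,\varphi_2)\big)=\int_D\kappa\, w\overline{\varphi}_1-v\overline{\varphi}_2\,dx .$$ Then $\mathbf A_0$ is invertible, and $\mathbf A_\varepsilon$ is invertible for all sufficiently small $\varepsilon>0$. For $\tau\in\mathbb C\setminus\{0\}$ put $\mathbf T_\varepsilon(\tau)=\mathbf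 A_\varepsilon^{-1}\mathbf B_0+\frac1\tau\mathbf A_\varepsilon^{-1}\mathbf C$, and let $\mathbf T_\varepsilon^*(\tau)$ be its Hilbert space adjoint in $X(D)$. Let $\tau\in\mathbb C\setminus\{0\}$ and let $(w_\tau,v_\tau)\in X(D)$ be a corresponding eigenfunction: $(w_\tau,v_\tau)\neq(0,0)$ and $\tau\,\mathbf T_0(\tau)(w_\tau,v_\tau)=(w_\tau,v_\tau)$, where $w_\tau$ and $v_\tau$ are $C^\infty$ in $D$. Then $$\big\|\mathbf T_\varepsilon^*(\tau)(w_\tau,v_\tau)-\mathbf T_0^*(\tau)(w_\tau,v_\tau)\big\|_{X(D)}=\mathcal O\big(\varepsilon^{d/2+1}\big)\qquad(\varepsilon\to0^+).$$ -/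

import Mathlib

open MeasureTheory Filter Topology Asymptotics
open scoped ENNReal ComplexConjugate ContDiff Pointwise

noncomputable section

namespace TransmissionEig

/-- `ℝ^d` with the Euclidean norm. -/
abbrev Pt (d : ℕ) : Type := EuclideanSpace ℝ (Fin d)

/-- `ℂ^d` with the Hermitian norm. -/
abbrev CVec (d : ℕ) : Type := EuclideanSpace ℂ (Fin d)

/-- Lebesgue measure on `D`. -/
abbrev leb {d : ℕ} (D : Set (Pt d)) : Measure (Pt d) := volume.restrict D

/-! ### Sobolev spaces -/

/-- The Hilbert space `L²(D; ℂ) × L²(D; ℂ^d)` of pairs `(u, g)`, with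
`‖(u, g)‖² = ‖u‖² + ‖g‖²`. The space `H¹(D)` is its subspace of the pairs in which `g` is the
weak gradient of `u`. -/
abbrev L2Pair {d : ℕ} (D : Set (Pt d)) : Type :=
  WithLp 2 (Lp ℂ 2 (leb D) × Lp (CVec d) 2 (leb D))

/-- Test functions: complex valued, `C^∞`, compactly supported in `D`. -/
def IsTest {d : ℕ} (D : Set (Pt d)) (η : Pt d → ℂ) : Prop :=
  ContDiff ℝ ∞ η ∧ HasCompactSupport η ∧ tsupport η ⊆ D

/-- The partial derivative `∂ η / ∂ x_i`. -/
def pderiv {d : ℕ} (i : Fin d) (η : Pt d → ℂ) (x : Pt d) : ℂ :=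
  fderiv ℝ η x (EuclideanSpace.single i 1)

/-- The gradient of a function `ℝ^d → ℂ`. -/
def grad {d : ℕ} (η : Pt d → ℂ) (x : Pt d) : CVec d :=
  WithLp.toLp 2 fun i => pderiv i η x

/-- `g` is the weak gradient of `u` in `D`. -/
def IsWeakGrad {d : ℕ} (D : Set (Pt d)) (u : Lp ℂ 2 (leb D)) (g : Lp (CVec d) 2 (leb D)) : Prop :=
  ∀ η : Pt d → ℂ, IsTest D η → ∀ i : Fin d,
    ∫ x in D, u x * pderiv i η x = - ∫ x in D, g x i * η x

theorem IsTest.memLp {d : ℕ} {D : Set (Pt d)} {η : Pt d → ℂ} (h : IsTest D η) :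
    MemLp η 2 (leb D) :=
  (h.1.continuous.memLp_of_hasCompactSupport h.2.1).restrict D

theorem continuous_pderiv {d : ℕ} {η : Pt d → ℂ} (h : ContDiff ℝ ∞ η) (i : Fin d) :
    Continuous (pderiv i η) :=
  (h.continuous_fderiv (by simp)).clm_apply continuous_const

theorem IsTest.memLp_pderiv {d : ℕ} {D : Set (Pt d)} {η : Pt d → ℂ} (h : IsTest D η) (i : Fin d) :
    MemLp (pderiv i η) 2 (leb D) := by
  refine ((continuous_pderiv h.1 i).memLp_of_hasCompactSupport ?_).restrict D
  have h1 : HasCompactSupport (fderiv ℝ η) := h.2.1.fderiv (𝕜 := ℝ)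
  exact h1.comp_left (g := fun L : Pt d →L[ℝ] ℂ => L (EuclideanSpace.single i 1)) (by simp)

theorem integral_mul_eq_inner {d : ℕ} {D : Set (Pt d)} {f : Pt d → ℂ} (hf : MemLp f 2 (leb D))
    (u : Lp ℂ 2 (leb D)) :
    ∫ x in D, u x * f x = inner ℂ (hf.star.toLp (star f)) u := by
  rw [L2.inner_def]
  refine integral_congr_ae ?_
  filter_upwards [hf.star.coeFn_toLp] with x hx
  rw [hx]
  simp [RCLike.inner_apply]

theorem integral_apply_mul_eq_inner {d : ℕ} {D : Set (Pt d)} {f : Pt d → ℂ}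
    (hf : MemLp f 2 (leb D)) (i : Fin d) :
    ∃ F : Lp (CVec d) 2 (leb D), ∀ g : Lp (CVec d) 2 (leb D),
      ∫ x in D, g x i * f x = inner ℂ F g := by
  have hF : MemLp (fun x => EuclideanSpace.single i (star (f x)) : Pt d → CVec d) 2 (leb D) := by
    refine hf.of_le_mul (c := 1) ?_ ?_
    · have hc : Continuous fun c : ℂ => (EuclideanSpace.single i (star c) : CVec d) := by
        refine (PiLp.continuous_toLp 2 _).comp ?_
        exact (continuous_single i).comp continuous_star
      exact hc.comp_aestronglyMeasurable hf.1
    · exact Eventually.of_forall fun x => by simp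
  refine ⟨hF.toLp _, fun g => ?_⟩
  rw [L2.inner_def]
  refine integral_congr_ae ?_
  filter_upwards [hF.coeFn_toLp] with x hx
  rw [hx]
  simp [EuclideanSpace.inner_single_left, mul_comm]

theorem isWeakGrad_iff {d : ℕ} {D : Set (Pt d)} :
    ∃ (ι : Type) (F : ι → L2Pair D), ∀ p : L2Pair D,
      IsWeakGrad D p.fst p.snd ↔ ∀ k, inner ℂ (F k) p = 0 := by
  choose G hG using fun (η : {η : Pt d → ℂ // IsTest D η}) (i : Fin d) =>
    integral_apply_mul_eq_inner η.2.memLp i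
  refine ⟨{η : Pt d → ℂ // IsTest D η} × Fin d, fun k =>
    WithLp.toLp 2 ((k.1.2.memLp_pderiv k.2).star.toLp _, G k.1 k.2), fun p => ?_⟩
  have key : ∀ (η : {η : Pt d → ℂ // IsTest D η}) (i : Fin d),
      (∫ x in D, p.fst x * pderiv i η.1 x = - ∫ x in D, p.snd x i * η.1 x) ↔
      inner ℂ (WithLp.toLp 2 ((η.2.memLp_pderiv i).star.toLp _, G η i) : L2Pair D) p = 0 := by
    intro η i
    rw [WithLp.prod_inner_apply, integral_mul_eq_inner (η.2.memLp_pderiv i), hG η i,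
      eq_neg_iff_add_eq_zero]
    exact Iff.rfl
  constructor
  · rintro h ⟨η, i⟩
    exact (key η i).1 (h η.1 η.2 i)
  · intro h η hη i
    exact (key ⟨η, hη⟩ i).2 (h (⟨η, hη⟩, i))

/-- The Sobolev space `H¹(D)`, with `‖u‖²_{H¹} = ‖u‖²_{L²} + ‖∇u‖²_{L²}`. -/
def H1 {d : ℕ} (D : Set (Pt d)) : Submodule ℂ (L2Pair D) where
  carrier := {p | IsWeakGrad D p.fst p.snd}
  zero_mem' := by
    obtain ⟨ι, F, hF⟩ := isWeakGrad_iff (D := D)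
    exact (hF 0).2 fun k => inner_zero_right _
  add_mem' := by
    intro p q hp hq
    obtain ⟨ι, F, hF⟩ := isWeakGrad_iff (D := D)
    refine (hF (p + q)).2 fun k => ?_
    rw [inner_add_right, (hF p).1 hp k, (hF q).1 hq k, add_zero]
  smul_mem' := by
    intro c p hp
    obtain ⟨ι, F, hF⟩ := isWeakGrad_iff (D := D)
    refine (hF (c • p)).2 fun k => ?_
    rw [inner_smul_right, (hF p).1 hp k, mul_zero]

theorem isClosed_H1 {d : ℕ} (D : Set (Pt d)) : IsClosed (H1 D : Set (L2Pair D)) := by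
  obtain ⟨ι, F, hF⟩ := isWeakGrad_iff (D := D)
  have : (H1 D : Set (L2Pair D)) = ⋂ k, {p | inner ℂ (F k) p = 0} := by
    ext p
    simp only [Set.mem_iInter, Set.mem_ofPred_eq]
    exact hF p
  rw [this]
  exact isClosed_iInter fun k =>
    isClosed_eq (continuous_const.inner continuous_id) continuous_const

/-- The test functions, together with their gradients, as a subspace of `H¹(D)`. -/
def testSubspace {d : ℕ} (D : Set (Pt d)) : Submodule ℂ (L2Pair D) :=
  Submodule.span ℂ {p | ∃ η : Pt d → ℂ, IsTest D η ∧ p.fst =ᵐ[leb D] η ∧ p.snd =ᵐ[leb D] grad η}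

/-- `H¹₀(D)`, the closure of the test functions in the `H¹` norm. -/
def H10 {d : ℕ} (D : Set (Pt d)) : Submodule ℂ (L2Pair D) :=
  (testSubspace D).topologicalClosure

/-- The variational space `X(D) = {(w, v) ∈ H¹(D) × H¹(D) : w - v ∈ H¹₀(D)}`. -/
def XSub {d : ℕ} (D : Set (Pt d)) : Submodule ℂ (WithLp 2 (L2Pair D × L2Pair D)) where
  carrier := {p | p.fst ∈ H1 D ∧ p.snd ∈ H1 D ∧ p.fst - p.snd ∈ H10 D}
  zero_mem' := ⟨(H1 D).zero_mem, (H1 D).zero_mem, by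
    simp⟩
  add_mem' := by
    rintro p q ⟨hp1, hp2, hp3⟩ ⟨hq1, hq2, hq3⟩
    refine ⟨(H1 D).add_mem hp1 hq1, (H1 D).add_mem hp2 hq2, ?_⟩
    have := (H10 D).add_mem hp3 hq3
    rwa [← add_sub_add_comm] at this
  smul_mem' := by
    rintro c p ⟨hp1, hp2, hp3⟩
    refine ⟨(H1 D).smul_mem c hp1, (H1 D).smul_mem c hp2, ?_⟩
    have := (H10 D).smul_mem c hp3
    rwa [smul_sub] at this

theorem isClosed_XSub {d : ℕ} (D : Set (Pt d)) :
    IsClosed (XSub D : Set (WithLp 2 (L2Pair D × L2Pair D))) := by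
  have h1 : Continuous fun p : WithLp 2 (L2Pair D × L2Pair D) => p.fst :=
    (WithLp.fstL 2 ℂ (L2Pair D) (L2Pair D)).continuous
  have h2 : Continuous fun p : WithLp 2 (L2Pair D × L2Pair D) => p.snd :=
    (WithLp.sndL 2 ℂ (L2Pair D) (L2Pair D)).continuous
  exact ((isClosed_H1 D).preimage h1).inter (((isClosed_H1 D).preimage h2).inter
    ((testSubspace D).isClosed_topologicalClosure.preimage (h1.sub h2)))

/-- `X(D)` with the inner product of `H¹(D) × H¹(D)`. -/
def X {d : ℕ} (D : Set (Pt d)) : Type := XSub D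

instance {d : ℕ} (D : Set (Pt d)) : NormedAddCommGroup (X D) :=
  inferInstanceAs (NormedAddCommGroup (XSub D))

instance {d : ℕ} (D : Set (Pt d)) : InnerProductSpace ℂ (X D) :=
  inferInstanceAs (InnerProductSpace ℂ (XSub D))

instance {d : ℕ} (D : Set (Pt d)) : CompleteSpace (X D) :=
  (isClosed_XSub D).completeSpace_coe

section components
variable {d : ℕ} {D : Set (Pt d)}

/-- The isometric inclusion of `X(D)` in the product of two spaces `L²(D; ℂ) × L²(D; ℂ^d)`. -/
def X.incl : X D →ₗᵢ[ℂ] WithLp 2 (L2Pair D × L2Pair D) := (XSub D).subtypeₗᵢ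

/-- The component `(w, v) ↦ w`. -/
def X.w : X D →L[ℂ] Lp ℂ 2 (leb D) :=
  WithLp.fstL 2 ℂ (Lp ℂ 2 (leb D)) (Lp (CVec d) 2 (leb D)) ∘L
    WithLp.fstL 2 ℂ (L2Pair D) (L2Pair D) ∘L X.incl.toContinuousLinearMap

/-- The component `(w, v) ↦ ∇w`. -/
def X.dw : X D →L[ℂ] Lp (CVec d) 2 (leb D) :=
  WithLp.sndL 2 ℂ (Lp ℂ 2 (leb D)) (Lp (CVec d) 2 (leb D)) ∘L
    WithLp.fstL 2 ℂ (L2Pair D) (L2Pair D) ∘L X.incl.toContinuousLinearMap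

/-- The component `(w, v) ↦ v`. -/
def X.v : X D →L[ℂ] Lp ℂ 2 (leb D) :=
  WithLp.fstL 2 ℂ (Lp ℂ 2 (leb D)) (Lp (CVec d) 2 (leb D)) ∘L
    WithLp.sndL 2 ℂ (L2Pair D) (L2Pair D) ∘L X.incl.toContinuousLinearMap

/-- The component `(w, v) ↦ ∇v`. -/
def X.dv : X D →L[ℂ] Lp (CVec d) 2 (leb D) :=
  WithLp.sndL 2 ℂ (Lp ℂ 2 (leb D)) (Lp (CVec d) 2 (leb D)) ∘L
    WithLp.sndL 2 ℂ (L2Pair D) (L2Pair D) ∘L X.incl.toContinuousLinearMap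

end components

/-! ### Sesquilinear forms and operators -/

/-- The product `M ξ` of a real matrix and a complex vector. -/
def matVec {d : ℕ} (M : Matrix (Fin d) (Fin d) ℝ) (ξ : CVec d) : CVec d :=
  WithLp.toLp 2 fun i => ∑ j, (M i j : ℂ) * ξ j

/-- The product `ξ · conj η`. -/
def dotConj {d : ℕ} (ξ η : CVec d) : ℂ := ∑ i, ξ i * conj (η i)

/-- `inf_{|ξ| = 1} conj ξ · M ξ`. -/
def lowerBd {d : ℕ} (M : Matrix (Fin d) (Fin d) ℝ) : ℝ :=
  ⨅ ξ : Metric.sphere (0 : CVec d) 1, (dotConj (matVec M ξ) ξ).re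

/-- `sup_{|ξ| = 1} conj ξ · M ξ`. -/
def upperBd {d : ℕ} (M : Matrix (Fin d) (Fin d) ℝ) : ℝ :=
  ⨆ ξ : Metric.sphere (0 : CVec d) 1, (dotConj (matVec M ξ) ξ).re

/-- `𝒜((w,v);(φ₁,φ₂)) = ∫_D a∇w·∇φ̄₁ + κ w φ̄₁ dx - ∫_D ∇v·∇φ̄₂ + v φ̄₂ dx`
for the matrix field `a`. -/
def formA {d : ℕ} (D : Set (Pt d)) (a : Pt d → Matrix (Fin d) (Fin d) ℝ) (κ : ℝ) (f φ : X D) : ℂ :=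
  (∫ x in D, dotConj (matVec (a x) (X.dw f x)) (X.dw φ x) + κ * X.w f x * conj (X.w φ x)) -
    ∫ x in D, dotConj (X.dv f x) (X.dv φ x) + X.v f x * conj (X.v φ x)

/-- `((w,v);(φ₁,φ₂)) ↦ ∫_D m w φ̄₁ - v φ̄₂ dx` for a constant `m`. For `m = n` this is the form
`ℬ₀`, and for `m = κ` it is the form `𝒞`. -/
def formL {d : ℕ} (D : Set (Pt d)) (m : ℝ) (f φ : X D) : ℂ :=
  ∫ x in D, m * X.w f x * conj (X.w φ x) - X.v f x * conj (X.v φ x)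

open Classical in
/-- The bounded operator `T` on `X(D)` with `(T f, φ)_{X(D)} = s(f; φ)` for all `f, φ` (inner
products are conjugate linear in their first argument in Mathlib). The value `0` is used only
if there is no such operator. -/
def rieszOp {d : ℕ} {D : Set (Pt d)} (s : X D → X D → ℂ) : X D →L[ℂ] X D :=
  if h : ∃ T : X D →L[ℂ] X D, ∀ f φ : X D, inner ℂ φ (T f) = s f φ then h.choose else 0

/-- The operator `𝐀` for the matrix field `a`. -/
def opA {d : ℕ} (D : Set (Pt d)) (a : Pt d → Matrix (Fin d) (Fin d) ℝ) (κ : ℝ) : X D →L[ℂ] X D :=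
  rieszOp (formA D a κ)

/-- The operator `𝐁₀`. -/
def opB {d : ℕ} (D : Set (Pt d)) (n : ℝ) : X D →L[ℂ] X D := rieszOp (formL D n)

/-- The operator `𝐂`. -/
def opC {d : ℕ} (D : Set (Pt d)) (κ : ℝ) : X D →L[ℂ] X D := rieszOp (formL D κ)

/-- The operator `𝐓(τ) = 𝐀⁻¹ 𝐁₀ + τ⁻¹ 𝐀⁻¹ 𝐂`. -/
def opT {d : ℕ} (D : Set (Pt d)) (a : Pt d → Matrix (Fin d) (Fin d) ℝ) (κ n : ℝ) (τ : ℂ) :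
    X D →L[ℂ] X D :=
  (opA D a κ).inverse ∘L opB D n + (1 / τ) • ((opA D a κ).inverse ∘L opC D κ)

/-! ### The perturbed medium -/

/-- `B` is a smooth deformation of a ball centered at the origin: the image of such a ball under
a `C^∞` diffeomorphism of `ℝ^d`. -/
def IsSmoothBall {d : ℕ} (B : Set (Pt d)) : Prop :=
  ∃ (Φ : Pt d ≃ₜ Pt d) (r : ℝ), ContDiff ℝ ∞ Φ ∧ ContDiff ℝ ∞ Φ.symm ∧ 0 < r ∧
    B = Φ '' Metric.ball 0 r

/-- The defective region `z + ε B`. -/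
def defect {d : ℕ} (z : Pt d) (B : Set (Pt d)) (ε : ℝ) : Set (Pt d) := (fun y => z + ε • y) '' B

/-- The coefficient `A_ε`: the matrix `A_m` in `z_m + ε B_m`, and `A` outside these regions. (It is
written as a sum of indicator functions; for small `ε` the regions are pairwise disjoint.) -/
def coeff {d M : ℕ} (A : Matrix (Fin d) (Fin d) ℝ) (Am : Fin M → Matrix (Fin d) (Fin d) ℝ)
    (z : Fin M → Pt d) (B : Fin M → Set (Pt d)) (ε : ℝ) (x : Pt d) : Matrix (Fin d) (Fin d) ℝ :=
  A + ∑ m, (defect (z m) (B m) ε).indicator (fun _ => Am m - A) x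

/-! ### The operators do represent the forms -/

theorem dotConj_eq_inner {d : ℕ} (ξ η : CVec d) : dotConj ξ η = inner ℂ η ξ := by
  simp [dotConj, PiLp.inner_apply, RCLike.inner_apply]

theorem norm_matVec_le {d : ℕ} {M : Matrix (Fin d) (Fin d) ℝ} {K : ℝ} (hK : 0 ≤ K)
    (hM : ∀ i j, |M i j| ≤ K) (ξ : CVec d) : ‖matVec M ξ‖ ≤ (d * (d * K)) * ‖ξ‖ := by
  have h1 : ∀ i, ‖matVec M ξ i‖ ≤ d * K * ‖ξ‖ := by
    intro i
    simp only [matVec]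
    refine (norm_sum_le _ _).trans ?_
    refine (Finset.sum_le_sum (g := fun _ => K * ‖ξ‖) fun j _ => ?_).trans ?_
    · rw [norm_mul, Complex.norm_real]
      exact mul_le_mul (hM i j) (PiLp.norm_apply_le ξ j) (norm_nonneg _) hK
    · simp [mul_assoc]
  have h2 : matVec M ξ = ∑ i, EuclideanSpace.single i (matVec M ξ i) := by
    ext k
    simp [Pi.single_apply]
  rw [h2]
  refine (norm_sum_le _ _).trans ?_
  refine (Finset.sum_le_sum (g := fun _ => d * K * ‖ξ‖) fun i _ => ?_).trans ?_
  · simpa using h1 i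
  · simp [mul_assoc]

theorem matVec_add {d : ℕ} (M : Matrix (Fin d) (Fin d) ℝ) (ξ η : CVec d) :
    matVec M (ξ + η) = matVec M ξ + matVec M η := by
  ext i
  simp [matVec, mul_add, Finset.sum_add_distrib]

theorem matVec_smul {d : ℕ} (M : Matrix (Fin d) (Fin d) ℝ) (c : ℂ) (ξ : CVec d) :
    matVec M (c • ξ) = c • matVec M ξ := by
  ext i
  simp only [matVec, PiLp.smul_apply, smul_eq_mul, Finset.mul_sum]
  exact Finset.sum_congr rfl fun j _ => by ring

/-- Multiplication by a bounded measurable matrix field is bounded on `L²(D; ℂ^d)`. -/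
theorem exists_mulField {d : ℕ} (D : Set (Pt d)) (a : Pt d → Matrix (Fin d) (Fin d) ℝ)
    (ha : ∀ i j, Measurable fun x => a x i j) {K : ℝ} (hK : ∀ x i j, |a x i j| ≤ K) :
    ∃ N : Lp (CVec d) 2 (leb D) →L[ℂ] Lp (CVec d) 2 (leb D),
      ∀ g, N g =ᵐ[leb D] fun x => matVec (a x) (g x) := by
  have hK' : ∀ x (ξ : CVec d), ‖matVec (a x) ξ‖ ≤ (d * (d * max K 0)) * ‖ξ‖ := fun x ξ =>
    norm_matVec_le (le_max_right _ _) (fun i j => (hK x i j).trans (le_max_left _ _)) ξ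
  have hm : ∀ g : Lp (CVec d) 2 (leb D), MemLp (fun x => matVec (a x) (g x)) 2 (leb D) := by
    intro g
    refine (Lp.memLp g).of_le_mul (c := d * (d * max K 0)) ?_
      (Eventually.of_forall fun x => hK' x _)
    have hg : Measurable (g : Pt d → CVec d) := (Lp.stronglyMeasurable g).measurable
    refine Measurable.aestronglyMeasurable ?_
    refine (PiLp.continuous_toLp 2 _).measurable.comp (measurable_pi_lambda _ fun i => ?_)
    refine Finset.measurable_sum _ fun j _ => ?_
    refine (Complex.measurable_ofReal.comp (ha i j)).mul ?_
    exact (PiLp.continuous_apply 2 _ j).measurable.comp hg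
  let L : Lp (CVec d) 2 (leb D) →ₗ[ℂ] Lp (CVec d) 2 (leb D) :=
    { toFun := fun g => (hm g).toLp _
      map_add' := by
        intro f g
        apply Lp.ext
        filter_upwards [(hm (f + g)).coeFn_toLp, Lp.coeFn_add f g, (hm f).coeFn_toLp,
          (hm g).coeFn_toLp, Lp.coeFn_add ((hm f).toLp _) ((hm g).toLp _)] with x h1 h2 h3 h4 h5
        rw [h1, h5, h2, Pi.add_apply, Pi.add_apply, h3, h4, matVec_add]
      map_smul' := by
        intro c f
        apply Lp.ext
        filter_upwards [(hm (c • f)).coeFn_toLp, Lp.coeFn_smul c f, (hm f).coeFn_toLp,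
          Lp.coeFn_smul c ((hm f).toLp _)] with x h1 h2 h3 h5
        simp only [RingHom.id_apply]
        rw [h1, h5, h2, Pi.smul_apply, Pi.smul_apply, h3, matVec_smul] }
  refine ⟨L.mkContinuous (d * (d * max K 0)) fun g => ?_, fun g => (hm g).coeFn_toLp⟩
  refine Lp.norm_le_mul_norm_of_ae_le_mul ?_
  filter_upwards [(hm g).coeFn_toLp] with x hx
  change ‖(hm g).toLp _ x‖ ≤ _
  rw [hx]
  exact hK' x _

theorem rieszOp_spec {d : ℕ} {D : Set (Pt d)} {s : X D → X D → ℂ}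
    (h : ∃ T : X D →L[ℂ] X D, ∀ f φ : X D, inner ℂ φ (T f) = s f φ) (f φ : X D) :
    inner ℂ φ (rieszOp s f) = s f φ := by
  classical
  rw [rieszOp, dif_pos h]
  exact h.choose_spec f φ

theorem inner_L2_eq {d : ℕ} {D : Set (Pt d)} (u p : Lp ℂ 2 (leb D)) :
    inner ℂ p u = ∫ x in D, u x * conj (p x) := by
  rw [L2.inner_def]
  simp [RCLike.inner_apply]

theorem inner_L2vec_eq {d : ℕ} {D : Set (Pt d)} (u p : Lp (CVec d) 2 (leb D)) :
    inner ℂ p u = ∫ x in D, dotConj (u x) (p x) := by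
  rw [L2.inner_def]
  simp [dotConj_eq_inner]

theorem integrable_L2 {d : ℕ} {D : Set (Pt d)} (u p : Lp ℂ 2 (leb D)) :
    Integrable (fun x => u x * conj (p x)) (leb D) := by
  simpa [RCLike.inner_apply] using L2.integrable_inner (𝕜 := ℂ) p u

theorem integrable_L2vec {d : ℕ} {D : Set (Pt d)} (u p : Lp (CVec d) 2 (leb D)) :
    Integrable (fun x => dotConj (u x) (p x)) (leb D) := by
  simpa [dotConj_eq_inner] using L2.integrable_inner (𝕜 := ℂ) p u

/-- For a bounded measurable matrix field, `𝐀` represents the form `𝒜`. -/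
theorem inner_opA {d : ℕ} (D : Set (Pt d)) (a : Pt d → Matrix (Fin d) (Fin d) ℝ) (κ : ℝ)
    (ha : ∀ i j, Measurable fun x => a x i j) {K : ℝ} (hK : ∀ x i j, |a x i j| ≤ K) (f φ : X D) :
    inner ℂ φ (opA D a κ f) = formA D a κ f φ := by
  refine rieszOp_spec ?_ f φ
  obtain ⟨N, hN⟩ := exists_mulField D a ha hK
  refine ⟨ContinuousLinearMap.adjoint X.dw ∘L N ∘L X.dw + (κ : ℂ) • (ContinuousLinearMap.adjoint X.w ∘L X.w)
    - (ContinuousLinearMap.adjoint X.dv ∘L X.dv + ContinuousLinearMap.adjoint X.v ∘L X.v), fun f φ => ?_⟩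
  have hN' : (fun x => dotConj (N (X.dw f) x) (X.dw φ x)) =ᵐ[leb D]
      fun x => dotConj (matVec (a x) (X.dw f x)) (X.dw φ x) := by
    filter_upwards [hN (X.dw f)] with x hx
    rw [hx]
  simp only [_root_.sub_apply, _root_.add_apply,
    _root_.smul_apply, ContinuousLinearMap.comp_apply, inner_sub_right,
    inner_add_right, inner_smul_right, ContinuousLinearMap.adjoint_inner_right]
  rw [inner_L2_eq, inner_L2_eq, inner_L2vec_eq, inner_L2vec_eq, formA,
    integral_add (integrable_L2vec _ _) (integrable_L2 _ _), integral_congr_ae hN']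
  congr 1
  simp_rw [mul_assoc]
  rw [integral_add ((integrable_L2vec _ _).congr hN') ((integrable_L2 _ _).const_mul _),
    integral_const_mul]

/-- `𝐁₀` and `𝐂` represent the forms `ℬ₀` and `𝒞`. -/
theorem inner_opL {d : ℕ} (D : Set (Pt d)) (m : ℝ) (f φ : X D) :
    inner ℂ φ (rieszOp (formL D m) f) = formL D m f φ := by
  refine rieszOp_spec ?_ f φ
  refine ⟨(m : ℂ) • (ContinuousLinearMap.adjoint X.w ∘L X.w) - ContinuousLinearMap.adjoint X.v ∘L X.v, fun f φ => ?_⟩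
  simp only [_root_.sub_apply,
    _root_.smul_apply, ContinuousLinearMap.comp_apply, inner_sub_right,
    inner_smul_right, ContinuousLinearMap.adjoint_inner_right]
  rw [inner_L2_eq, inner_L2_eq, formL]
  simp_rw [mul_assoc]
  rw [integral_sub ((integrable_L2 _ _).const_mul _) (integrable_L2 _ _), integral_const_mul]

theorem measurableSet_defect {d : ℕ} (z : Pt d) {B : Set (Pt d)} (hB : IsSmoothBall B) (ε : ℝ) :
    MeasurableSet (defect z B ε) := by
  obtain ⟨Φ, r, -, -, -, rfl⟩ := hB
  rcases eq_or_ne ε 0 with rfl | hε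
  · refine Set.Subsingleton.measurableSet ?_
    rintro _ ⟨y, -, rfl⟩ _ ⟨y', -, rfl⟩
    simp
  · have h : IsOpenMap fun y : Pt d => z + ε • y :=
      (isOpenMap_add_left z).comp (isOpenMap_smul₀ hε)
    exact (h _ (Φ.isOpenMap _ Metric.isOpen_ball)).measurableSet

/-- The coefficient `A_ε` is bounded and measurable, so that `𝐀_ε` represents its form. -/
theorem inner_opA_coeff {d M : ℕ} (D : Set (Pt d)) (A : Matrix (Fin d) (Fin d) ℝ)
    (Am : Fin M → Matrix (Fin d) (Fin d) ℝ) (z : Fin M → Pt d) (B : Fin M → Set (Pt d))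
    (hB : ∀ m, IsSmoothBall (B m)) (κ ε : ℝ) (f φ : X D) :
    inner ℂ φ (opA D (coeff A Am z B ε) κ f) = formA D (coeff A Am z B ε) κ f φ := by
  have hval : ∀ x i j, coeff A Am z B ε x i j =
      A i j + ∑ m, (defect (z m) (B m) ε).indicator (fun _ => Am m i j - A i j) x := by
    intro x i j
    simp only [coeff, Matrix.add_apply, Matrix.sum_apply]
    congr 1
    refine Finset.sum_congr rfl fun m _ => ?_
    by_cases hx : x ∈ defect (z m) (B m) ε <;> simp [hx]
  refine inner_opA D _ κ (fun i j => ?_)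
    (K := ∑ i, ∑ j, (|A i j| + ∑ m, |Am m i j - A i j|)) (fun x i j => ?_) f φ
  · simp_rw [hval]
    exact measurable_const.add (Finset.measurable_sum _ fun m _ =>
      measurable_const.indicator (measurableSet_defect (z m) (hB m) ε))
  · have hpos : ∀ i j, 0 ≤ |A i j| + ∑ m, |Am m i j - A i j| := fun i j =>
      add_nonneg (abs_nonneg _) (Finset.sum_nonneg fun m _ => abs_nonneg _)
    refine le_trans ?_ (Finset.single_le_sum (fun i _ => Finset.sum_nonneg fun j _ => hpos i j)
      (Finset.mem_univ i))
    refine le_trans ?_ (Finset.single_le_sum (fun j _ => hpos i j) (Finset.mem_univ j))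
    rw [hval]
    refine (abs_add_le _ _).trans (add_le_add_right ?_ _)
    refine (Finset.abs_sum_le_sum_abs _ _).trans (Finset.sum_le_sum fun m _ => ?_)
    by_cases hx : x ∈ defect (z m) (B m) ε <;> simp [hx]

end TransmissionEig

end

/-!
The operators `A_ε` are self-adjoint and, by T-coercivity (testing against `(w, -v + 2w)` or
`(w - 2v, -v)` according to the sign of the contrast), boundedly invertible uniformly in `ε`. Write
`S = B₀ + τ⁻¹ C`, `f = A₀⁻¹ S g`, `f' = A_ε⁻¹ S g` and `u = A₀⁻¹ φ`. Pairing `g` with the difference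
of the two adjoints applied to `φ` gives `-⟪u, (A_ε - A₀) f'⟫` up to conjugation, and `A_ε - A₀`
only sees the gradients of the first components on the union `Ω` of the defects, so that this is
at most `K ‖∇w(f')‖_Ω ‖∇w(u)‖_Ω`. Uniform stability allows `f'` to be replaced by `f`. Both `f` and
`u` solve constant-coefficient equations, with data in `H¹` and smooth data respectively, and
`H² ⊆ L^∞` for `d ≤ 3`; hence their gradients are bounded near the points `z_m`, by a multiple of
`‖g‖` and by a constant. The pairing is therefore at most a multiple of `|Ω| ‖g‖`, which is
`O(ε ^ d) ‖g‖`, and `d / 2 + 1 ≤ d` because `2 ≤ d`.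
-/

noncomputable section

namespace TransmissionEig

section matrices

variable {d : ℕ}

theorem sub_matVec (M N : Matrix (Fin d) (Fin d) ℝ) (ξ : CVec d) :
    matVec (M - N) ξ = matVec M ξ - matVec N ξ := by
  ext i
  simp [matVec, sub_mul, Finset.sum_sub_distrib]

theorem dotConj_matVec_comm {M : Matrix (Fin d) (Fin d) ℝ} (hM : M.IsSymm) (ξ η : CVec d) :
    dotConj (matVec M ξ) η = conj (dotConj (matVec M η) ξ) := by
  simp only [dotConj, matVec, map_sum, map_mul, Complex.conj_conj, Complex.conj_ofReal,
    Finset.sum_mul]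
  rw [Finset.sum_comm]
  refine Finset.sum_congr rfl fun i _ => Finset.sum_congr rfl fun j _ => ?_
  rw [hM.apply i j]
  ring

theorem norm_dotConj_le (ξ η : CVec d) : ‖dotConj ξ η‖ ≤ ‖ξ‖ * ‖η‖ := by
  rw [dotConj_eq_inner, mul_comm]
  exact norm_inner_le_norm _ _

theorem exists_norm_matVec_le (A : Matrix (Fin d) (Fin d) ℝ) :
    ∃ K : ℝ, 0 ≤ K ∧ ∀ ξ : CVec d, ‖matVec A ξ‖ ≤ K * ‖ξ‖ := by
  have hentry : ∀ i j, |A i j| ≤ ∑ i, ∑ j, |A i j| := fun i j =>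
    (Finset.single_le_sum (f := fun j => |A i j|) (fun _ _ => abs_nonneg _)
      (Finset.mem_univ j)).trans (Finset.single_le_sum (f := fun i => ∑ j, |A i j|)
        (fun _ _ => Finset.sum_nonneg fun _ _ => abs_nonneg _) (Finset.mem_univ i))
  have hsum : 0 ≤ ∑ i, ∑ j, |A i j| :=
    Finset.sum_nonneg fun _ _ => Finset.sum_nonneg fun _ _ => abs_nonneg _
  exact ⟨_, by positivity, fun ξ => norm_matVec_le hsum hentry ξ⟩

theorem exists_abs_re_dotConj_matVec_le (M : Matrix (Fin d) (Fin d) ℝ) :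
    ∃ K : ℝ, ∀ ξ : Metric.sphere (0 : CVec d) 1, |(dotConj (matVec M ξ) ξ).re| ≤ K := by
  obtain ⟨K, -, hK⟩ := exists_norm_matVec_le M
  refine ⟨K, fun ξ => (Complex.abs_re_le_norm _).trans ((norm_dotConj_le _ _).trans ?_)⟩
  have hξ : ‖(ξ : CVec d)‖ = 1 := mem_sphere_zero_iff_norm.1 ξ.2
  simpa [hξ] using hK ξ

theorem exists_re_dotConj_matVec_eq_norm_sq_mul (M : Matrix (Fin d) (Fin d) ℝ) {ξ : CVec d}
    (hξ : ξ ≠ 0) : ∃ ζ : Metric.sphere (0 : CVec d) 1,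
      (dotConj (matVec M ξ) ξ).re = ‖ξ‖ ^ 2 * (dotConj (matVec M ζ) ζ).re := by
  have hζ : (((‖ξ‖ : ℝ) : ℂ)⁻¹ • ξ) ∈ Metric.sphere (0 : CVec d) 1 := by
    rw [mem_sphere_zero_iff_norm, norm_smul, norm_inv, Complex.norm_real, norm_norm,
      inv_mul_cancel₀ (norm_ne_zero_iff.2 hξ)]
  refine ⟨⟨_, hζ⟩, ?_⟩
  simp only [matVec_smul, dotConj_eq_inner, inner_smul_left, inner_smul_right,
    Complex.conj_ofReal, ← Complex.ofReal_inv, Complex.re_ofReal_mul]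
  field_simp [norm_ne_zero_iff.2 hξ]

theorem lowerBd_mul_le (M : Matrix (Fin d) (Fin d) ℝ) (ξ : CVec d) :
    lowerBd M * ‖ξ‖ ^ 2 ≤ (dotConj (matVec M ξ) ξ).re := by
  rcases eq_or_ne ξ 0 with rfl | hξ
  · simp [dotConj]
  obtain ⟨ζ, hζ⟩ := exists_re_dotConj_matVec_eq_norm_sq_mul M hξ
  obtain ⟨K, hK⟩ := exists_abs_re_dotConj_matVec_le M
  rw [hζ, mul_comm]
  exact mul_le_mul_of_nonneg_left
    (ciInf_le ⟨-K, by rintro _ ⟨ξ, rfl⟩; exact (abs_le.1 (hK ξ)).1⟩ ζ) (by positivity)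

theorem le_upperBd_mul (M : Matrix (Fin d) (Fin d) ℝ) (ξ : CVec d) :
    (dotConj (matVec M ξ) ξ).re ≤ upperBd M * ‖ξ‖ ^ 2 := by
  rcases eq_or_ne ξ 0 with rfl | hξ
  · simp [dotConj]
  obtain ⟨ζ, hζ⟩ := exists_re_dotConj_matVec_eq_norm_sq_mul M hξ
  obtain ⟨K, hK⟩ := exists_abs_re_dotConj_matVec_le M
  rw [hζ, mul_comm (upperBd M)]
  exact mul_le_mul_of_nonneg_left
    (le_ciSup (f := fun ξ : Metric.sphere (0 : CVec d) 1 => (dotConj (matVec M ξ) ξ).re)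
      ⟨K, by rintro _ ⟨ξ, rfl⟩; exact (abs_le.1 (hK ξ)).2⟩ ζ) (by positivity)

theorem lowerBd_le_upperBd [NeZero d] (M : Matrix (Fin d) (Fin d) ℝ) :
    lowerBd M ≤ upperBd M := by
  simpa using (lowerBd_mul_le M (EuclideanSpace.single 0 1)).trans
    (le_upperBd_mul M (EuclideanSpace.single 0 1))

theorem lowerBd_mul_le_sum (M : Matrix (Fin d) (Fin d) ℝ) (ξ : Pt d) :
    lowerBd M * ‖ξ‖ ^ 2 ≤ ∑ i, ∑ j, M i j * ξ i * ξ j := by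
  convert lowerBd_mul_le M (WithLp.toLp 2 fun i => (ξ i : ℂ)) using 1
  · simp [EuclideanSpace.norm_sq_eq]
  · simp only [dotConj, matVec, Complex.conj_ofReal, Finset.sum_mul, Complex.re_sum]
    refine Finset.sum_congr rfl fun i _ => Finset.sum_congr rfl fun j _ => ?_
    rw [← Complex.ofReal_mul, ← Complex.ofReal_mul, Complex.ofReal_re]
    ring

end matrices

section derivatives

variable {d : ℕ}

theorem contDiff_pderiv {η : Pt d → ℂ} (h : ContDiff ℝ ∞ η) (i : Fin d) :
    ContDiff ℝ ∞ (pderiv i η) :=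
  (h.fderiv_right (m := ∞) (by simp)).clm_apply contDiff_const

theorem tsupport_pderiv_subset (i : Fin d) (η : Pt d → ℂ) : tsupport (pderiv i η) ⊆ tsupport η :=
  (closure_mono fun _ => mt fun h => by simp [pderiv, h]).trans (tsupport_fderiv_subset ℝ)

theorem hasCompactSupport_pderiv {η : Pt d → ℂ} (hc : HasCompactSupport η) (i : Fin d) :
    HasCompactSupport (pderiv i η) :=
  hc.mono' ((subset_tsupport _).trans (tsupport_pderiv_subset i η))

theorem IsTest.pderiv {D : Set (Pt d)} {η : Pt d → ℂ} (h : IsTest D η) (i : Fin d) :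
    IsTest D (pderiv i η) :=
  ⟨contDiff_pderiv h.1 i, hasCompactSupport_pderiv h.2.1 i,
    (tsupport_pderiv_subset i η).trans h.2.2⟩

theorem continuous_grad {η : Pt d → ℂ} (h : ContDiff ℝ ∞ η) : Continuous (grad η) :=
  (PiLp.continuous_toLp 2 _).comp (continuous_pi fun i => continuous_pderiv h i)

theorem norm_pderiv_le_norm_grad (η : Pt d → ℂ) (i : Fin d) (x : Pt d) :
    ‖pderiv i η x‖ ≤ ‖grad η x‖ :=
  PiLp.norm_apply_le (grad η x) i

theorem tsupport_grad_subset (η : Pt d → ℂ) : tsupport (grad η) ⊆ tsupport η := by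
  refine closure_minimal (fun x hx => ?_) (isClosed_tsupport η)
  contrapose! hx
  rw [Function.notMem_support]
  ext i
  exact image_eq_zero_of_notMem_tsupport (f := pderiv i η)
    fun h => hx (tsupport_pderiv_subset i η h)

theorem hasCompactSupport_grad {η : Pt d → ℂ} (hc : HasCompactSupport η) :
    HasCompactSupport (grad η) :=
  hc.mono' ((subset_tsupport _).trans (tsupport_grad_subset η))

theorem pderiv_add {f g : Pt d → ℂ} {x : Pt d} (hf : DifferentiableAt ℝ f x)
    (hg : DifferentiableAt ℝ g x) (i : Fin d) :
    pderiv i (fun y => f y + g y) x = pderiv i f x + pderiv i g x := by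
  simp [pderiv, fderiv_fun_add hf hg]

theorem pderiv_mul {f g : Pt d → ℂ} {x : Pt d} (hf : DifferentiableAt ℝ f x)
    (hg : DifferentiableAt ℝ g x) (i : Fin d) :
    pderiv i (fun y => f y * g y) x = pderiv i f x * g x + f x * pderiv i g x := by
  simp only [pderiv, fderiv_fun_mul hf hg, _root_.add_apply, _root_.smul_apply, smul_eq_mul]
  ring

theorem grad_mul {f g : Pt d → ℂ} {x : Pt d} (hf : DifferentiableAt ℝ f x)
    (hg : DifferentiableAt ℝ g x) :
    grad (fun y => f y * g y) x = f x • grad g x + g x • grad f x := by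
  ext i
  simp only [grad, pderiv_mul hf hg, PiLp.add_apply, PiLp.smul_apply, smul_eq_mul]
  ring

theorem pderiv_conj (f : Pt d → ℂ) (i : Fin d) (x : Pt d) :
    pderiv i (fun y => conj (f y)) x = conj (pderiv i f x) := by
  have h : fderiv ℝ (fun y => conj (f y)) x = _ := Complex.conjCLE.comp_fderiv (f := f) (x := x)
  simp [pderiv, h]

theorem pderiv_comm {f : Pt d → ℂ} {x : Pt d} (hf : ContDiffAt ℝ 2 f x) (i j : Fin d) :
    pderiv i (pderiv j f) x = pderiv j (pderiv i f) x := by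
  have hdiff : DifferentiableAt ℝ (fderiv ℝ f) x :=
    (hf.fderiv_right (m := 1) (by norm_num)).differentiableAt one_ne_zero
  have hsnd : ∀ u v : Pt d,
      fderiv ℝ (fun y => fderiv ℝ f y u) x v = fderiv ℝ (fderiv ℝ f) x v u := by
    intro u v
    rw [fderiv_clm_apply hdiff (differentiableAt_const u)]
    simp
  change fderiv ℝ (fun y => fderiv ℝ f y _) x _ = fderiv ℝ (fun y => fderiv ℝ f y _) x _
  rw [hsnd, hsnd, hf.isSymmSndFDerivAt (by simp)]

theorem integral_mul_pderiv {f g : Pt d → ℂ} (hf : ContDiff ℝ 1 f) (hg : ContDiff ℝ 1 g)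
    (hc : HasCompactSupport g) (i : Fin d) :
    ∫ x, f x * pderiv i g x = - ∫ x, pderiv i f x * g x := by
  have hcont : ∀ {η : Pt d → ℂ}, ContDiff ℝ 1 η → Continuous (pderiv i η) := fun h =>
    (h.continuous_fderiv one_ne_zero).clm_apply continuous_const
  refine integral_mul_fderiv_eq_neg_fderiv_mul_of_integrable ?_ ?_ ?_
    (fun x _ => hf.differentiable one_ne_zero x) (fun x _ => hg.differentiable one_ne_zero x)
  · exact ((hcont hf).mul hg.continuous).integrable_of_hasCompactSupport hc.mul_left
  · exact (hf.continuous.mul (hcont hg)).integrable_of_hasCompactSupport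
      (hasCompactSupport_pderiv hc i).mul_left
  · exact (hf.continuous.mul hg.continuous).integrable_of_hasCompactSupport hc.mul_left

/-- The constant coefficient operator `k - ∑ i j, A i j ∂ᵢ∂ⱼ`. -/
def ellOp (A : Matrix (Fin d) (Fin d) ℝ) (k : ℝ) (η : Pt d → ℂ) (x : Pt d) : ℂ :=
  k * η x - ∑ i, ∑ j, (A i j : ℂ) * pderiv i (pderiv j η) x

theorem contDiff_ellOp (A : Matrix (Fin d) (Fin d) ℝ) (k : ℝ) {η : Pt d → ℂ}
    (h : ContDiff ℝ ∞ η) : ContDiff ℝ ∞ (ellOp A k η) :=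
  (contDiff_const.mul h).sub (ContDiff.sum fun i _ => ContDiff.sum fun j _ =>
    contDiff_const.mul (contDiff_pderiv (contDiff_pderiv h j) i))

theorem tsupport_ellOp_subset (A : Matrix (Fin d) (Fin d) ℝ) (k : ℝ) (η : Pt d → ℂ) :
    tsupport (ellOp A k η) ⊆ tsupport η := by
  refine closure_minimal (fun x hx => ?_) (isClosed_tsupport η)
  contrapose! hx
  have hη : η x = 0 := image_eq_zero_of_notMem_tsupport hx
  have hη₂ : ∀ i j, pderiv i (pderiv j η) x = 0 := fun i j =>
    image_eq_zero_of_notMem_tsupport fun h =>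
      hx (tsupport_pderiv_subset j η (tsupport_pderiv_subset i _ h))
  simp [ellOp, hη, hη₂]

theorem integral_mul_ellOp {μ : Measure (Pt d)} (A : Matrix (Fin d) (Fin d) ℝ) (k : ℝ)
    {G η : Pt d → ℂ} (h₀ : Integrable (fun x => G x * η x) μ)
    (h₂ : ∀ i j, Integrable (fun x => G x * pderiv i (pderiv j η) x) μ) :
    ∫ x, G x * ellOp A k η x ∂μ =
      k * ∫ x, G x * η x ∂μ - ∑ i, ∑ j, (A i j : ℂ) * ∫ x, G x * pderiv i (pderiv j η) x ∂μ := by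
  have hsum := fun i => integrable_finsetSum Finset.univ fun j _ => (h₂ i j).const_mul (A i j : ℂ)
  simp only [← integral_const_mul]
  simp_rw [← integral_finsetSum _ fun j _ => (h₂ _ j).const_mul (A _ j : ℂ)]
  rw [← integral_finsetSum _ fun i _ => hsum i,
    ← integral_sub (h₀.const_mul _) (integrable_finsetSum _ fun i _ => hsum i)]
  simp only [ellOp, mul_sub, Finset.mul_sum, mul_left_comm]

theorem ellOp_conj (A : Matrix (Fin d) (Fin d) ℝ) (k : ℝ) (η : Pt d → ℂ) (x : Pt d) :
    ellOp A k (fun y => conj (η y)) x = conj (ellOp A k η x) := by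
  simp only [ellOp, funext (pderiv_conj η _), pderiv_conj, map_sub, map_sum, map_mul,
    Complex.conj_ofReal]

theorem integral_mul_conj_ellOp_eq_integral_dotConj {μ : Measure (Pt d)}
    (A : Matrix (Fin d) (Fin d) ℝ) (k : ℝ) {u η : Pt d → ℂ} {g : Pt d → CVec d}
    (h₀ : Integrable (fun x => u x * conj (η x)) μ)
    (h₁ : ∀ i j, Integrable (fun x => g x j * conj (pderiv i η x)) μ)
    (h₂ : ∀ i j, Integrable (fun x => u x * conj (pderiv i (pderiv j η) x)) μ)
    (hparts : ∀ i j, ∫ x, u x * conj (pderiv i (pderiv j η) x) ∂μ =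
      -∫ x, g x j * conj (pderiv i η x) ∂μ) :
    ∫ x, u x * conj (ellOp A k η x) ∂μ =
      ∫ x, dotConj (matVec A (g x)) (grad η x) + k * u x * conj (η x) ∂μ := by
  have hsum := fun i => integrable_finsetSum Finset.univ fun j _ => (h₁ i j).const_mul (A i j : ℂ)
  have hform : ∀ x, dotConj (matVec A (g x)) (grad η x) + k * u x * conj (η x) =
      ∑ i, ∑ j, (A i j : ℂ) * (g x j * conj (pderiv i η x)) + k * (u x * conj (η x)) := fun x => by
    simp only [dotConj, matVec, grad, Finset.sum_mul, mul_assoc]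
  simp only [← ellOp_conj, hform]
  rw [integral_add (integrable_finsetSum _ fun i _ => hsum i) (h₀.const_mul _),
    integral_mul_ellOp A k h₀ (by simpa only [funext (pderiv_conj _ _), pderiv_conj] using h₂),
    integral_finsetSum _ fun i _ => hsum i, integral_const_mul, add_comm, sub_eq_add_neg,
    ← Finset.sum_neg_distrib]
  congr 1
  refine Finset.sum_congr rfl fun i _ => ?_
  rw [integral_finsetSum _ fun j _ => (h₁ i j).const_mul _, ← Finset.sum_neg_distrib]
  refine Finset.sum_congr rfl fun j _ => ?_
  simp only [funext (pderiv_conj _ _), pderiv_conj, hparts, integral_const_mul, mul_neg, neg_neg]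

end derivatives

section fourier

open SchwartzMap LineDeriv FourierTransform

variable {d : ℕ}

theorem fourier_lineDerivOp_apply (f : 𝓢(Pt d, ℂ)) (m ξ : Pt d) :
    𝓕 (∂_{m} f) ξ = (2 * Real.pi * Complex.I) * (inner ℝ ξ m : ℝ) * 𝓕 f ξ := by
  have : (inner ℝ · m : Pt d → ℝ).HasTemperateGrowth := by fun_prop
  rw [fourier_lineDerivOp_eq]
  simp [smulLeftCLM_apply_apply this, mul_assoc]

/-- `ellOp A k` as a map of the Schwartz space, where the Fourier transform is available. -/
def schwartzEllOp (A : Matrix (Fin d) (Fin d) ℝ) (k : ℝ) (f : 𝓢(Pt d, ℂ)) : 𝓢(Pt d, ℂ) :=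
  (k : ℂ) • f - ∑ i, ∑ j, (A i j : ℂ) •
    ∂_{(EuclideanSpace.single i 1 : Pt d)} (∂_{(EuclideanSpace.single j 1 : Pt d)} f)

theorem schwartzEllOp_apply (A : Matrix (Fin d) (Fin d) ℝ) (k : ℝ) (f : 𝓢(Pt d, ℂ)) (x : Pt d) :
    schwartzEllOp A k f x = ellOp A k f x := by
  simp only [schwartzEllOp, _root_.sub_apply, _root_.sum_apply, _root_.smul_apply, smul_eq_mul]
  rfl

theorem fourier_schwartzEllOp_apply (A : Matrix (Fin d) (Fin d) ℝ) (k : ℝ) (f : 𝓢(Pt d, ℂ))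
    (ξ : Pt d) : 𝓕 (schwartzEllOp A k f) ξ =
      ((k + (2 * Real.pi) ^ 2 * ∑ i, ∑ j, A i j * ξ i * ξ j : ℝ) : ℂ) * 𝓕 f ξ := by
  have hsecond : ∀ i j : Fin d,
      𝓕 (∂_{(EuclideanSpace.single i 1 : Pt d)} (∂_{(EuclideanSpace.single j 1 : Pt d)} f)) ξ =
        -((2 * Real.pi) ^ 2 * ξ i * ξ j : ℝ) * 𝓕 f ξ := by
    intro i j
    rw [fourier_lineDerivOp_apply, fourier_lineDerivOp_apply]
    simp only [EuclideanSpace.inner_single_right, one_mul, conj_trivial]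
    push_cast
    linear_combination (2 * Real.pi) ^ 2 * (ξ i : ℂ) * ξ j * 𝓕 f ξ * Complex.I_sq
  simp only [schwartzEllOp, ← fourierCLM_apply (R := ℂ), map_sub, map_smul, map_sum]
  simp only [fourierCLM_apply, _root_.sub_apply, _root_.sum_apply, _root_.smul_apply, smul_eq_mul,
    hsecond]
  push_cast
  simp only [add_mul, Finset.mul_sum, Finset.sum_mul, sub_eq_add_neg, ← Finset.sum_neg_distrib]
  congr 1
  exact Finset.sum_congr rfl fun i _ => Finset.sum_congr rfl fun j _ => by ring

theorem mul_one_add_norm_sq_le_symbol (A : Matrix (Fin d) (Fin d) ℝ) (k : ℝ) (hA : 0 ≤ lowerBd A)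
    (ξ : Pt d) :
    min k (lowerBd A) * (1 + ‖ξ‖ ^ 2) ≤
      k + (2 * Real.pi) ^ 2 * ∑ i, ∑ j, A i j * ξ i * ξ j := by
  have hpi : (1 : ℝ) ≤ (2 * Real.pi) ^ 2 := by nlinarith [Real.pi_gt_three]
  calc min k (lowerBd A) * (1 + ‖ξ‖ ^ 2)
      = min k (lowerBd A) + min k (lowerBd A) * ‖ξ‖ ^ 2 := by ring
    _ ≤ k + lowerBd A * ‖ξ‖ ^ 2 := by gcongr; exacts [min_le_left _ _, min_le_right _ _]
    _ ≤ k + (2 * Real.pi) ^ 2 * (lowerBd A * ‖ξ‖ ^ 2) :=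
        add_le_add le_rfl (le_mul_of_one_le_left (by positivity) hpi)
    _ ≤ k + (2 * Real.pi) ^ 2 * ∑ i, ∑ j, A i j * ξ i * ξ j := by
        gcongr
        exact lowerBd_mul_le_sum A ξ

theorem integrable_inv_one_add_norm_sq_sq (hd : d ≤ 3) :
    Integrable fun ξ : Pt d => ((1 + ‖ξ‖ ^ 2)⁻¹) ^ 2 := by
  refine (integrable_rpow_neg_one_add_norm_sq (E := Pt d) (μ := volume) (r := 4)
    ?_).congr (Eventually.of_forall fun ξ => ?_)
  · rw [finrank_euclideanSpace_fin]
    exact_mod_cast Nat.lt_succ_of_le hd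
  have h0 : (0 : ℝ) ≤ 1 + ‖ξ‖ ^ 2 := by positivity
  simp only
  rw [show (-4 / 2 : ℝ) = -(2 : ℕ) by norm_num, Real.rpow_neg h0, Real.rpow_natCast, inv_pow]

theorem sq_integral_mul_le {α : Type*} [MeasurableSpace α] {μ : Measure α} {f g : α → ℝ}
    (hf₀ : 0 ≤ f) (hg₀ : 0 ≤ g) (hf : MemLp f 2 μ) (hg : MemLp g 2 μ) :
    (∫ x, f x * g x ∂μ) ^ 2 ≤ (∫ x, f x ^ 2 ∂μ) * ∫ x, g x ^ 2 ∂μ := by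
  have h := integral_mul_le_Lp_mul_Lq_of_nonneg (μ := μ) Real.HolderConjugate.two_two
    (Eventually.of_forall hf₀) (Eventually.of_forall hg₀) (by simpa using hf) (by simpa using hg)
  simp only [Real.rpow_ofNat, ← Real.sqrt_eq_rpow] at h
  calc (∫ x, f x * g x ∂μ) ^ 2
      ≤ (√(∫ x, f x ^ 2 ∂μ) * √(∫ x, g x ^ 2 ∂μ)) ^ 2 :=
        pow_le_pow_left₀ (integral_nonneg fun x => mul_nonneg (hf₀ x) (hg₀ x)) h 2
    _ = _ := by
        rw [mul_pow, Real.sq_sqrt (integral_nonneg fun x => sq_nonneg _),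
          Real.sq_sqrt (integral_nonneg fun x => sq_nonneg _)]

theorem norm_le_integral_norm_fourier (f : 𝓢(Pt d, ℂ)) (x : Pt d) : ‖f x‖ ≤ ∫ ξ, ‖𝓕 f ξ‖ := by
  have hinv : f x = 𝓕⁻ (𝓕 f) x := by rw [fourierInv_fourier_eq]
  rw [hinv, fourierInv_coe, Real.fourierInv_eq]
  exact (norm_integral_le_integral_norm _).trans_eq (by simp)

theorem norm_sq_le_of_norm_fourier_le (hd : d ≤ 3) {f g : 𝓢(Pt d, ℂ)} {c : ℝ}
    (h : ∀ ξ, ‖𝓕 f ξ‖ ≤ c * ((1 + ‖ξ‖ ^ 2)⁻¹ * ‖𝓕 g ξ‖)) (x : Pt d) :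
    ‖f x‖ ^ 2 ≤ c ^ 2 * (∫ ξ : Pt d, ((1 + ‖ξ‖ ^ 2)⁻¹) ^ 2) * ∫ y, ‖g y‖ ^ 2 := by
  have hcont : Continuous fun ξ : Pt d => (1 + ‖ξ‖ ^ 2)⁻¹ :=
    Continuous.inv₀ (by fun_prop) fun ξ => by positivity
  have hmem : MemLp (fun ξ : Pt d => (1 + ‖ξ‖ ^ 2)⁻¹) 2 :=
    (memLp_two_iff_integrable_sq hcont.aestronglyMeasurable).2
      (integrable_inv_one_add_norm_sq_sq hd)
  have hmem' : MemLp (fun ξ => ‖𝓕 g ξ‖) 2 := ((𝓕 g).memLp 2).norm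
  have hsup : ‖f x‖ ≤ c * ∫ ξ, (1 + ‖ξ‖ ^ 2)⁻¹ * ‖𝓕 g ξ‖ := by
    rw [← integral_const_mul]
    exact (norm_le_integral_norm_fourier f x).trans (integral_mono (𝓕 f).integrable.norm
      ((hmem.integrable_mul hmem').const_mul c) h)
  calc ‖f x‖ ^ 2 ≤ (c * ∫ ξ, (1 + ‖ξ‖ ^ 2)⁻¹ * ‖𝓕 g ξ‖) ^ 2 := by gcongr
    _ = c ^ 2 * (∫ ξ, (1 + ‖ξ‖ ^ 2)⁻¹ * ‖𝓕 g ξ‖) ^ 2 := mul_pow _ _ _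
    _ ≤ c ^ 2 * ((∫ ξ : Pt d, ((1 + ‖ξ‖ ^ 2)⁻¹) ^ 2) * ∫ ξ, ‖𝓕 g ξ‖ ^ 2) := by
        gcongr
        exact sq_integral_mul_le (fun ξ => by positivity) (fun ξ => by positivity) hmem hmem'
    _ = _ := by rw [integral_norm_sq_fourier, mul_assoc]

theorem exists_norm_sq_le_integral_ellOp (hd : d ≤ 3) {A : Matrix (Fin d) (Fin d) ℝ} {k : ℝ}
    (hA : 0 < lowerBd A) (hk : 0 < k) :
    ∃ C : ℝ, 0 ≤ C ∧ ∀ U : Pt d → ℂ, ContDiff ℝ ∞ U → HasCompactSupport U → ∀ x,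
      ‖U x‖ ^ 2 ≤ C * ∫ y, ‖ellOp A k U y‖ ^ 2 := by
  set c := min k (lowerBd A)
  refine ⟨c⁻¹ ^ 2 * ∫ ξ : Pt d, ((1 + ‖ξ‖ ^ 2)⁻¹) ^ 2, by positivity, fun U hU hUc x => ?_⟩
  let f : 𝓢(Pt d, ℂ) := hUc.toSchwartzMap hU
  have hf : ⇑f = U := rfl
  rw [← hf]
  simp only [← schwartzEllOp_apply]
  refine norm_sq_le_of_norm_fourier_le hd (fun ξ => ?_) x
  have hsymbol := mul_one_add_norm_sq_le_symbol A k hA.le ξ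
  have hpos : 0 < c * (1 + ‖ξ‖ ^ 2) := mul_pos (lt_min hk hA) (by positivity)
  rw [fourier_schwartzEllOp_apply, norm_mul, Complex.norm_real,
    Real.norm_of_nonneg (hpos.le.trans hsymbol), ← mul_assoc, ← mul_inv, inv_mul_eq_div,
    le_div_iff₀ hpos, mul_comm]
  gcongr

end fourier

section interiorEstimate

variable {d : ℕ}

theorem exists_cutoff (z : Pt d) {r R : ℝ} (hr : 0 < r) (hrR : r < R) :
    ∃ χ : Pt d → ℂ, ContDiff ℝ ∞ χ ∧ tsupport χ ⊆ Metric.closedBall z R ∧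
      (∀ x ∈ Metric.closedBall z r, χ x = 1) ∧ ∀ x, ‖χ x‖ ≤ 1 := by
  let b : ContDiffBump z := ⟨r, R, hr, hrR⟩
  refine ⟨fun x => (b x : ℂ), Complex.ofRealCLM.contDiff.comp b.contDiff, ?_, fun x hx => ?_,
    fun x => ?_⟩
  · rw [← b.tsupport_eq]
    exact closure_mono fun x hx => by simpa using hx
  · simp [b.one_of_mem_closedBall hx]
  · rw [Complex.norm_real, Real.norm_of_nonneg b.nonneg]
    exact b.le_one

theorem hasCompactSupport_of_tsupport_subset {χ : Pt d → ℂ} {K : Set (Pt d)} (hK : IsCompact K)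
    (h : tsupport χ ⊆ K) : HasCompactSupport χ :=
  hK.of_isClosed_subset (isClosed_tsupport χ) h

theorem ellOp_mul (A : Matrix (Fin d) (Fin d) ℝ) (k : ℝ) {χ V : Pt d → ℂ}
    (hχ : ContDiff ℝ ∞ χ) (hV : ContDiff ℝ ∞ V) (x : Pt d) :
    ellOp A k (fun y => χ y * V y) x = χ x * ellOp A k V x -
      (∑ i, ∑ j, (A i j : ℂ) * (pderiv i χ x * pderiv j V x + pderiv j χ x * pderiv i V x)) +
      ellOp A 0 χ x * V x := by
  have hdiff : ∀ {f : Pt d → ℂ}, ContDiff ℝ ∞ f → ∀ y, DifferentiableAt ℝ f y := fun h =>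
    h.differentiable (by simp)
  have hsecond : ∀ i j, pderiv i (pderiv j fun y => χ y * V y) x =
      pderiv i (pderiv j χ) x * V x + (pderiv i χ x * pderiv j V x + pderiv j χ x * pderiv i V x) +
        χ x * pderiv i (pderiv j V) x := by
    intro i j
    have hχj := contDiff_pderiv hχ j
    have hVj := contDiff_pderiv hV j
    have hfirst : (pderiv j fun y => χ y * V y) =
        fun y => pderiv j χ y * V y + χ y * pderiv j V y :=
      funext fun y => pderiv_mul (hdiff hχ y) (hdiff hV y) j
    rw [hfirst, pderiv_add (hdiff (hχj.mul hV) x) (hdiff (hχ.mul hVj) x),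
      pderiv_mul (hdiff hχj x) (hdiff hV x), pderiv_mul (hdiff hχ x) (hdiff hVj x)]
    ring
  simp only [ellOp, hsecond, mul_add, Finset.sum_add_distrib, mul_sub, sub_mul, Finset.sum_mul,
    Finset.mul_sum, mul_left_comm (χ x) (A _ _ : ℂ), mul_assoc]
  push_cast
  ring

theorem exists_norm_ellOp_mul_le (A : Matrix (Fin d) (Fin d) ℝ) (k : ℝ) {χ : Pt d → ℂ}
    (hχ : ContDiff ℝ ∞ χ) (hc : HasCompactSupport χ) :
    ∃ S : ℝ, 0 ≤ S ∧ ∀ V : Pt d → ℂ, ContDiff ℝ ∞ V → ∀ x,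
      ‖ellOp A k (fun y => χ y * V y) x‖ ≤
        ‖χ x‖ * ‖ellOp A k V x‖ + S * (‖V x‖ + ‖grad V x‖) := by
  obtain ⟨L, hL⟩ := (hasCompactSupport_grad hc).exists_bound_of_continuous (continuous_grad hχ)
  obtain ⟨N, hN⟩ := HasCompactSupport.exists_bound_of_continuous
    (hc.mono' ((subset_tsupport _).trans (tsupport_ellOp_subset A 0 χ)))
    (contDiff_ellOp A 0 hχ).continuous
  have hL₀ : 0 ≤ L := (norm_nonneg _).trans (hL 0)
  have hN₀ : 0 ≤ N := (norm_nonneg _).trans (hN 0)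
  have hAL : 0 ≤ ∑ i, ∑ j, |A i j| * (2 * L) :=
    Finset.sum_nonneg fun _ _ => Finset.sum_nonneg fun _ _ => by positivity
  refine ⟨N + ∑ i, ∑ j, |A i j| * (2 * L), by positivity, fun V hV x => ?_⟩
  have hprod : ∀ i j, ‖pderiv i χ x * pderiv j V x‖ ≤ L * ‖grad V x‖ := fun i j => by
    rw [norm_mul]
    gcongr
    exacts [(norm_pderiv_le_norm_grad χ i x).trans (hL x), norm_pderiv_le_norm_grad V j x]
  have hcross : ‖∑ i, ∑ j, (A i j : ℂ) *
      (pderiv i χ x * pderiv j V x + pderiv j χ x * pderiv i V x)‖ ≤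
      (∑ i, ∑ j, |A i j| * (2 * L)) * ‖grad V x‖ := by
    simp only [Finset.sum_mul, mul_assoc]
    refine norm_sum_le_of_le _ fun i _ => norm_sum_le_of_le _ fun j _ => ?_
    rw [norm_mul, Complex.norm_real, Real.norm_eq_abs, two_mul]
    gcongr
    exact norm_add_le_of_le (hprod i j) (hprod j i)
  have hzeroth : ‖ellOp A 0 χ x * V x‖ ≤ N * ‖V x‖ := by
    rw [norm_mul]
    gcongr
    exact hN x
  rw [ellOp_mul A k hχ hV]
  refine (norm_add_le_of_le (norm_sub_le_of_le (norm_mul _ _).le hcross) hzeroth).trans ?_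
  nlinarith [mul_nonneg hN₀ (norm_nonneg (grad V x)), mul_nonneg hAL (norm_nonneg (V x))]

theorem integral_mul_conj_ellOp_self (A : Matrix (Fin d) (Fin d) ℝ) (k : ℝ) {U : Pt d → ℂ}
    (hU : ContDiff ℝ ∞ U) (hc : HasCompactSupport U) :
    ∫ x, U x * conj (ellOp A k U x) =
      ∫ x, dotConj (matVec A (grad U x)) (grad U x) + k * U x * conj (U x) := by
  have hint : ∀ {f g : Pt d → ℂ}, ContDiff ℝ ∞ f → HasCompactSupport f → ContDiff ℝ ∞ g →
      Integrable fun x => f x * conj (g x) := fun hf hfc hg =>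
    (hf.continuous.mul (Complex.continuous_conj.comp hg.continuous)).integrable_of_hasCompactSupport
      hfc.mul_right
  refine integral_mul_conj_ellOp_eq_integral_dotConj A k (hint hU hc hU)
    (fun i j => hint (contDiff_pderiv hU j) (hasCompactSupport_pderiv hc j) (contDiff_pderiv hU i))
    (fun i j => hint hU hc (contDiff_pderiv (contDiff_pderiv hU j) i)) fun i j => ?_
  have hcomm : ∀ x, pderiv i (pderiv j U) x = pderiv j (pderiv i U) x := fun x =>
    pderiv_comm (hU.contDiffAt.of_le ENat.LEInfty.out) i j
  simp only [hcomm, ← pderiv_conj (pderiv i U) j]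
  exact integral_mul_pderiv (g := fun x => conj (pderiv i U x)) (hU.of_le (by simp))
    (Complex.conjCLE.contDiff.comp ((contDiff_pderiv hU i).of_le (by simp)))
    ((hasCompactSupport_pderiv hc i).comp_left (g := conj) (map_zero _)) j

theorem integrable_norm_grad_sq {U : Pt d → ℂ} (hU : ContDiff ℝ ∞ U) (hc : HasCompactSupport U) :
    Integrable fun x => ‖grad U x‖ ^ 2 :=
  ((continuous_grad hU).memLp_of_hasCompactSupport
    (hasCompactSupport_grad hc)).integrable_norm_pow two_ne_zero

theorem lowerBd_mul_integral_norm_grad_sq_le (A : Matrix (Fin d) (Fin d) ℝ) {k : ℝ} (hk : 0 ≤ k)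
    {U : Pt d → ℂ} (hU : ContDiff ℝ ∞ U) (hc : HasCompactSupport U) :
    lowerBd A * ∫ x, ‖grad U x‖ ^ 2 ≤ ∫ x, ‖U x‖ * ‖ellOp A k U x‖ := by
  have hquad_int : Integrable fun x =>
      dotConj (matVec A (grad U x)) (grad U x) + k * U x * conj (U x) := by
    refine Continuous.integrable_of_hasCompactSupport ?_ (hc.mono' fun x hx => ?_)
    · have := fun i => continuous_pderiv hU i
      have := hU.continuous
      simp only [dotConj, matVec, grad]
      fun_prop
    · contrapose! hx
      have hgx : grad U x = 0 := image_eq_zero_of_notMem_tsupport fun h => hx <|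
        (tsupport_grad_subset U) h
      simp [image_eq_zero_of_notMem_tsupport hx, hgx, dotConj]
  calc lowerBd A * ∫ x, ‖grad U x‖ ^ 2
      = ∫ x, lowerBd A * ‖grad U x‖ ^ 2 := (integral_const_mul _ _).symm
    _ ≤ ∫ x, (dotConj (matVec A (grad U x)) (grad U x) + k * U x * conj (U x)).re := by
        refine integral_mono ((integrable_norm_grad_sq hU hc).const_mul _) hquad_int.re fun x => ?_
        have hmass : 0 ≤ (k * U x * conj (U x)).re := by
          rw [mul_assoc, Complex.mul_conj', Complex.re_ofReal_mul, ← Complex.ofReal_pow,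
            Complex.ofReal_re]
          positivity
        exact (le_add_of_nonneg_right hmass).trans' (lowerBd_mul_le A (grad U x))
    _ = (∫ x, U x * conj (ellOp A k U x)).re := by
        rw [integral_mul_conj_ellOp_self A k hU hc]
        exact integral_re hquad_int
    _ ≤ ‖∫ x, U x * conj (ellOp A k U x)‖ := Complex.re_le_norm _
    _ ≤ ∫ x, ‖U x‖ * ‖ellOp A k U x‖ := by
        refine (norm_integral_le_integral_norm _).trans_eq ?_
        simp only [norm_mul, RCLike.norm_conj]

theorem norm_sq_le_of_norm_sub_le {E : Type*} [NormedAddCommGroup E] {p q : E} {t : ℝ}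
    (h : ‖p - q‖ ≤ t) : ‖q‖ ^ 2 ≤ 2 * ‖p‖ ^ 2 + 2 * t ^ 2 := by
  have hq : ‖q‖ ≤ ‖p‖ + t := by linarith [norm_sub_norm_le q p, norm_sub_rev p q]
  nlinarith [sq_nonneg (‖p‖ - t), norm_nonneg q, pow_le_pow_left₀ (norm_nonneg q) hq 2]

theorem mul_add_mul_le {p v h q s a : ℝ} (hs : 0 ≤ s) (ha : 0 < a) (hp : 0 ≤ p)
    (hp₁ : p ≤ 1) :
    p * v * (p * h + s * (v + q)) ≤
      a / 4 * (p * q) ^ 2 + (1 + s + s ^ 2 / a) * (v ^ 2 + h ^ 2) := by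
  have hyoung : s * v * (p * q) ≤ a / 4 * (p * q) ^ 2 + s ^ 2 / a * v ^ 2 := by
    have h1 : a / 4 * (p * q) ^ 2 + s ^ 2 / a * v ^ 2 - s * v * (p * q) =
      (a / 2 * (p * q) - s * v) ^ 2 / a := by field_simp; ring
    nlinarith [div_nonneg (sq_nonneg (a / 2 * (p * q) - s * v)) ha.le]
  have hpp : p * p ≤ 1 := by nlinarith
  have h2 : p * p * (v * h) ≤ v ^ 2 + h ^ 2 := by
    nlinarith [sq_nonneg (v - h), mul_nonneg hp hp, sq_nonneg v, sq_nonneg h]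
  have h3 : p * (s * v ^ 2) ≤ s * v ^ 2 := mul_le_of_le_one_left (by positivity) hp₁
  have h4 : 0 ≤ (s + s ^ 2 / a) * h ^ 2 := by positivity
  nlinarith

theorem norm_mul_norm_grad_sq_le {ζ V : Pt d → ℂ} {x : Pt d} {G : ℝ}
    (hζ : DifferentiableAt ℝ ζ x) (hV : DifferentiableAt ℝ V x) (hG : ‖grad ζ x‖ ≤ G) :
    (‖ζ x‖ * ‖grad V x‖) ^ 2 ≤
      2 * ‖grad (fun y => ζ y * V y) x‖ ^ 2 + 2 * G ^ 2 * ‖V x‖ ^ 2 := by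
  have h := norm_sq_le_of_norm_sub_le (p := grad (fun y => ζ y * V y) x) (q := ζ x • grad V x)
    (t := G * ‖V x‖) (by
      rw [grad_mul hζ hV, add_sub_cancel_left, norm_smul, mul_comm]
      gcongr)
  rwa [norm_smul, mul_pow, mul_pow G, ← mul_pow, ← mul_assoc] at h

theorem exists_lowerBd_mul_setIntegral_norm_grad_cutoff_mul_sq_le
    {A : Matrix (Fin d) (Fin d) ℝ} {k : ℝ} (hA : 0 < lowerBd A) (hk : 0 ≤ k)
    {ζ : Pt d → ℂ} {K : Set (Pt d)} (hK : IsCompact K)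
    (hζ : ContDiff ℝ ∞ ζ) (hζK : tsupport ζ ⊆ K) (hζ₁ : ∀ x, ‖ζ x‖ ≤ 1) :
    ∃ C : ℝ, 0 ≤ C ∧ ∀ V : Pt d → ℂ, ContDiff ℝ ∞ V →
      lowerBd A * ∫ x in K, ‖grad (fun y => ζ y * V y) x‖ ^ 2 ≤
        lowerBd A / 4 * (∫ x in K, (‖ζ x‖ * ‖grad V x‖) ^ 2) +
          C * ∫ x in K, (‖V x‖ ^ 2 + ‖ellOp A k V x‖ ^ 2) := by
  have hζc := hasCompactSupport_of_tsupport_subset hK hζK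
  obtain ⟨S, hS, hell⟩ := exists_norm_ellOp_mul_le A k hζ hζc
  refine ⟨1 + S + S ^ 2 / lowerBd A, by positivity, fun V hV => ?_⟩
  have hU : ContDiff ℝ ∞ fun y => ζ y * V y := hζ.mul hV
  have hUc : HasCompactSupport fun y => ζ y * V y := hζc.mul_right
  have hgV := continuous_grad hV
  have hLV := (contDiff_ellOp A k hV).continuous
  have hLU := (contDiff_ellOp A k hU).continuous
  have hU0 : ∀ x ∉ K, ‖ζ x * V x‖ * ‖ellOp A k (fun y => ζ y * V y) x‖ = 0 := fun x hx => by
    simp [image_eq_zero_of_notMem_tsupport fun h => hx (hζK h)]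
  have hint : ∀ {g : Pt d → ℝ}, Continuous g → IntegrableOn g K := fun hg =>
    hg.continuousOn.integrableOn_compact hK
  have hζ' := hζ.continuous
  have hV' := hV.continuous
  calc lowerBd A * ∫ x in K, ‖grad (fun y => ζ y * V y) x‖ ^ 2
      ≤ lowerBd A * ∫ x, ‖grad (fun y => ζ y * V y) x‖ ^ 2 :=
        mul_le_mul_of_nonneg_left (setIntegral_le_integral (integrable_norm_grad_sq hU hUc)
          (ae_of_all _ fun x => sq_nonneg _)) hA.le
    _ ≤ ∫ x, ‖ζ x * V x‖ * ‖ellOp A k (fun y => ζ y * V y) x‖ :=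
        lowerBd_mul_integral_norm_grad_sq_le A hk hU hUc
    _ = ∫ x in K, ‖ζ x * V x‖ * ‖ellOp A k (fun y => ζ y * V y) x‖ :=
        (setIntegral_eq_integral_of_forall_compl_eq_zero hU0).symm
    _ ≤ ∫ x in K, (lowerBd A / 4 * (‖ζ x‖ * ‖grad V x‖) ^ 2 +
          (1 + S + S ^ 2 / lowerBd A) * (‖V x‖ ^ 2 + ‖ellOp A k V x‖ ^ 2)) := by
        refine integral_mono (hint (by fun_prop)) (hint (by fun_prop)) fun x => ?_
        simp only [norm_mul]
        exact (mul_le_mul_of_nonneg_left (hell V hV x) (by positivity)).trans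
          (mul_add_mul_le hS hA (norm_nonneg _) (hζ₁ x))
    _ = _ := by
        rw [integral_add (hint (by fun_prop)) (hint (by fun_prop)), integral_const_mul,
          integral_const_mul]

theorem exists_setIntegral_norm_sq_mul_norm_grad_sq_le {A : Matrix (Fin d) (Fin d) ℝ} {k : ℝ}
    (hA : 0 < lowerBd A) (hk : 0 ≤ k) {ζ : Pt d → ℂ} {K : Set (Pt d)} (hK : IsCompact K)
    (hζ : ContDiff ℝ ∞ ζ) (hζK : tsupport ζ ⊆ K) (hζ₁ : ∀ x, ‖ζ x‖ ≤ 1) :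
    ∃ C : ℝ, 0 ≤ C ∧ ∀ V : Pt d → ℂ, ContDiff ℝ ∞ V →
      ∫ x in K, (‖ζ x‖ * ‖grad V x‖) ^ 2 ≤ C * ∫ x in K, (‖V x‖ ^ 2 + ‖ellOp A k V x‖ ^ 2) := by
  have hζc := hasCompactSupport_of_tsupport_subset hK hζK
  obtain ⟨G, hG⟩ := (hasCompactSupport_grad hζc).exists_bound_of_continuous (continuous_grad hζ)
  obtain ⟨C, hC, hcut⟩ :=
    exists_lowerBd_mul_setIntegral_norm_grad_cutoff_mul_sq_le hA hk hK hζ hζK hζ₁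
  refine ⟨4 * C / lowerBd A + 4 * G ^ 2, by positivity, fun V hV => ?_⟩
  have hV' := hV.continuous
  have hζ' := hζ.continuous
  have hgV := continuous_grad hV
  have hgU := continuous_grad (hζ.mul hV)
  have hLV := (contDiff_ellOp A k hV).continuous
  have hint : ∀ {g : Pt d → ℝ}, Continuous g → IntegrableOn g K := fun hg =>
    hg.continuousOn.integrableOn_compact hK
  have hprod : ∫ x in K, (‖ζ x‖ * ‖grad V x‖) ^ 2 ≤
      2 * (∫ x in K, ‖grad (fun y => ζ y * V y) x‖ ^ 2) +
        2 * G ^ 2 * ∫ x in K, (‖V x‖ ^ 2 + ‖ellOp A k V x‖ ^ 2) := by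
    rw [← integral_const_mul, ← integral_const_mul,
      ← integral_add (hint (by fun_prop)) (hint (by fun_prop))]
    refine integral_mono (hint (by fun_prop)) (hint (by fun_prop)) fun x => ?_
    refine (norm_mul_norm_grad_sq_le (hζ.differentiable (by simp) x)
      (hV.differentiable (by simp) x) (hG x)).trans ?_
    gcongr
    exact le_add_of_nonneg_right (by positivity)
  have hcutV := hcut V hV
  refine le_of_mul_le_mul_left ?_ hA
  have hexp : lowerBd A * ((4 * C / lowerBd A + 4 * G ^ 2) *
        ∫ x in K, (‖V x‖ ^ 2 + ‖ellOp A k V x‖ ^ 2)) =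
      4 * C * (∫ x in K, (‖V x‖ ^ 2 + ‖ellOp A k V x‖ ^ 2)) +
        4 * (lowerBd A * (G ^ 2 * ∫ x in K, (‖V x‖ ^ 2 + ‖ellOp A k V x‖ ^ 2))) := by
    field_simp
  nlinarith [mul_le_mul_of_nonneg_left hprod hA.le]

theorem exists_norm_ellOp_cutoff_mul_sq_le (A : Matrix (Fin d) (Fin d) ℝ) (k : ℝ) {χ ζ : Pt d → ℂ}
    (hχ : ContDiff ℝ ∞ χ) (hc : HasCompactSupport χ) (hχ₁ : ∀ x, ‖χ x‖ ≤ 1)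
    (hζ : ∀ x ∈ tsupport χ, ζ x = 1) :
    ∃ C : ℝ, 0 ≤ C ∧ ∀ V : Pt d → ℂ, ContDiff ℝ ∞ V → ∀ x,
      ‖ellOp A k (fun y => χ y * V y) x‖ ^ 2 ≤
        C * (‖V x‖ ^ 2 + ‖ellOp A k V x‖ ^ 2 + (‖ζ x‖ * ‖grad V x‖) ^ 2) := by
  obtain ⟨S, -, hell⟩ := exists_norm_ellOp_mul_le A k hχ hc
  refine ⟨3 * (1 + S ^ 2), by positivity, fun V hV x => ?_⟩
  by_cases hx : x ∈ tsupport χ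
  · have hle : ‖ellOp A k (fun y => χ y * V y) x‖ ≤
        ‖ellOp A k V x‖ + S * (‖V x‖ + ‖grad V x‖) := (hell V hV x).trans
      (add_le_add (mul_le_of_le_one_left (norm_nonneg _) (hχ₁ x)) le_rfl)
    refine (pow_le_pow_left₀ (norm_nonneg _) hle 2).trans ?_
    rw [hζ x hx, norm_one, one_mul]
    nlinarith [sq_nonneg (‖ellOp A k V x‖ - S * ‖V x‖), sq_nonneg (S * ‖V x‖ - S * ‖grad V x‖),
      sq_nonneg (‖ellOp A k V x‖ - S * ‖grad V x‖), sq_nonneg (S * ‖ellOp A k V x‖),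
      sq_nonneg ‖V x‖, sq_nonneg ‖grad V x‖]
  · have h0 : ellOp A k (fun y => χ y * V y) x = 0 := image_eq_zero_of_notMem_tsupport fun h =>
      hx (tsupport_mul_subset_left (tsupport_ellOp_subset A k _ h))
    rw [h0, norm_zero, zero_pow two_ne_zero]
    positivity

theorem exists_integral_norm_ellOp_cutoff_mul_sq_le {A : Matrix (Fin d) (Fin d) ℝ} {k : ℝ}
    (hA : 0 < lowerBd A) (hk : 0 ≤ k) {χ : Pt d → ℂ} {z : Pt d} {s R : ℝ} (hs : 0 < s)
    (hsR : s < R) (hχ : ContDiff ℝ ∞ χ) (hχs : tsupport χ ⊆ Metric.closedBall z s)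
    (hχ₁ : ∀ x, ‖χ x‖ ≤ 1) :
    ∃ C : ℝ, 0 ≤ C ∧ ∀ V : Pt d → ℂ, ContDiff ℝ ∞ V →
      ∫ x, ‖ellOp A k (fun y => χ y * V y) x‖ ^ 2 ≤
        C * ∫ x in Metric.closedBall z R, (‖V x‖ ^ 2 + ‖ellOp A k V x‖ ^ 2) := by
  have hK : IsCompact (Metric.closedBall z R) := isCompact_closedBall z R
  obtain ⟨ζ, hζ, hζs, hζone, hζ₁⟩ := exists_cutoff z hs hsR
  obtain ⟨C₁, hC₁, hcut⟩ := exists_norm_ellOp_cutoff_mul_sq_le A k hχ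
    (hasCompactSupport_of_tsupport_subset (isCompact_closedBall z s) hχs) hχ₁
    fun x hx => hζone x (hχs hx)
  obtain ⟨C₂, hC₂, hcacc⟩ := exists_setIntegral_norm_sq_mul_norm_grad_sq_le hA hk hK hζ hζs hζ₁
  refine ⟨C₁ * (1 + C₂), by positivity, fun V hV => ?_⟩
  have hV' := hV.continuous
  have hζ' := hζ.continuous
  have hgV := continuous_grad hV
  have hLV := (contDiff_ellOp A k hV).continuous
  have hLχV := (contDiff_ellOp A k (hχ.mul hV)).continuous
  have hint : ∀ {g : Pt d → ℝ}, Continuous g → IntegrableOn g (Metric.closedBall z R) :=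
    fun hg => hg.continuousOn.integrableOn_compact hK
  have hzero : ∀ x ∉ Metric.closedBall z R, ‖ellOp A k (fun y => χ y * V y) x‖ ^ 2 = 0 := by
    intro x hx
    rw [image_eq_zero_of_notMem_tsupport fun h => hx (Metric.closedBall_subset_closedBall hsR.le
      (hχs (tsupport_mul_subset_left (tsupport_ellOp_subset A k _ h)))), norm_zero,
      zero_pow two_ne_zero]
  calc ∫ x, ‖ellOp A k (fun y => χ y * V y) x‖ ^ 2
      = ∫ x in Metric.closedBall z R, ‖ellOp A k (fun y => χ y * V y) x‖ ^ 2 :=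
        (setIntegral_eq_integral_of_forall_compl_eq_zero hzero).symm
    _ ≤ ∫ x in Metric.closedBall z R,
          C₁ * (‖V x‖ ^ 2 + ‖ellOp A k V x‖ ^ 2 + (‖ζ x‖ * ‖grad V x‖) ^ 2) :=
        integral_mono (hint (by fun_prop)) (hint (by fun_prop)) (hcut V hV)
    _ ≤ C₁ * (1 + C₂) *
          ∫ x in Metric.closedBall z R, (‖V x‖ ^ 2 + ‖ellOp A k V x‖ ^ 2) := by
        rw [integral_const_mul, integral_add (hint (by fun_prop)) (hint (by fun_prop)),
          mul_assoc C₁, one_add_mul C₂]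
        gcongr
        exact hcacc V hV

theorem exists_norm_sq_le_setIntegral {A : Matrix (Fin d) (Fin d) ℝ} {k : ℝ} (hd : d ≤ 3)
    (hA : 0 < lowerBd A) (hk : 0 < k) (z : Pt d) {r R : ℝ} (hr : 0 < r) (hrR : r < R) :
    ∃ C : ℝ, 0 ≤ C ∧ ∀ V : Pt d → ℂ, ContDiff ℝ ∞ V → ∀ x ∈ Metric.closedBall z r,
      ‖V x‖ ^ 2 ≤ C * ∫ y in Metric.closedBall z R, (‖V y‖ ^ 2 + ‖ellOp A k V y‖ ^ 2) := by
  obtain ⟨χ, hχ, hχs, hχone, hχ₁⟩ := exists_cutoff z hr (left_lt_add_div_two.2 hrR)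
  have hχc := hasCompactSupport_of_tsupport_subset (isCompact_closedBall z _) hχs
  obtain ⟨C₁, hC₁, hsup⟩ := exists_norm_sq_le_integral_ellOp hd hA hk
  obtain ⟨C₂, hC₂, hcut⟩ := exists_integral_norm_ellOp_cutoff_mul_sq_le hA hk.le
    (hr.trans (left_lt_add_div_two.2 hrR)) (add_div_two_lt_right.2 hrR) hχ hχs hχ₁
  refine ⟨C₁ * C₂, by positivity, fun V hV x hx => ?_⟩
  calc ‖V x‖ ^ 2 = ‖χ x * V x‖ ^ 2 := by rw [hχone x hx, one_mul]
    _ ≤ C₁ * ∫ y, ‖ellOp A k (fun y => χ y * V y) y‖ ^ 2 :=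
        hsup _ (hχ.mul hV) hχc.mul_right x
    _ ≤ C₁ * C₂ * ∫ y in Metric.closedBall z R, (‖V y‖ ^ 2 + ‖ellOp A k V y‖ ^ 2) := by
        rw [mul_assoc]
        exact mul_le_mul_of_nonneg_left (hcut V hV) hC₁

end interiorEstimate

section mollification

variable {d : ℕ}

/-- The convolution `G ⋆ ρ`, the mollification of `G` when `ρ` is an approximate identity. -/
def mollify (ρ G : Pt d → ℂ) (x : Pt d) : ℂ := ∫ t, G t * ρ (x - t)

theorem mollify_eq_convolution (ρ G : Pt d → ℂ) :
    mollify ρ G = convolution G ρ (ContinuousLinearMap.mul ℝ ℂ) volume := rfl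

theorem contDiff_mollify {ρ G : Pt d → ℂ} (hρ : ContDiff ℝ ∞ ρ) (hc : HasCompactSupport ρ)
    (hG : LocallyIntegrable G) : ContDiff ℝ ∞ (mollify ρ G) := by
  rw [mollify_eq_convolution]
  exact hc.contDiff_convolution_right _ hG hρ

theorem pderiv_mollify {ρ G : Pt d → ℂ} (hρ : ContDiff ℝ ∞ ρ) (hc : HasCompactSupport ρ)
    (hG : LocallyIntegrable G) (i : Fin d) :
    pderiv i (mollify ρ G) = mollify (pderiv i ρ) G := by
  funext x
  have h := hc.hasFDerivAt_convolution_right (ContinuousLinearMap.mul ℝ ℂ) hG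
    (hρ.of_le (by simp)) x
  rw [pderiv, mollify_eq_convolution, h.fderiv,
    convolution_precompR_apply _ hG (hc.fderiv (𝕜 := ℝ)) (hρ.continuous_fderiv (by simp))]
  rfl

theorem pderiv_comp_sub (ρ : Pt d → ℂ) (x : Pt d) (i : Fin d) :
    pderiv i (fun t => ρ (x - t)) = fun t => -pderiv i ρ (x - t) := by
  funext t
  simp only [sub_eq_add_neg]
  have h : fderiv ℝ (fun t => ρ (x + -t)) t = _ := (ContinuousLinearEquiv.neg ℝ).comp_right_fderiv
    (f := fun y => ρ (x + y)) (x := t)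
  simp [pderiv, h, fderiv_comp_add_left]

theorem pderiv_pderiv_comp_sub (ρ : Pt d → ℂ) (x : Pt d) (i j : Fin d) :
    pderiv i (pderiv j fun t => ρ (x - t)) = fun t => pderiv i (pderiv j ρ) (x - t) := by
  rw [pderiv_comp_sub]
  exact (pderiv_comp_sub (fun y => -pderiv j ρ y) x i).trans
    (funext fun t => by simp only [pderiv, fderiv_fun_neg, _root_.neg_apply, neg_neg]; rfl)

theorem ellOp_mollify (A : Matrix (Fin d) (Fin d) ℝ) (k : ℝ) {ρ G : Pt d → ℂ}
    (hρ : ContDiff ℝ ∞ ρ) (hc : HasCompactSupport ρ) (hG : LocallyIntegrable G) (x : Pt d) :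
    ellOp A k (mollify ρ G) x = ∫ t, G t * ellOp A k (fun t => ρ (x - t)) t := by
  have hint : ∀ {θ : Pt d → ℂ}, ContDiff ℝ ∞ θ → HasCompactSupport θ →
      Integrable fun t => G t * θ (x - t) := fun hθ hθc =>
    hθc.convolutionExists_right (ContinuousLinearMap.mul ℝ ℂ) hG hθ.continuous x
  rw [integral_mul_ellOp A k (hint hρ hc)]
  · simp only [ellOp, pderiv_mollify hρ hc hG, pderiv_pderiv_comp_sub,
      pderiv_mollify (contDiff_pderiv hρ _) (hasCompactSupport_pderiv hc _) hG]
    rfl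
  · intro i j
    simp only [pderiv_pderiv_comp_sub]
    exact hint (contDiff_pderiv (contDiff_pderiv hρ j) i)
      (hasCompactSupport_pderiv (hasCompactSupport_pderiv hc j) i)

theorem norm_mollify_sq_le {r : Pt d → ℝ} (hr : Continuous r) (hc : HasCompactSupport r)
    (h₀ : ∀ x, 0 ≤ r x) (h₁ : ∫ x, r x = 1) {G : Pt d → ℂ} (hG : MemLp G 2) (x : Pt d) :
    ‖mollify (fun y => (r y : ℂ)) G x‖ ^ 2 ≤ ∫ t, ‖G t‖ ^ 2 * r (x - t) := by
  have hint : ∀ {F : Pt d → ℝ}, LocallyIntegrable F → Integrable fun t => F t * r (x - t) :=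
    fun hF => hc.convolutionExists_right (ContinuousLinearMap.mul ℝ ℝ) hF hr x
  have hint₁ := hint (hG.norm.locallyIntegrable (by norm_num))
  have hint₂ := hint (hG.integrable_norm_pow two_ne_zero).locallyIntegrable
  have hr_int : Integrable fun t => r (x - t) :=
    (hr.integrable_of_hasCompactSupport hc).comp_sub_left x
  set s := ∫ t, ‖G t‖ * r (x - t) with hs
  have hnorm : ‖mollify (fun y => (r y : ℂ)) G x‖ ≤ s := by
    refine (norm_integral_le_integral_norm _).trans_eq ?_
    simp [hs, abs_of_nonneg (h₀ _)]
  have hvar : 0 ≤ ∫ t, (‖G t‖ - s) ^ 2 * r (x - t) :=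
    integral_nonneg fun t => mul_nonneg (sq_nonneg _) (h₀ _)
  have hexpand : ∫ t, (‖G t‖ - s) ^ 2 * r (x - t) = (∫ t, ‖G t‖ ^ 2 * r (x - t)) - s ^ 2 := by
    have hmass : ∫ t, r (x - t) = 1 := by rw [integral_sub_left_eq_self r, h₁]
    have : ∀ t, (‖G t‖ - s) ^ 2 * r (x - t) =
        ‖G t‖ ^ 2 * r (x - t) - 2 * s * (‖G t‖ * r (x - t)) + s ^ 2 * r (x - t) := fun t => by ring
    simp only [this]
    have hdiff : Integrable fun t => ‖G t‖ ^ 2 * r (x - t) - 2 * s * (‖G t‖ * r (x - t)) :=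
      hint₂.sub (hint₁.const_mul _)
    rw [integral_add hdiff (hr_int.const_mul _),
      integral_sub hint₂ (hint₁.const_mul _), integral_const_mul, integral_const_mul, hmass]
    ring
  nlinarith [pow_le_pow_left₀ (norm_nonneg _) hnorm 2]

theorem integral_norm_mollify_sq_le {r : Pt d → ℝ} (hr : Continuous r) (hc : HasCompactSupport r)
    (h₀ : ∀ x, 0 ≤ r x) (h₁ : ∫ x, r x = 1) {G : Pt d → ℂ} (hG : MemLp G 2) :
    Integrable (fun x => ‖mollify (fun y => (r y : ℂ)) G x‖ ^ 2) ∧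
      ∫ x, ‖mollify (fun y => (r y : ℂ)) G x‖ ^ 2 ≤ ∫ x, ‖G x‖ ^ 2 := by
  have hG₂ : Integrable fun x => ‖G x‖ ^ 2 := hG.integrable_norm_pow two_ne_zero
  have hr_int : Integrable r := hr.integrable_of_hasCompactSupport hc
  have hle := norm_mollify_sq_le hr hc h₀ h₁ hG
  have hconv : Integrable fun x => ∫ t, ‖G t‖ ^ 2 * r (x - t) :=
    hG₂.integrable_convolution (ContinuousLinearMap.mul ℝ ℝ) hr_int
  have hconv_eq : ∫ x, ∫ t, ‖G t‖ ^ 2 * r (x - t) = ∫ x, ‖G x‖ ^ 2 := by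
    simpa [convolution, h₁] using integral_convolution (ContinuousLinearMap.mul ℝ ℝ) hG₂ hr_int
  have hcont : Continuous (mollify (fun y => (r y : ℂ)) G) :=
    (hc.comp_left (g := Complex.ofReal) rfl).continuous_convolution_right
      (ContinuousLinearMap.mul ℝ ℂ) (hG.locallyIntegrable (by norm_num))
      (Complex.continuous_ofReal.comp hr)
  refine ⟨hconv.mono' (hcont.norm.pow 2).aestronglyMeasurable (.of_forall fun x => ?_),
    hconv_eq ▸ integral_mono_of_nonneg (.of_forall fun x => sq_nonneg _) hconv (.of_forall hle)⟩
  simpa using hle x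

end mollification

section distributionalSolutions

variable {d : ℕ} {A : Matrix (Fin d) (Fin d) ℝ} {k : ℝ} {Ω : Set (Pt d)} {G H : Pt d → ℂ}

/-- `G` solves `(k - ∑ i j, A i j ∂ᵢ∂ⱼ) G = H` in `Ω` in the sense of distributions. -/
def IsDistribSol (A : Matrix (Fin d) (Fin d) ℝ) (k : ℝ) (Ω : Set (Pt d)) (G H : Pt d → ℂ) : Prop :=
  ∀ η, IsTest Ω η → ∫ x in Ω, G x * ellOp A k η x = ∫ x in Ω, H x * η x

theorem isTest_comp_sub {ρ : Pt d → ℂ} (hρ : ContDiff ℝ ∞ ρ) {δ : ℝ}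
    (hρs : Function.support ρ ⊆ Metric.closedBall 0 δ) {y : Pt d}
    (hy : Metric.closedBall y δ ⊆ Ω) : IsTest Ω fun t => ρ (y - t) := by
  have hs : tsupport (fun t => ρ (y - t)) ⊆ Metric.closedBall y δ :=
    closure_minimal (fun t ht => by simpa [dist_comm t y, dist_eq_norm] using hρs ht)
      Metric.isClosed_closedBall
  exact ⟨hρ.comp (contDiff_const.sub contDiff_id),
    hasCompactSupport_of_tsupport_subset (isCompact_closedBall y δ) hs, hs.trans hy⟩

theorem integral_indicator_mul (hΩ : MeasurableSet Ω) (F η : Pt d → ℂ) :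
    ∫ x, Ω.indicator F x * η x = ∫ x in Ω, F x * η x := by
  rw [← integral_indicator hΩ]
  simp only [Set.indicator_mul_left]

theorem IsDistribSol.ellOp_mollify (h : IsDistribSol A k Ω G H) (hΩ : MeasurableSet Ω)
    (hG : LocallyIntegrable (Ω.indicator G)) {ρ : Pt d → ℂ} (hρ : ContDiff ℝ ∞ ρ) {δ : ℝ}
    (hρs : Function.support ρ ⊆ Metric.closedBall 0 δ) {y : Pt d}
    (hy : Metric.closedBall y δ ⊆ Ω) :
    ellOp A k (mollify ρ (Ω.indicator G)) y = mollify ρ (Ω.indicator H) y := by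
  have hρc : HasCompactSupport ρ := .of_support_subset_isCompact (isCompact_closedBall 0 δ) hρs
  rw [TransmissionEig.ellOp_mollify A k hρ hρc hG, mollify, integral_indicator_mul hΩ,
    integral_indicator_mul hΩ]
  exact h _ (isTest_comp_sub hρ hρs hy)

theorem integral_norm_indicator_sq (hΩ : MeasurableSet Ω) (F : Pt d → ℂ) :
    ∫ x, ‖Ω.indicator F x‖ ^ 2 = ∫ x in Ω, ‖F x‖ ^ 2 := by
  rw [← integral_indicator hΩ]
  refine integral_congr_ae (.of_forall fun x => ?_)
  by_cases hx : x ∈ Ω <;> simp [hx]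

theorem exists_norm_mollify_sq_le (hd : d ≤ 3) (hA : 0 < lowerBd A) (hk : 0 < k) (z : Pt d)
    {r R : ℝ} (hr : 0 < r) (hrR : r < R) :
    ∃ C : ℝ, 0 ≤ C ∧ ∀ G H : Pt d → ℂ, MemLp G 2 (leb (Metric.ball z R)) →
      MemLp H 2 (leb (Metric.ball z R)) → IsDistribSol A k (Metric.ball z R) G H →
      ∀ (ρ : Pt d → ℝ) (δ : ℝ), ContDiff ℝ ∞ ρ → Function.support ρ ⊆ Metric.closedBall 0 δ →
      δ < (R - r) / 2 → (∀ x, 0 ≤ ρ x) → ∫ x, ρ x = 1 → ∀ x ∈ Metric.closedBall z r,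
        ‖mollify (fun y => (ρ y : ℂ)) ((Metric.ball z R).indicator G) x‖ ^ 2 ≤
          C * ((∫ y in Metric.ball z R, ‖G y‖ ^ 2) + ∫ y in Metric.ball z R, ‖H y‖ ^ 2) := by
  obtain ⟨C, hC, hsup⟩ := exists_norm_sq_le_setIntegral hd hA hk z hr (left_lt_add_div_two.2 hrR)
  refine ⟨C, hC, fun G H hG hH hGH ρ δ hρ hρs hδ h₀ h₁ x hx => ?_⟩
  have hball : MeasurableSet (Metric.ball z R) := measurableSet_ball
  have hG' := (memLp_indicator_iff_restrict hball).2 hG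
  have hH' := (memLp_indicator_iff_restrict hball).2 hH
  have hGloc := hG'.locallyIntegrable (by norm_num)
  have hρc : HasCompactSupport ρ := .of_support_subset_isCompact (isCompact_closedBall 0 δ) hρs
  have hρ' : ContDiff ℝ ∞ fun y => (ρ y : ℂ) := Complex.ofRealCLM.contDiff.comp hρ
  have hsol : ∀ y ∈ Metric.closedBall z ((r + R) / 2),
      ellOp A k (mollify (fun y => (ρ y : ℂ)) ((Metric.ball z R).indicator G)) y =
        mollify (fun y => (ρ y : ℂ)) ((Metric.ball z R).indicator H) y := fun y hy =>
    hGH.ellOp_mollify hball hGloc hρ' (fun t ht => hρs fun h => ht (by simp [h])) <|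
      Metric.closedBall_subset_ball' <| by linarith [Metric.mem_closedBall.1 hy]
  obtain ⟨hGint, hGle⟩ := integral_norm_mollify_sq_le hρ.continuous hρc h₀ h₁ hG'
  obtain ⟨hHint, hHle⟩ := integral_norm_mollify_sq_le hρ.continuous hρc h₀ h₁ hH'
  rw [integral_norm_indicator_sq hball] at hGle hHle
  refine (hsup _ (contDiff_mollify hρ' (hρc.comp_left (g := Complex.ofReal) rfl) hGloc) x hx).trans
    (mul_le_mul_of_nonneg_left ?_ hC)
  calc _ = ∫ y in Metric.closedBall z ((r + R) / 2),
        (‖mollify (fun y => (ρ y : ℂ)) ((Metric.ball z R).indicator G) y‖ ^ 2 +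
          ‖mollify (fun y => (ρ y : ℂ)) ((Metric.ball z R).indicator H) y‖ ^ 2) :=
        setIntegral_congr_fun Metric.isClosed_closedBall.measurableSet fun y hy => by
          simp only [hsol y hy]
    _ ≤ _ := setIntegral_le_integral (hGint.add hHint) (.of_forall fun y => by positivity)
    _ = _ := integral_add hGint hHint
    _ ≤ _ := add_le_add hGle hHle

theorem exists_ae_tendsto_mollify {F : Pt d → ℂ} (hF : LocallyIntegrable F) {δ : ℝ} (hδ : 0 < δ) :
    ∃ ρ : ℕ → Pt d → ℝ, (∀ n, ContDiff ℝ ∞ (ρ n) ∧ Function.support (ρ n) ⊆ Metric.closedBall 0 δ ∧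
      (∀ x, 0 ≤ ρ n x) ∧ ∫ x, ρ n x = 1) ∧
      ∀ᵐ x, Tendsto (fun n => mollify (fun y => (ρ n y : ℂ)) F x) atTop (𝓝 (F x)) := by
  let φ : ℕ → ContDiffBump (0 : Pt d) := fun n =>
    ⟨δ / ((n : ℝ) + 1) / 2, δ / ((n : ℝ) + 1), by positivity, half_lt_self (by positivity)⟩
  have hφ : Tendsto (fun n => (φ n).rOut) atTop (𝓝 0) := by
    simpa [φ, div_eq_mul_inv] using tendsto_one_div_add_atTop_nhds_zero_nat.const_mul δ
  refine ⟨fun n => (φ n).normed volume, fun n => ⟨(φ n).contDiff_normed, ?_, (φ n).nonneg_normed,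
    (φ n).integral_normed⟩, ?_⟩
  · rw [(φ n).support_normed_eq]
    exact Metric.ball_subset_closedBall.trans
      (Metric.closedBall_subset_closedBall (div_le_self hδ.le (by simp)))
  · filter_upwards [ContDiffBump.ae_convolution_tendsto_right_of_locallyIntegrable (K := 2) hφ
      (.of_forall fun n => by simp only [φ]; linarith) hF] with x hx
    refine hx.congr fun n => ?_
    rw [← convolution_flip]
    exact integral_congr_ae (.of_forall fun t => by simp [mul_comm])

theorem exists_ae_norm_sq_le (hd : d ≤ 3) (hA : 0 < lowerBd A) (hk : 0 < k) (z : Pt d)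
    {r R : ℝ} (hr : 0 < r) (hrR : r < R) :
    ∃ C : ℝ, 0 ≤ C ∧ ∀ G H : Pt d → ℂ, MemLp G 2 (leb (Metric.ball z R)) →
      MemLp H 2 (leb (Metric.ball z R)) → IsDistribSol A k (Metric.ball z R) G H →
      ∀ᵐ x, x ∈ Metric.closedBall z r → ‖G x‖ ^ 2 ≤
        C * ((∫ y in Metric.ball z R, ‖G y‖ ^ 2) + ∫ y in Metric.ball z R, ‖H y‖ ^ 2) := by
  obtain ⟨C, hC, hbound⟩ := exists_norm_mollify_sq_le hd hA hk z hr hrR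
  refine ⟨C, hC, fun G H hG hH hGH => ?_⟩
  obtain ⟨ρ, hρ, hconv⟩ := exists_ae_tendsto_mollify
    (((memLp_indicator_iff_restrict measurableSet_ball).2 hG).locallyIntegrable (by norm_num))
    (show 0 < (R - r) / 4 by linarith)
  filter_upwards [hconv] with x hx hxr
  rw [Set.indicator_of_mem (Metric.closedBall_subset_ball hrR hxr)] at hx
  refine le_of_tendsto (hx.norm.pow 2) (.of_forall fun n => ?_)
  obtain ⟨hsmooth, hsupp, hnonneg, hmass⟩ := hρ n
  exact hbound G H hG hH hGH (ρ n) _ hsmooth hsupp (by linarith) hnonneg hmass x hxr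

end distributionalSolutions

section distributionalDerivatives

variable {d : ℕ} {A : Matrix (Fin d) (Fin d) ℝ} {k : ℝ} {B D : Set (Pt d)} {f η : Pt d → ℂ}

theorem IsTest.conj (h : IsTest D η) : IsTest D fun x => conj (η x) := by
  have hs : tsupport (fun x => conj (η x)) ⊆ tsupport η :=
    closure_mono fun x hx h₀ => hx (by simp [h₀])
  exact ⟨Complex.conjCLE.contDiff.comp h.1, h.2.1.mono' ((subset_tsupport _).trans hs),
    hs.trans h.2.2⟩

theorem IsTest.mono (h : IsTest B η) (hBD : B ⊆ D) : IsTest D η :=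
  ⟨h.1, h.2.1, h.2.2.trans hBD⟩

theorem IsTest.eq_zero (h : IsTest D η) {x : Pt d} (hx : x ∉ D) : η x = 0 :=
  image_eq_zero_of_notMem_tsupport fun hx' => hx (h.2.2 hx')

theorem IsTest.ellOp (h : IsTest D η) (A : Matrix (Fin d) (Fin d) ℝ) (k : ℝ) :
    IsTest D (ellOp A k η) :=
  ⟨contDiff_ellOp A k h.1, h.2.1.mono' ((subset_tsupport _).trans (tsupport_ellOp_subset A k η)),
    (tsupport_ellOp_subset A k η).trans h.2.2⟩

theorem IsTest.integrable_mul (h : IsTest D η) (hf : MemLp f 2 (leb D)) :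
    Integrable (fun x => f x * η x) (leb D) :=
  hf.integrable_mul h.memLp

theorem IsTest.setIntegral_mul_eq_integral (h : IsTest D η) (f : Pt d → ℂ) :
    ∫ x in D, f x * η x = ∫ x, f x * η x :=
  setIntegral_eq_integral_of_forall_compl_eq_zero fun x hx => by rw [h.eq_zero hx, mul_zero]

theorem IsTest.setIntegral_mul_eq (h : IsTest B η) (hBD : B ⊆ D) (f : Pt d → ℂ) :
    ∫ x in D, f x * η x = ∫ x in B, f x * η x := by
  rw [(h.mono hBD).setIntegral_mul_eq_integral, h.setIntegral_mul_eq_integral]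

theorem IsTest.contDiff_mul (h : IsTest D η) (hD : IsOpen D) (hf : ContDiffOn ℝ ∞ f D) :
    ContDiff ℝ ∞ fun x => f x * η x := by
  refine contDiff_iff_contDiffAt.2 fun x => ?_
  by_cases hx : x ∈ tsupport η
  · exact (hf.contDiffAt (hD.mem_nhds (h.2.2 hx))).mul h.1.contDiffAt
  · refine (contDiffAt_const (c := 0)).congr_of_eventuallyEq ?_
    filter_upwards [(isClosed_tsupport η).isOpen_compl.mem_nhds hx] with y hy
    rw [image_eq_zero_of_notMem_tsupport hy, mul_zero]

theorem IsTest.integrable_contDiffOn_mul (h : IsTest D η) (hD : IsOpen D)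
    (hf : ContDiffOn ℝ ∞ f D) : Integrable fun x => f x * η x :=
  (h.contDiff_mul hD hf).continuous.integrable_of_hasCompactSupport h.2.1.mul_left

theorem contDiffOn_pderiv (hD : IsOpen D) (hf : ContDiffOn ℝ ∞ f D) (i : Fin d) :
    ContDiffOn ℝ ∞ (pderiv i f) D :=
  (hf.fderiv_of_isOpen hD (m := ∞) (by simp)).clm_apply contDiffOn_const

theorem contDiffOn_ellOp (A : Matrix (Fin d) (Fin d) ℝ) (k : ℝ) (hD : IsOpen D)
    (hf : ContDiffOn ℝ ∞ f D) : ContDiffOn ℝ ∞ (ellOp A k f) D :=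
  (contDiffOn_const.mul hf).sub (ContDiffOn.sum fun i _ => ContDiffOn.sum fun j _ =>
    contDiffOn_const.mul (contDiffOn_pderiv hD (contDiffOn_pderiv hD hf j) i))

theorem integral_pderiv_eq_zero (hf : ContDiff ℝ 1 f) (hc : HasCompactSupport f) (i : Fin d) :
    ∫ x, pderiv i f x = 0 := by
  simpa [pderiv] using integral_mul_pderiv (f := fun _ => 1) contDiff_const hf hc i

theorem setIntegral_mul_pderiv (hD : IsOpen D) (hf : ContDiffOn ℝ ∞ f D) (h : IsTest D η)
    (i : Fin d) : ∫ x in D, f x * pderiv i η x = -∫ x in D, pderiv i f x * η x := by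
  have hprod : ∀ x, pderiv i (fun y => f y * η y) x = pderiv i f x * η x + f x * pderiv i η x := by
    intro x
    by_cases hx : x ∈ tsupport η
    · exact pderiv_mul ((hf.contDiffAt (hD.mem_nhds (h.2.2 hx))).differentiableAt (by simp))
        (h.1.differentiable (by simp) x) i
    · have hfη : x ∉ tsupport fun y => f y * η y := fun hx' => hx (tsupport_mul_subset_right hx')
      have hpderiv : ∀ {g : Pt d → ℂ}, x ∉ tsupport g → pderiv i g x = 0 := fun hg =>
        image_eq_zero_of_notMem_tsupport fun hx' => hg (tsupport_pderiv_subset i _ hx')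
      rw [hpderiv hfη, hpderiv hx, image_eq_zero_of_notMem_tsupport hx, mul_zero, mul_zero,
        add_zero]
  have hzero := integral_pderiv_eq_zero ((h.contDiff_mul hD hf).of_le (by simp)) h.2.1.mul_left i
  simp only [hprod] at hzero
  rw [integral_add (h.integrable_contDiffOn_mul hD (contDiffOn_pderiv hD hf i))
    ((h.pderiv i).integrable_contDiffOn_mul hD hf)] at hzero
  rw [(h.pderiv i).setIntegral_mul_eq_integral, h.setIntegral_mul_eq_integral]
  exact eq_neg_of_add_eq_zero_right hzero

theorem pderiv_ellOp (A : Matrix (Fin d) (Fin d) ℝ) (k : ℝ) (hη : ContDiff ℝ ∞ η) (l : Fin d)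
    (x : Pt d) : pderiv l (ellOp A k η) x = ellOp A k (pderiv l η) x := by
  have hdiff : ∀ {g : Pt d → ℂ}, ContDiff ℝ ∞ g → DifferentiableAt ℝ g x := fun hg =>
    hg.differentiable (by simp) x
  have hcomm : ∀ {g : Pt d → ℂ}, ContDiff ℝ ∞ g → ∀ i y, pderiv l (pderiv i g) y =
      pderiv i (pderiv l g) y := fun hg i y =>
    pderiv_comm (hg.contDiffAt.of_le ENat.LEInfty.out) l i
  have hthird : ∀ i j, pderiv l (pderiv i (pderiv j η)) x = pderiv i (pderiv j (pderiv l η)) x :=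
    fun i j => by rw [hcomm (contDiff_pderiv hη j), funext (hcomm hη j)]
  have hterm : ∀ i j, DifferentiableAt ℝ (fun y => (A i j : ℂ) * pderiv i (pderiv j η) y) x :=
    fun i j => (hdiff (contDiff_pderiv (contDiff_pderiv hη j) i)).const_mul _
  have hsum : ∀ i, DifferentiableAt ℝ (fun y => ∑ j, (A i j : ℂ) * pderiv i (pderiv j η) y) x :=
    fun i => DifferentiableAt.fun_sum fun j _ => hterm i j
  have hfderiv : fderiv ℝ (ellOp A k η) x = (k : ℂ) • fderiv ℝ η x -
      ∑ i, ∑ j, (A i j : ℂ) • fderiv ℝ (pderiv i (pderiv j η)) x := by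
    change fderiv ℝ (fun y => k * η y - ∑ i, ∑ j, (A i j : ℂ) * pderiv i (pderiv j η) y) x = _
    rw [fderiv_fun_sub ((hdiff hη).const_mul _) (DifferentiableAt.fun_sum fun i _ => hsum i),
      fderiv_const_mul (hdiff hη), fderiv_fun_sum fun i _ => hsum i]
    simp only [fderiv_fun_sum fun j _ => hterm _ j,
      fderiv_const_mul (hdiff (contDiff_pderiv (contDiff_pderiv hη _) _))]
  simp only [ellOp, ← hthird]
  simp [pderiv, hfderiv]

theorem IsDistribSol.mono {G H : Pt d → ℂ} (h : IsDistribSol A k D G H) (hBD : B ⊆ D) :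
    IsDistribSol A k B G H := fun η hη => by
  rw [← (hη.ellOp A k).setIntegral_mul_eq hBD, ← hη.setIntegral_mul_eq hBD]
  exact h η (hη.mono hBD)

theorem isDistribSol_ellOp (A : Matrix (Fin d) (Fin d) ℝ) (k : ℝ) (hD : IsOpen D)
    (hf : ContDiffOn ℝ ∞ f D) : IsDistribSol A k D f (ellOp A k f) := by
  intro η hη
  have hf₂ := fun i j => contDiffOn_pderiv hD (contDiffOn_pderiv hD hf j) i
  have hparts : ∀ i j, ∫ x in D, f x * pderiv i (pderiv j η) x =
      ∫ x in D, η x * pderiv i (pderiv j f) x := by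
    intro i j
    rw [setIntegral_mul_pderiv hD hf (hη.pderiv j),
      setIntegral_mul_pderiv hD (contDiffOn_pderiv hD hf i) hη, neg_neg]
    refine setIntegral_congr_fun hD.measurableSet fun x hx => ?_
    have hfx : ContDiffAt ℝ 2 f x :=
      (hf.contDiffAt (hD.mem_nhds hx)).of_le ENat.LEInfty.out
    simp only [pderiv_comm hfx j i, mul_comm]
  have hint : ∀ {θ g : Pt d → ℂ}, IsTest D θ → ContDiffOn ℝ ∞ g D →
      Integrable (fun x => g x * θ x) (leb D) := fun hθ hg =>
    (hθ.integrable_contDiffOn_mul hD hg).restrict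
  simp only [mul_comm _ (η _)]
  rw [integral_mul_ellOp A k (hint hη hf) fun i j => hint ((hη.pderiv j).pderiv i) hf,
    integral_mul_ellOp A k (by simpa only [mul_comm] using hint hη hf) fun i j => by
      simpa only [mul_comm] using hint hη (hf₂ i j)]
  simp only [hparts, mul_comm (η _) (f _)]

end distributionalDerivatives

section variationalSpace

variable {d : ℕ} {D : Set (Pt d)}

theorem Lp_norm_sq_eq_integral {E : Type*} [NormedAddCommGroup E] [InnerProductSpace ℂ E]
    {α : Type*} [MeasurableSpace α] {μ : Measure α} (u : Lp E 2 μ) :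
    ‖u‖ ^ 2 = ∫ x, ‖u x‖ ^ 2 ∂μ := by
  have h := L2.inner_def (𝕜 := ℂ) u u
  simp only [inner_self_eq_norm_sq_to_K, Complex.coe_algebraMap, ← Complex.ofReal_pow] at h
  rw [integral_complex_ofReal] at h
  exact_mod_cast h

theorem IsTest.memLp_grad {η : Pt d → ℂ} (h : IsTest D η) : MemLp (grad η) 2 (leb D) :=
  ((continuous_grad h.1).memLp_of_hasCompactSupport (hasCompactSupport_grad h.2.1)).restrict D

theorem IsTest.isWeakGrad {η : Pt d → ℂ} (h : IsTest D η) :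
    IsWeakGrad D (h.memLp.toLp η) (h.memLp_grad.toLp (grad η)) := by
  intro θ hθ i
  have hfst : ∫ x in D, h.memLp.toLp η x * TransmissionEig.pderiv i θ x =
      ∫ x in D, η x * TransmissionEig.pderiv i θ x :=
    integral_congr_ae (h.memLp.coeFn_toLp.mul .rfl)
  have hsnd : ∫ x in D, h.memLp_grad.toLp (grad η) x i * θ x =
      ∫ x in D, TransmissionEig.pderiv i η x * θ x :=
    integral_congr_ae (by filter_upwards [h.memLp_grad.coeFn_toLp] with x hx; rw [hx]; rfl)
  rw [hfst, hsnd, (hθ.pderiv i).setIntegral_mul_eq_integral, hθ.setIntegral_mul_eq_integral]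
  exact integral_mul_pderiv (h.1.of_le (by simp)) (hθ.1.of_le (by simp)) hθ.2.1 i

/-- The element `(η, 0)` of `X(D)` given by a test function `η`. -/
def IsTest.toX {η : Pt d → ℂ} (h : IsTest D η) : X D :=
  let p : L2Pair D := WithLp.toLp 2 (h.memLp.toLp η, h.memLp_grad.toLp (grad η))
  have hp : p ∈ H10 D := (testSubspace D).le_topologicalClosure
    (Submodule.subset_span ⟨η, h, h.memLp.coeFn_toLp, h.memLp_grad.coeFn_toLp⟩)
  (⟨WithLp.toLp 2 (p, 0), h.isWeakGrad, (H1 D).zero_mem, by simpa using hp⟩ : XSub D)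

theorem w_toX {η : Pt d → ℂ} (h : IsTest D η) : X.w h.toX =ᵐ[leb D] η := h.memLp.coeFn_toLp

theorem dw_toX {η : Pt d → ℂ} (h : IsTest D η) : X.dw h.toX =ᵐ[leb D] grad η :=
  h.memLp_grad.coeFn_toLp

theorem v_toX {η : Pt d → ℂ} (h : IsTest D η) : X.v h.toX = 0 := rfl

theorem dv_toX {η : Pt d → ℂ} (h : IsTest D η) : X.dv h.toX = 0 := rfl

theorem v_toX_ae_eq_zero {η : Pt d → ℂ} (h : IsTest D η) : ∀ᵐ x ∂leb D, X.v h.toX x = 0 := by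
  rw [v_toX]
  exact Lp.coeFn_zero ℂ 2 (leb D)

theorem dv_toX_ae_eq_zero {η : Pt d → ℂ} (h : IsTest D η) : ∀ᵐ x ∂leb D, X.dv h.toX x = 0 := by
  rw [dv_toX]
  exact Lp.coeFn_zero (CVec d) 2 (leb D)

theorem X.inner_eq (ψ f : X D) :
    inner ℂ ψ f = inner ℂ (X.w ψ) (X.w f) + inner ℂ (X.dw ψ) (X.dw f) +
      (inner ℂ (X.v ψ) (X.v f) + inner ℂ (X.dv ψ) (X.dv f)) := rfl

theorem X.norm_sq_eq (f : X D) :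
    ‖f‖ ^ 2 = ‖X.w f‖ ^ 2 + ‖X.dw f‖ ^ 2 + (‖X.v f‖ ^ 2 + ‖X.dv f‖ ^ 2) := by
  have h := X.inner_eq f f
  simp only [inner_self_eq_norm_sq_to_K, Complex.coe_algebraMap] at h
  exact_mod_cast h

theorem X.norm_dw_sq_le (f : X D) : ‖X.dw f‖ ^ 2 ≤ ‖f‖ ^ 2 := by
  rw [X.norm_sq_eq]
  linarith [sq_nonneg ‖X.w f‖, sq_nonneg ‖X.v f‖, sq_nonneg ‖X.dv f‖]

theorem X.isWeakGrad_dw (f : X D) : IsWeakGrad D (X.w f) (X.dw f) :=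
  (show XSub D from f).2.1

theorem inner_opA_const (A : Matrix (Fin d) (Fin d) ℝ) (κ : ℝ) (f φ : X D) :
    inner ℂ φ (opA D (fun _ => A) κ f) = formA D (fun _ => A) κ f φ := by
  obtain ⟨K, hK⟩ := (Set.finite_range fun ij : Fin d × Fin d => |A ij.1 ij.2|).bddAbove
  have hbound : ∀ i j, |A i j| ≤ K := fun i j => hK ⟨(i, j), rfl⟩
  exact inner_opA D (fun _ => A) κ (fun _ _ => measurable_const) (fun _ => hbound) f φ

theorem IsWeakGrad.integral_mul_conj_ellOp {u : Lp ℂ 2 (leb D)} {g : Lp (CVec d) 2 (leb D)}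
    (hug : IsWeakGrad D u g) (A : Matrix (Fin d) (Fin d) ℝ) (k : ℝ) {η : Pt d → ℂ}
    (hη : IsTest D η) :
    ∫ x in D, u x * conj (ellOp A k η x) =
      ∫ x in D, dotConj (matVec A (g x)) (grad η x) + k * u x * conj (η x) := by
  refine integral_mul_conj_ellOp_eq_integral_dotConj A k (hη.conj.integrable_mul (Lp.memLp u))
    (fun i j => (hη.pderiv i).conj.integrable_mul ((Lp.memLp g).eval_piLp j))
    (fun i j => ((hη.pderiv j).pderiv i).conj.integrable_mul (Lp.memLp u)) fun i j => ?_
  rw [← hug _ (hη.pderiv i).conj j]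
  refine integral_congr_ae (.of_forall fun x => ?_)
  simp only [pderiv_conj, pderiv_comm (hη.1.contDiffAt.of_le ENat.LEInfty.out) i j]

theorem formA_const_toX (A : Matrix (Fin d) (Fin d) ℝ) (κ : ℝ) (f : X D) {η : Pt d → ℂ}
    (hη : IsTest D η) :
    formA D (fun _ => A) κ f hη.toX = ∫ x in D, X.w f x * conj (ellOp A κ η x) := by
  have hsnd : ∫ x in D, dotConj (X.dv f x) (X.dv hη.toX x) + X.v f x * conj (X.v hη.toX x) = 0 := by
    refine integral_eq_zero_of_ae ?_
    filter_upwards [v_toX_ae_eq_zero hη, dv_toX_ae_eq_zero hη] with x hv hdv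
    simp [hv, hdv, dotConj]
  rw [formA, hsnd, sub_zero, (X.isWeakGrad_dw f).integral_mul_conj_ellOp A κ hη]
  refine integral_congr_ae ?_
  filter_upwards [w_toX hη, dw_toX hη] with x hw hdw
  rw [hw, hdw]

theorem formL_toX (m : ℝ) (f : X D) {η : Pt d → ℂ} (hη : IsTest D η) :
    formL D m f hη.toX = m * ∫ x in D, X.w f x * conj (η x) := by
  rw [formL, ← integral_const_mul]
  refine integral_congr_ae ?_
  filter_upwards [w_toX hη, v_toX_ae_eq_zero hη] with x hw hv
  simp [hw, hv, mul_assoc]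

theorem one_matVec (ξ : CVec d) : matVec 1 ξ = ξ := by
  ext i
  simp [matVec, Matrix.one_apply, apply_ite, ite_mul]

theorem inner_toX (f : X D) {η : Pt d → ℂ} (hη : IsTest D η) :
    inner ℂ hη.toX f = ∫ x in D, X.w f x * conj (ellOp 1 1 η x) := by
  rw [X.inner_eq, v_toX, dv_toX, inner_zero_left, inner_zero_left, add_zero, add_zero,
    (X.isWeakGrad_dw f).integral_mul_conj_ellOp 1 1 hη, add_comm, inner_L2_eq, inner_L2vec_eq,
    ← integral_add (integrable_L2vec _ _) (integrable_L2 _ _)]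
  refine integral_congr_ae ?_
  filter_upwards [w_toX hη, dw_toX hη] with x hw hdw
  simp only [hw, hdw, one_matVec, Complex.ofReal_one, one_mul]

theorem isDistribSol_of_opA_eq {A : Matrix (Fin d) (Fin d) ℝ} {κ n : ℝ} {c : ℂ} {f g : X D}
    (h : opA D (fun _ => A) κ f = opB D n g + c • opC D κ g) :
    IsDistribSol A κ D (X.w f) fun x => (n + c * κ) * X.w g x := by
  intro η hη
  have htest := congrArg (inner ℂ hη.conj.toX) h
  rw [inner_opA_const, inner_add_right, inner_smul_right, opB, opC, inner_opL, inner_opL,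
    formA_const_toX, formL_toX, formL_toX] at htest
  simp only [ellOp_conj, Complex.conj_conj] at htest
  simp only [htest, mul_assoc, integral_const_mul]
  ring

theorem isDistribSol_of_opA_eq_of_contDiffOn (hD : IsOpen D) {A : Matrix (Fin d) (Fin d) ℝ}
    {κ : ℝ} {u φ : X D} (hu : opA D (fun _ => A) κ u = φ) {f : Pt d → ℂ}
    (hf : ContDiffOn ℝ ∞ f D) (hφ : X.w φ =ᵐ[leb D] f) :
    IsDistribSol A κ D (X.w u) (ellOp 1 1 f) := by
  intro η hη
  have htest := congrArg (inner ℂ hη.conj.toX) hu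
  rw [inner_opA_const, formA_const_toX, inner_toX] at htest
  simp only [ellOp_conj, Complex.conj_conj] at htest
  have hcongr : ∫ x in D, X.w φ x * ellOp 1 1 η x = ∫ x in D, f x * ellOp 1 1 η x :=
    integral_congr_ae (hφ.mul .rfl)
  rw [htest, hcongr]
  exact isDistribSol_ellOp 1 1 hD hf η hη

end variationalSpace

section gradientBounds

variable {d : ℕ} {A : Matrix (Fin d) (Fin d) ℝ} {k : ℝ} {D : Set (Pt d)}

theorem IsDistribSol.weakGrad {u : Lp ℂ 2 (leb D)} {g : Lp (CVec d) 2 (leb D)} {h H : Pt d → ℂ}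
    (hu : IsDistribSol A k D u h) (hug : IsWeakGrad D u g) {l : Fin d}
    (hH : ∀ η, IsTest D η → ∫ x in D, h x * pderiv l η x = -∫ x in D, H x * η x) :
    IsDistribSol A k D (fun x => g x l) H := by
  intro η hη
  have hparts := hug _ (hη.ellOp A k) l
  rwa [funext (pderiv_ellOp A k hη.1 l), hu _ (hη.pderiv l), hH η hη, neg_inj, eq_comm] at hparts

theorem setIntegral_norm_sq_eq_sum {g : Pt d → CVec d} (hg : MemLp g 2 (leb D)) :
    ∫ x in D, ‖g x‖ ^ 2 = ∑ l, ∫ x in D, ‖g x l‖ ^ 2 := by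
  rw [← integral_finsetSum _ fun l _ => (hg.eval_piLp l).integrable_norm_pow two_ne_zero]
  simp only [EuclideanSpace.norm_sq_eq]

theorem exists_ae_norm_vec_sq_le (hd : d ≤ 3) (hA : 0 < lowerBd A) (hk : 0 < k) (z : Pt d)
    {r R : ℝ} (hr : 0 < r) (hrR : r < R) :
    ∃ C : ℝ, 0 ≤ C ∧ ∀ G H : Pt d → CVec d, MemLp G 2 (leb (Metric.ball z R)) →
      MemLp H 2 (leb (Metric.ball z R)) →
      (∀ l, IsDistribSol A k (Metric.ball z R) (fun x => G x l) fun x => H x l) →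
      ∀ᵐ x, x ∈ Metric.closedBall z r → ‖G x‖ ^ 2 ≤
        C * ((∫ y in Metric.ball z R, ‖G y‖ ^ 2) + ∫ y in Metric.ball z R, ‖H y‖ ^ 2) := by
  obtain ⟨C, hC, hbound⟩ := exists_ae_norm_sq_le hd hA hk z hr hrR
  refine ⟨C, hC, fun G H hG hH hsol => ?_⟩
  have hcomp := fun l => hbound _ _ (hG.eval_piLp l) (hH.eval_piLp l) (hsol l)
  filter_upwards [ae_all_iff.2 hcomp] with x hx hxr
  rw [EuclideanSpace.norm_sq_eq, setIntegral_norm_sq_eq_sum hG, setIntegral_norm_sq_eq_sum hH,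
    ← Finset.sum_add_distrib, Finset.mul_sum]
  exact Finset.sum_le_sum fun l _ => hx l hxr

theorem setIntegral_norm_dw_sq_le (f : X D) {B : Set (Pt d)} (hB : B ⊆ D) :
    ∫ x in B, ‖X.dw f x‖ ^ 2 ≤ ‖f‖ ^ 2 := by
  have hint : IntegrableOn (fun x => ‖X.dw f x‖ ^ 2) D :=
    (Lp.memLp (X.dw f)).integrable_norm_pow two_ne_zero
  calc ∫ x in B, ‖X.dw f x‖ ^ 2 ≤ ∫ x in D, ‖X.dw f x‖ ^ 2 :=
        setIntegral_mono_set hint (.of_forall fun x => sq_nonneg _) hB.eventuallyLE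
    _ = ‖X.dw f‖ ^ 2 := (Lp_norm_sq_eq_integral _).symm
    _ ≤ ‖f‖ ^ 2 := X.norm_dw_sq_le f

theorem exists_ae_norm_dw_sq_le (hd : d ≤ 3) {κ : ℝ} (hA : 0 < lowerBd A) (hκ : 0 < κ) {z : Pt d}
    {r R : ℝ} (hr : 0 < r) (hrR : r < R) (hRD : Metric.ball z R ⊆ D) (n : ℝ) (c : ℂ) :
    ∃ C : ℝ, 0 ≤ C ∧ ∀ f g : X D, opA D (fun _ => A) κ f = opB D n g + c • opC D κ g →
      ∀ᵐ x, x ∈ Metric.closedBall z r → ‖X.dw f x‖ ^ 2 ≤ C * (‖f‖ ^ 2 + ‖g‖ ^ 2) := by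
  obtain ⟨C, hC, hbound⟩ := exists_ae_norm_vec_sq_le hd hA hκ z hr hrR
  set s : ℂ := n + c * κ
  refine ⟨C * (1 + ‖s‖ ^ 2), by positivity, fun f g hfg => ?_⟩
  have hmemLp : ∀ f : X D, MemLp (X.dw f) 2 (leb (Metric.ball z R)) := fun f =>
    (Lp.memLp _).mono_measure (Measure.restrict_mono_set _ hRD)
  have hsol : ∀ l, IsDistribSol A κ (Metric.ball z R) (fun x => X.dw f x l)
      fun x => (s • X.dw g x) l := by
    refine fun l => ((isDistribSol_of_opA_eq hfg).weakGrad (X.isWeakGrad_dw f) ?_).mono hRD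
    intro η hη
    simp only [PiLp.smul_apply, smul_eq_mul, mul_assoc, integral_const_mul,
      X.isWeakGrad_dw g η hη l, mul_neg, s]
  filter_upwards [hbound _ (fun x => s • X.dw g x) (hmemLp f) ((hmemLp g).const_smul s) hsol]
    with x hx hxr
  refine (hx hxr).trans ?_
  simp only [norm_smul, mul_pow, integral_const_mul]
  rw [mul_assoc]
  refine mul_le_mul_of_nonneg_left ?_ hC
  have hsg := mul_le_mul_of_nonneg_left (setIntegral_norm_dw_sq_le g hRD) (sq_nonneg ‖s‖)
  nlinarith [setIntegral_norm_dw_sq_le f hRD, sq_nonneg ‖f‖, sq_nonneg ‖g‖, sq_nonneg ‖s‖,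
    mul_nonneg (sq_nonneg ‖s‖) (sq_nonneg ‖f‖)]

theorem exists_ae_norm_dw_sq_le_of_contDiffOn (hd : d ≤ 3) {κ : ℝ} (hA : 0 < lowerBd A)
    (hκ : 0 < κ) (hD : IsOpen D) {z : Pt d} {r R : ℝ} (hr : 0 < r) (hrR : r < R)
    (hRD : Metric.closedBall z R ⊆ D) {u φ : X D} (hu : opA D (fun _ => A) κ u = φ)
    {f : Pt d → ℂ} (hf : ContDiffOn ℝ ∞ f D) (hφ : X.w φ =ᵐ[leb D] f) :
    ∃ C : ℝ, 0 ≤ C ∧ ∀ᵐ x, x ∈ Metric.closedBall z r → ‖X.dw u x‖ ^ 2 ≤ C := by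
  have hBD : Metric.ball z R ⊆ D := Metric.ball_subset_closedBall.trans hRD
  obtain ⟨C, hC, hbound⟩ := exists_ae_norm_vec_sq_le hd hA hκ z hr hrR
  have hf' := contDiffOn_ellOp 1 1 hD hf
  have hcont : ContinuousOn (grad (ellOp 1 1 f)) D :=
    (PiLp.continuous_toLp 2 _).comp_continuousOn
      (continuousOn_pi.2 fun l => (contDiffOn_pderiv hD hf' l).continuousOn)
  have hmemLp : MemLp (grad (ellOp 1 1 f)) 2 (leb (Metric.ball z R)) := by
    obtain ⟨N, hN⟩ := (isCompact_closedBall z R).exists_bound_of_continuousOn (hcont.mono hRD)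
    have : IsFiniteMeasure (leb (Metric.ball z R)) := ⟨by simpa using measure_ball_lt_top⟩
    refine .of_bound ((hcont.mono hBD).aestronglyMeasurable measurableSet_ball) N ?_
    filter_upwards [ae_restrict_mem measurableSet_ball] with x hx
    exact hN x (Metric.ball_subset_closedBall hx)
  have hsol : ∀ l, IsDistribSol A κ (Metric.ball z R) (fun x => X.dw u x l)
      fun x => grad (ellOp 1 1 f) x l := fun l =>
    ((isDistribSol_of_opA_eq_of_contDiffOn hD hu hf hφ).weakGrad (X.isWeakGrad_dw u)
      fun η hη => setIntegral_mul_pderiv hD hf' hη l).mono hBD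
  exact ⟨_, by positivity, hbound _ _ ((Lp.memLp _).mono_measure (Measure.restrict_mono_set _ hBD))
    hmemLp hsol⟩

end gradientBounds

section coefficientFields

variable {d : ℕ} {D : Set (Pt d)} {a b : Pt d → Matrix (Fin d) (Fin d) ℝ}

/-- The admissible coefficients: bounded measurable fields of symmetric matrices. -/
def IsCoeffField (a : Pt d → Matrix (Fin d) (Fin d) ℝ) : Prop :=
  (∀ i j, Measurable fun x => a x i j) ∧ (∃ K : ℝ, ∀ x i j, |a x i j| ≤ K) ∧ ∀ x, (a x).IsSymm

theorem isCoeffField_const {A : Matrix (Fin d) (Fin d) ℝ} (hA : A.IsSymm) :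
    IsCoeffField fun _ : Pt d => A := by
  obtain ⟨K, hK⟩ := (Set.finite_range fun ij : Fin d × Fin d => |A ij.1 ij.2|).bddAbove
  exact ⟨fun _ _ => measurable_const, ⟨K, fun _ i j => hK ⟨(i, j), rfl⟩⟩, fun _ => hA⟩

/-- Multiplication by the coefficient `a`, as an operator on `L²(D; ℂ^d)`. -/
def IsCoeffField.mulField (ha : IsCoeffField a) (D : Set (Pt d)) :
    Lp (CVec d) 2 (leb D) →L[ℂ] Lp (CVec d) 2 (leb D) :=
  (exists_mulField D a ha.1 ha.2.1.choose_spec).choose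

theorem IsCoeffField.coeFn_mulField (ha : IsCoeffField a) (g : Lp (CVec d) 2 (leb D)) :
    ha.mulField D g =ᵐ[leb D] fun x => matVec (a x) (g x) :=
  (exists_mulField D a ha.1 ha.2.1.choose_spec).choose_spec g

theorem IsCoeffField.inner_mulField (ha : IsCoeffField a) (p g : Lp (CVec d) 2 (leb D)) :
    inner ℂ p (ha.mulField D g) = ∫ x in D, dotConj (matVec (a x) (g x)) (p x) := by
  rw [inner_L2vec_eq]
  refine integral_congr_ae ?_
  filter_upwards [ha.coeFn_mulField g] with x hx
  rw [hx]

theorem IsCoeffField.integrable_dotConj (ha : IsCoeffField a) (g p : Lp (CVec d) 2 (leb D)) :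
    Integrable (fun x => dotConj (matVec (a x) (g x)) (p x)) (leb D) := by
  refine (integrable_L2vec (ha.mulField D g) p).congr ?_
  filter_upwards [ha.coeFn_mulField g] with x hx
  rw [hx]

theorem IsCoeffField.isSymmetric_mulField (ha : IsCoeffField a) :
    (ha.mulField D : Lp (CVec d) 2 (leb D) →ₗ[ℂ] Lp (CVec d) 2 (leb D)).IsSymmetric := by
  intro g p
  change inner ℂ (ha.mulField D g) p = inner ℂ g (ha.mulField D p)
  rw [← inner_conj_symm, ha.inner_mulField, ha.inner_mulField, ← integral_conj]
  exact integral_congr_ae (.of_forall fun x => (dotConj_matVec_comm (ha.2.2 x) _ _).symm)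

theorem IsCoeffField.re_inner_mulField (ha : IsCoeffField a) (g : Lp (CVec d) 2 (leb D)) :
    (inner ℂ g (ha.mulField D g)).re = ∫ x in D, (dotConj (matVec (a x) (g x)) (g x)).re := by
  rw [ha.inner_mulField]
  exact (Complex.reCLM.integral_comp_comm (ha.integrable_dotConj g g)).symm

theorem IsCoeffField.mul_norm_sq_le_re_inner (ha : IsCoeffField a) {c : ℝ}
    (hc : ∀ x ξ, c * ‖ξ‖ ^ 2 ≤ (dotConj (matVec (a x) ξ) ξ).re) (g : Lp (CVec d) 2 (leb D)) :
    c * ‖g‖ ^ 2 ≤ (inner ℂ g (ha.mulField D g)).re := by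
  rw [Lp_norm_sq_eq_integral, ← integral_const_mul, ha.re_inner_mulField]
  exact integral_mono (((Lp.memLp g).integrable_norm_pow two_ne_zero).const_mul c)
    (ha.integrable_dotConj g g).re fun x => hc x (g x)

theorem IsCoeffField.re_inner_le_mul_norm_sq (ha : IsCoeffField a) {c : ℝ}
    (hc : ∀ x ξ, (dotConj (matVec (a x) ξ) ξ).re ≤ c * ‖ξ‖ ^ 2) (g : Lp (CVec d) 2 (leb D)) :
    (inner ℂ g (ha.mulField D g)).re ≤ c * ‖g‖ ^ 2 := by
  rw [Lp_norm_sq_eq_integral, ← integral_const_mul, ha.re_inner_mulField]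
  exact integral_mono (ha.integrable_dotConj g g).re
    (((Lp.memLp g).integrable_norm_pow two_ne_zero).const_mul c) fun x => hc x (g x)

theorem IsCoeffField.inner_opA (ha : IsCoeffField a) (κ : ℝ) (φ f : X D) :
    inner ℂ φ (opA D a κ f) =
      inner ℂ (X.dw φ) (ha.mulField D (X.dw f)) + κ * inner ℂ (X.w φ) (X.w f) -
        (inner ℂ (X.dv φ) (X.dv f) + inner ℂ (X.v φ) (X.v f)) := by
  rw [TransmissionEig.inner_opA D a κ ha.1 ha.2.1.choose_spec, ha.inner_mulField, inner_L2_eq,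
    inner_L2_eq, inner_L2vec_eq, ← integral_const_mul,
    ← integral_add (ha.integrable_dotConj _ _) ((integrable_L2 _ _).const_mul _),
    ← integral_add (integrable_L2vec _ _) (integrable_L2 _ _)]
  simp only [formA, mul_assoc]

theorem IsCoeffField.isSymmetric_opA (ha : IsCoeffField a) (κ : ℝ) :
    (opA D a κ : X D →ₗ[ℂ] X D).IsSymmetric := by
  intro f φ
  change inner ℂ (opA D a κ f) φ = inner ℂ f (opA D a κ φ)
  have hmul : inner ℂ (ha.mulField D (X.dw f)) (X.dw φ) =
      inner ℂ (X.dw f) (ha.mulField D (X.dw φ)) := ha.isSymmetric_mulField _ _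
  rw [← inner_conj_symm, ha.inner_opA, ha.inner_opA]
  simp only [map_sub, map_add, map_mul, inner_conj_symm, Complex.conj_ofReal, hmul]

end coefficientFields

section coercivity

theorem isInvertible_of_isSymmetric_of_le {E : Type*} [NormedAddCommGroup E]
    [InnerProductSpace ℂ E] [CompleteSpace E] {T : E →L[ℂ] E}
    (hT : (T : E →ₗ[ℂ] E).IsSymmetric) {c : ℝ} (hc : 0 ≤ c) (hbound : ∀ f, ‖f‖ ≤ c * ‖T f‖) :
    T.IsInvertible := by
  lift c to NNReal using hc
  have hlip : AntilipschitzWith c T := T.antilipschitz_of_bound hbound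
  have hclosed : IsClosed (T.range : Set E) := hlip.isClosed_range T.uniformContinuous
  have : CompleteSpace T.range := hclosed.completeSpace_coe
  have hrange : T.range = ⊤ := by
    rw [← Submodule.orthogonal_eq_bot_iff, Submodule.eq_bot_iff]
    intro y hy
    have hTy : T y = 0 := by
      rw [← inner_self_eq_zero (𝕜 := ℂ)]
      exact (hT y (T y)).trans ((Submodule.mem_orthogonal' _ _).1 hy _ ⟨T y, rfl⟩)
    simpa [hTy] using hbound y
  exact ⟨.ofBijective T (LinearMap.ker_eq_bot.2 hlip.injective) hrange,
    ContinuousLinearEquiv.coe_ofBijective _ _ _⟩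

theorem norm_le_of_mul_norm_sq_le_re_inner {E : Type*} [NormedAddCommGroup E]
    [InnerProductSpace ℂ E] {A T : E →L[ℂ] E} {c : ℝ} (hc : 0 < c) {f : E}
    (h : c * ‖f‖ ^ 2 ≤ (inner ℂ (T f) (A f)).re) : ‖f‖ ≤ ‖T‖ / c * ‖A f‖ := by
  rcases (norm_nonneg f).eq_or_lt with hf | hf
  · rw [← hf]
    positivity
  have hupper : (inner ℂ (T f) (A f)).re ≤ ‖T‖ * ‖f‖ * ‖A f‖ :=
    (Complex.re_le_norm _).trans ((norm_inner_le_norm _ _).trans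
      (mul_le_mul_of_nonneg_right (T.le_opNorm f) (norm_nonneg _)))
  rw [div_mul_eq_mul_div, le_div_iff₀ hc]
  refine le_of_mul_le_mul_right ?_ hf
  linarith

variable {H : Type*} [NormedAddCommGroup H] [InnerProductSpace ℂ H]

theorem re_inner_ofReal_smul_self (κ : ℝ) (u : H) :
    (inner ℂ u ((κ : ℂ) • u)).re = κ * ‖u‖ ^ 2 := by
  have hself : (inner ℂ u u).re = ‖u‖ ^ 2 := inner_self_eq_norm_sq (𝕜 := ℂ) u
  rw [inner_smul_right, Complex.re_ofReal_mul, hself]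

theorem mul_norm_sq_add_le_re_inner_of_one_lt {b : ℝ} (hb : 1 < b) {ξ η : H}
    (hη : b * ‖ξ‖ ^ 2 ≤ (inner ℂ ξ η).re) (ζ : H) :
    (b - 1) / (b + 1) * (‖ξ‖ ^ 2 + ‖ζ‖ ^ 2) ≤
      (inner ℂ ξ η).re - (inner ℂ ((2 : ℂ) • ξ + (-1 : ℂ) • ζ) ζ).re := by
  have hmixed : (inner ℂ ((2 : ℂ) • ξ + (-1 : ℂ) • ζ) ζ).re ≤ 2 * (‖ξ‖ * ‖ζ‖) - ‖ζ‖ ^ 2 := by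
    have hcs := (Complex.re_le_norm _).trans (norm_inner_le_norm (𝕜 := ℂ) ξ ζ)
    have hself : (inner ℂ ζ ζ).re = ‖ζ‖ ^ 2 := inner_self_eq_norm_sq (𝕜 := ℂ) ζ
    simp only [inner_add_left, inner_smul_left, map_neg, map_one, map_ofNat, Complex.add_re,
      Complex.mul_re, Complex.re_ofNat, Complex.im_ofNat, Complex.neg_re, Complex.one_re,
      Complex.neg_im, Complex.one_im, hself]
    linarith
  have hpos : 0 < b + 1 := by linarith
  rw [div_mul_eq_mul_div, div_le_iff₀ hpos]
  nlinarith [sq_nonneg ((b + 1) * ‖ξ‖ - 2 * ‖ζ‖), sq_nonneg ‖ξ‖, sq_nonneg ‖ζ‖,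
    mul_le_mul_of_nonneg_right (hη) hpos.le,
    mul_le_mul_of_nonneg_right hmixed hpos.le, mul_nonneg (sub_nonneg.2 hb.le) (sq_nonneg ‖ξ‖)]

theorem two_mul_re_inner_le {S : H →ₗ[ℂ] H} (hS : S.IsSymmetric)
    (hS0 : ∀ ξ, 0 ≤ (inner ℂ ξ (S ξ)).re) {t : ℝ} (ht : 0 < t) (ξ ζ : H) :
    2 * (inner ℂ ζ (S ξ)).re ≤ (inner ℂ ξ (S ξ)).re / t + t * (inner ℂ ζ (S ζ)).re := by
  have hsq := hS0 (ξ - (t : ℂ) • ζ)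
  have hcomm : (inner ℂ ξ (S ζ)).re = (inner ℂ ζ (S ξ)).re := by
    rw [← hS, ← inner_conj_symm, Complex.conj_re]
  simp only [map_sub, map_smul, inner_sub_left, inner_sub_right, inner_smul_left, inner_smul_right,
    Complex.conj_ofReal, Complex.sub_re, Complex.re_ofReal_mul, hcomm] at hsq
  rw [div_add' _ _ _ ht.ne', le_div_iff₀ ht]
  linarith

theorem mul_norm_sq_add_le_re_inner_of_lt_one {S : H →ₗ[ℂ] H} (hS : S.IsSymmetric) {b b' t : ℝ}
    (hb' : 0 ≤ b') (ht : 1 ≤ t) (hlower : ∀ ξ, b' * ‖ξ‖ ^ 2 ≤ (inner ℂ ξ (S ξ)).re)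
    (hupper : ∀ ξ, (inner ℂ ξ (S ξ)).re ≤ b * ‖ξ‖ ^ 2) (ξ ζ : H) :
    min (b' * (1 - 1 / t)) (1 - t * b) * (‖ξ‖ ^ 2 + ‖ζ‖ ^ 2) ≤
      (inner ℂ (ξ + (-2 : ℂ) • ζ) (S ξ)).re - (inner ℂ ((-1 : ℂ) • ζ) ζ).re := by
  have ht0 : 0 < t := by linarith
  have hyoung := two_mul_re_inner_le hS
    (fun ξ => (mul_nonneg hb' (sq_nonneg ‖ξ‖)).trans (hlower ξ)) ht0 ξ ζ
  have hself : (inner ℂ ζ ζ).re = ‖ζ‖ ^ 2 := inner_self_eq_norm_sq (𝕜 := ℂ) ζ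
  have hfst : min (b' * (1 - 1 / t)) (1 - t * b) * ‖ξ‖ ^ 2 ≤
      (1 - 1 / t) * (inner ℂ ξ (S ξ)).re := by
    have ht1 : 0 ≤ 1 - 1 / t := sub_nonneg.2 ((div_le_one ht0).2 ht)
    refine (mul_le_mul_of_nonneg_right (min_le_left _ _) (sq_nonneg _)).trans ?_
    linarith [mul_le_mul_of_nonneg_left (hlower ξ) ht1]
  have hsnd : min (b' * (1 - 1 / t)) (1 - t * b) * ‖ζ‖ ^ 2 ≤
      ‖ζ‖ ^ 2 - t * (inner ℂ ζ (S ζ)).re := by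
    refine (mul_le_mul_of_nonneg_right (min_le_right _ _) (sq_nonneg _)).trans ?_
    linarith [mul_le_mul_of_nonneg_left (hupper ζ) ht0.le]
  simp only [inner_add_left, inner_smul_left, map_neg, map_one, map_ofNat, Complex.add_re,
    Complex.mul_re, Complex.re_ofNat, Complex.im_ofNat, Complex.neg_re, Complex.one_re,
    Complex.neg_im, Complex.one_im, hself]
  linarith [(sub_mul 1 (1 / t) (inner ℂ ξ (S ξ)).re), one_div_mul_eq_div t (inner ℂ ξ (S ξ)).re]

variable {d : ℕ} {D : Set (Pt d)}

theorem toLp_mem_XSub {p : WithLp 2 (L2Pair D × L2Pair D)} (hp : p ∈ XSub D) {α β γ δ : ℂ}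
    (h : α + β = γ + δ) :
    WithLp.toLp 2 (α • p.fst + β • p.snd, γ • p.fst + δ • p.snd) ∈ XSub D := by
  obtain ⟨hw, hv, hwv⟩ := hp
  refine ⟨(H1 D).add_mem ((H1 D).smul_mem α hw) ((H1 D).smul_mem β hv),
    (H1 D).add_mem ((H1 D).smul_mem γ hw) ((H1 D).smul_mem δ hv), ?_⟩
  have hdiff : (α • p.fst + β • p.snd) - (γ • p.fst + δ • p.snd) = (α - γ) • (p.fst - p.snd) := by
    obtain rfl : β = γ + δ - α := by linear_combination h
    module
  change (α • p.fst + β • p.snd) - (γ • p.fst + δ • p.snd) ∈ H10 D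
  rw [hdiff]
  exact (H10 D).smul_mem (α - γ) hwv

/-- The bounded operator `(w, v) ↦ (α w + β v, γ w + δ v)` of `X(D)`. It preserves the condition
`w - v ∈ H¹₀(D)` because `(α w + β v) - (γ w + δ v) = (α - γ)(w - v)`. -/
def X.combine (α β γ δ : ℂ) (h : α + β = γ + δ) : X D →L[ℂ] X D :=
  let fst := WithLp.fstL 2 ℂ (L2Pair D) (L2Pair D) ∘L X.incl.toContinuousLinearMap
  let snd := WithLp.sndL 2 ℂ (L2Pair D) (L2Pair D) ∘L X.incl.toContinuousLinearMap
  ContinuousLinearMap.codRestrict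
    ((WithLp.prodContinuousLinearEquiv 2 ℂ (L2Pair D) (L2Pair D)).symm.toContinuousLinearMap ∘L
      (α • fst + β • snd).prod (γ • fst + δ • snd))
    (XSub D) fun f => toLp_mem_XSub (Subtype.prop (p := (· ∈ XSub D)) f) h

theorem X.w_combine {α β γ δ : ℂ} (h : α + β = γ + δ) (f : X D) :
    X.w (X.combine α β γ δ h f) = α • X.w f + β • X.v f := rfl

theorem X.dw_combine {α β γ δ : ℂ} (h : α + β = γ + δ) (f : X D) :
    X.dw (X.combine α β γ δ h f) = α • X.dw f + β • X.dv f := rfl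

theorem X.v_combine {α β γ δ : ℂ} (h : α + β = γ + δ) (f : X D) :
    X.v (X.combine α β γ δ h f) = γ • X.w f + δ • X.v f := rfl

theorem X.dv_combine {α β γ δ : ℂ} (h : α + β = γ + δ) (f : X D) :
    X.dv (X.combine α β γ δ h f) = γ • X.dw f + δ • X.dv f := rfl

theorem exists_norm_le_opA_of_one_lt {b κ : ℝ} (hb : 1 < b) (hκ : b ≤ κ) :
    ∃ C : ℝ, 0 ≤ C ∧ ∀ a : Pt d → Matrix (Fin d) (Fin d) ℝ, IsCoeffField a →
      (∀ x ξ, b * ‖ξ‖ ^ 2 ≤ (dotConj (matVec (a x) ξ) ξ).re) →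
      ∀ f : X D, ‖f‖ ≤ C * ‖opA D a κ f‖ := by
  have hc : 0 < (b - 1) / (b + 1) := div_pos (by linarith) (by linarith)
  let T : X D →L[ℂ] X D := X.combine 1 0 2 (-1) (by norm_num)
  refine ⟨‖T‖ / ((b - 1) / (b + 1)), by positivity, fun a ha hlower f =>
    norm_le_of_mul_norm_sq_le_re_inner (T := T) hc ?_⟩
  have hw : b * ‖X.w f‖ ^ 2 ≤ (inner ℂ (X.w f) ((κ : ℂ) • X.w f)).re :=
    (mul_le_mul_of_nonneg_right hκ (sq_nonneg _)).trans_eq (re_inner_ofReal_smul_self κ _).symm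
  have hgrad := mul_norm_sq_add_le_re_inner_of_one_lt hb
    (ha.mul_norm_sq_le_re_inner hlower (X.dw f)) (X.dv f)
  have hval := mul_norm_sq_add_le_re_inner_of_one_lt hb hw (X.v f)
  rw [X.norm_sq_eq, ha.inner_opA]
  simp only [T, X.w_combine, X.dw_combine, X.v_combine, X.dv_combine, one_smul, zero_smul,
    add_zero, Complex.sub_re, Complex.add_re, ← inner_smul_right]
  linarith

theorem exists_norm_le_opA_of_lt_one {b b' κ : ℝ} (hb' : 0 < b') (hb : b < 1) (hb'κ : b' ≤ κ)
    (hκb : κ ≤ b) :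
    ∃ C : ℝ, 0 ≤ C ∧ ∀ a : Pt d → Matrix (Fin d) (Fin d) ℝ, IsCoeffField a →
      (∀ x ξ, b' * ‖ξ‖ ^ 2 ≤ (dotConj (matVec (a x) ξ) ξ).re) →
      (∀ x ξ, (dotConj (matVec (a x) ξ) ξ).re ≤ b * ‖ξ‖ ^ 2) →
      ∀ f : X D, ‖f‖ ≤ C * ‖opA D a κ f‖ := by
  have hb0 : 0 < 1 + b := by linarith
  set t : ℝ := 2 / (1 + b) with ht_def
  have ht : 1 < t := by
    rw [ht_def, one_lt_div hb0]
    linarith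
  have htb : t * b < 1 := by
    rw [ht_def, div_mul_eq_mul_div, div_lt_one hb0]
    linarith
  have hc : 0 < min (b' * (1 - 1 / t)) (1 - t * b) :=
    lt_min (mul_pos hb' (sub_pos.2 ((div_lt_one (by linarith)).2 ht))) (sub_pos.2 htb)
  let T : X D →L[ℂ] X D := X.combine 1 (-2) 0 (-1) (by norm_num)
  refine ⟨_, div_nonneg (norm_nonneg T) hc.le, fun a ha hlower hupper f =>
    norm_le_of_mul_norm_sq_le_re_inner (T := T) hc ?_⟩
  have hκ_symm : ((κ : ℂ) • LinearMap.id : Lp ℂ 2 (leb D) →ₗ[ℂ] Lp ℂ 2 (leb D)).IsSymmetric :=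
    LinearMap.IsSymmetric.id.smul (Complex.conj_ofReal κ)
  have hgrad := mul_norm_sq_add_le_re_inner_of_lt_one ha.isSymmetric_mulField hb'.le ht.le
    (ha.mul_norm_sq_le_re_inner hlower) (ha.re_inner_le_mul_norm_sq hupper) (X.dw f) (X.dv f)
  have hval := mul_norm_sq_add_le_re_inner_of_lt_one hκ_symm hb'.le ht.le
    (fun u => (mul_le_mul_of_nonneg_right hb'κ (sq_nonneg _)).trans_eq
      (re_inner_ofReal_smul_self κ u).symm)
    (fun u => (re_inner_ofReal_smul_self κ u).trans_le
      (mul_le_mul_of_nonneg_right hκb (sq_nonneg _))) (X.w f) (X.v f)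
  simp only [ContinuousLinearMap.coe_coe, LinearMap.smul_apply, LinearMap.id_apply] at hgrad hval
  rw [X.norm_sq_eq, ha.inner_opA]
  simp only [T, X.w_combine, X.dw_combine, X.v_combine, X.dv_combine, one_smul, zero_smul,
    zero_add, Complex.sub_re, Complex.add_re, ← inner_smul_right]
  linarith

theorem exists_gt_forall_le_of_finite {s : Set ℝ} (hs : s.Finite) {y : ℝ} (h : ∀ x ∈ s, y < x) :
    ∃ b > y, ∀ x ∈ s, b ≤ x := by
  have hle : ∀ᶠ b in 𝓝[>] y, ∀ x ∈ s, b ≤ x :=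
    hs.eventually_all.2 fun x hx => (eventually_le_nhds (h x hx)).filter_mono nhdsWithin_le_nhds
  exact (eventually_mem_nhdsWithin.and hle).exists

theorem exists_lt_forall_ge_of_finite {s : Set ℝ} (hs : s.Finite) {y : ℝ} (h : ∀ x ∈ s, x < y) :
    ∃ b < y, ∀ x ∈ s, x ≤ b := by
  have hle : ∀ᶠ b in 𝓝[<] y, ∀ x ∈ s, x ≤ b :=
    hs.eventually_all.2 fun x hx => (eventually_ge_nhds (h x hx)).filter_mono nhdsWithin_le_nhds
  exact (eventually_mem_nhdsWithin.and hle).exists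

/-- The two sign regimes for the contrast between the coefficients `𝒮`, `κ` of `w` and the unit
coefficients of `v`: all of the former lie above `1`, or all of them lie strictly between `0`
and `1`. -/
def OneSidedContrast (κ : ℝ) (𝒮 : Set (Matrix (Fin d) (Fin d) ℝ)) : Prop :=
  (1 < κ ∧ ∀ N ∈ 𝒮, 1 < lowerBd N) ∨
    (0 < κ ∧ κ < 1 ∧ ∀ N ∈ 𝒮, 0 < lowerBd N ∧ upperBd N < 1)

variable {κ : ℝ} {𝒮 : Set (Matrix (Fin d) (Fin d) ℝ)}

theorem OneSidedContrast.pos (h : OneSidedContrast κ 𝒮) : 0 < κ :=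
  h.elim (fun h => one_pos.trans h.1) And.left

theorem OneSidedContrast.lowerBd_pos (h : OneSidedContrast κ 𝒮) {N : Matrix (Fin d) (Fin d) ℝ}
    (hN : N ∈ 𝒮) : 0 < lowerBd N :=
  h.elim (fun h => one_pos.trans (h.2 N hN)) fun h => (h.2.2 N hN).1

theorem exists_norm_le_opA (h𝒮 : 𝒮.Finite) (h : OneSidedContrast κ 𝒮) :
    ∃ C : ℝ, 0 ≤ C ∧ ∀ a : Pt d → Matrix (Fin d) (Fin d) ℝ, IsCoeffField a → (∀ x, a x ∈ 𝒮) →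
      ∀ f : X D, ‖f‖ ≤ C * ‖opA D a κ f‖ := by
  have hlower {b : ℝ} (hb : ∀ r ∈ insert κ (lowerBd '' 𝒮), b ≤ r) {N} (hN : N ∈ 𝒮) (ξ : CVec d) :
      b * ‖ξ‖ ^ 2 ≤ (dotConj (matVec N ξ) ξ).re :=
    (mul_le_mul_of_nonneg_right (hb _ (.inr ⟨N, hN, rfl⟩)) (sq_nonneg _)).trans
      (lowerBd_mul_le N ξ)
  have hupper {b : ℝ} (hb : ∀ r ∈ insert κ (upperBd '' 𝒮), r ≤ b) {N} (hN : N ∈ 𝒮) (ξ : CVec d) :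
      (dotConj (matVec N ξ) ξ).re ≤ b * ‖ξ‖ ^ 2 :=
    (le_upperBd_mul N ξ).trans
      (mul_le_mul_of_nonneg_right (hb _ (.inr ⟨N, hN, rfl⟩)) (sq_nonneg _))
  have hfin_lower := (h𝒮.image lowerBd).insert κ
  have hfin_upper := (h𝒮.image upperBd).insert κ
  rcases h with ⟨hκ, h1⟩ | ⟨hκ0, hκ1, h01⟩
  · obtain ⟨b, hb1, hb⟩ := exists_gt_forall_le_of_finite (y := 1) hfin_lower (by simp_all)
    obtain ⟨C, hC0, hC⟩ := exists_norm_le_opA_of_one_lt (D := D) hb1 (hb κ (.inl rfl))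
    exact ⟨C, hC0, fun a ha ha𝒮 => hC a ha fun x => hlower hb (ha𝒮 x)⟩
  · obtain ⟨b', hb'0, hb'⟩ := exists_gt_forall_le_of_finite (y := 0) hfin_lower (by simp_all)
    obtain ⟨b, hb1, hb⟩ := exists_lt_forall_ge_of_finite (y := 1) hfin_upper (by simp_all)
    obtain ⟨C, hC0, hC⟩ := exists_norm_le_opA_of_lt_one (D := D) hb'0 hb1 (hb' κ (.inl rfl))
      (hb κ (.inl rfl))
    exact ⟨C, hC0, fun a ha ha𝒮 => hC a ha (fun x => hlower hb' (ha𝒮 x))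
      fun x => hupper hb (ha𝒮 x)⟩

theorem IsCoeffField.isInvertible_opA (ha : IsCoeffField a) (h𝒮 : 𝒮.Finite)
    (h : OneSidedContrast κ 𝒮) (ha𝒮 : ∀ x, a x ∈ 𝒮) : (opA D a κ).IsInvertible := by
  obtain ⟨C, hC, hbound⟩ := exists_norm_le_opA h𝒮 h
  exact isInvertible_of_isSymmetric_of_le (ha.isSymmetric_opA κ) hC (hbound a ha ha𝒮)

end coercivity

section perturbation

theorem norm_le_of_forall_norm_inner_le {E : Type*} [NormedAddCommGroup E] [InnerProductSpace ℂ E]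
    {x : E} {c : ℝ} (hc : 0 ≤ c) (h : ∀ g : E, ‖inner ℂ g x‖ ≤ c * ‖g‖) : ‖x‖ ≤ c := by
  rw [← innerSL_apply_norm ℂ x]
  exact ContinuousLinearMap.opNorm_le_bound _ hc fun g => by
    rw [innerSL_apply_apply, norm_inner_symm]
    exact h g

section adjoint

variable {E F : Type*} [NormedAddCommGroup E] [InnerProductSpace ℂ E]
  [NormedAddCommGroup F] [NormedSpace ℂ F] {A A' S : E →L[ℂ] E} {P : E →L[ℂ] F} {c K : ℝ}

theorem norm_inverse_apply_le_of_norm_inner_sub_le (hA : A.IsInvertible) (hA' : A'.IsInvertible)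
    (hc : 0 ≤ c) (hK : 0 ≤ K) (hbound : ∀ f, ‖f‖ ≤ c * ‖A' f‖) (hP : ∀ f, ‖P f‖ ≤ ‖f‖)
    (hdiff : ∀ φ f, ‖inner ℂ φ ((A' - A) f)‖ ≤ K * ‖P f‖ * ‖P φ‖) (g : E) :
    ‖P (A'.inverse g)‖ ≤ (1 + c * K) * ‖P (A.inverse g)‖ := by
  set f := A.inverse g
  set f' := A'.inverse g
  have hf : A f = g := hA.self_apply_inverse g
  have hf' : A' f' = g := hA'.self_apply_inverse g
  have hres : ‖(A' - A) f‖ ≤ K * ‖P f‖ :=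
    norm_le_of_forall_norm_inner_le (by positivity) fun φ =>
      (hdiff φ f).trans (mul_le_mul_of_nonneg_left (hP φ) (by positivity))
  have hsub : ‖f - f'‖ ≤ c * (K * ‖P f‖) := by
    refine (hbound _).trans (mul_le_mul_of_nonneg_left ?_ hc)
    rwa [map_sub, hf', ← hf]
  calc ‖P f'‖ = ‖P f - P (f - f')‖ := by rw [map_sub, sub_sub_cancel]
    _ ≤ ‖P f‖ + ‖f - f'‖ := (norm_sub_le _ _).trans (add_le_add_right (hP _) _)
    _ ≤ (1 + c * K) * ‖P f‖ := by linarith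

theorem norm_inner_adjoint_sub_le [CompleteSpace E] (hA_symm : (A : E →ₗ[ℂ] E).IsSymmetric)
    (hA : A.IsInvertible) (hA' : A'.IsInvertible) (hc : 0 ≤ c) (hK : 0 ≤ K)
    (hbound : ∀ f, ‖f‖ ≤ c * ‖A' f‖) (hP : ∀ f, ‖P f‖ ≤ ‖f‖)
    (hdiff : ∀ φ f, ‖inner ℂ φ ((A' - A) f)‖ ≤ K * ‖P f‖ * ‖P φ‖) (g φ : E) :
    ‖inner ℂ g ((A'.inverse ∘L S).adjoint φ - (A.inverse ∘L S).adjoint φ)‖ ≤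
      K * (1 + c * K) * ‖P (A.inverse (S g))‖ * ‖P (A.inverse φ)‖ := by
  set u := A.inverse φ
  set f' := A'.inverse (S g)
  have hu : A u = φ := hA.self_apply_inverse φ
  have hf' : A' f' = S g := hA'.self_apply_inverse _
  have hf : A (A.inverse (S g)) = S g := hA.self_apply_inverse _
  have hkey : inner ℂ g ((A'.inverse ∘L S).adjoint φ - (A.inverse ∘L S).adjoint φ) =
      -conj (inner ℂ u ((A' - A) f')) := by
    have hsymm : inner ℂ (A (f' - A.inverse (S g))) u = inner ℂ (f' - A.inverse (S g)) (A u) :=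
      hA_symm _ _
    rw [inner_sub_right, ContinuousLinearMap.adjoint_inner_right,
      ContinuousLinearMap.adjoint_inner_right, ← inner_sub_left, inner_conj_symm,
      ← inner_neg_left, sub_apply, neg_sub, hf', ← hf, ← map_sub, hsymm, hu]
    rfl
  rw [hkey, norm_neg, RCLike.norm_conj]
  refine (hdiff u f').trans (mul_le_mul_of_nonneg_right ?_ (norm_nonneg _))
  rw [mul_assoc]
  exact mul_le_mul_of_nonneg_left (norm_inverse_apply_le_of_norm_inner_sub_le hA hA' hc hK hbound
    hP hdiff (S g)) hK

end adjoint

theorem norm_inner_le_of_ae_norm_le {α E : Type*} [MeasurableSpace α] {μ : Measure α}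
    [NormedAddCommGroup E] [InnerProductSpace ℂ E] {s : Set α} {K : ℝ}
    {u p G : Lp E 2 μ} (hoff : ∀ᵐ x ∂μ, x ∉ s → G x = 0) (hG : ∀ᵐ x ∂μ, ‖G x‖ ≤ K * ‖u x‖) :
    ‖inner ℂ p G‖ ≤
      K * ‖LpToLpRestrictCLM α E ℂ μ 2 s u‖ * ‖LpToLpRestrictCLM α E ℂ μ 2 s p‖ := by
  set R := LpToLpRestrictCLM α E ℂ μ 2 s
  have hR : ∀ f, R f =ᵐ[μ.restrict s] f := LpToLpRestrictCLM_coeFn ℂ s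
  have hinner : inner ℂ p G = inner ℂ (R p) (R G) := by
    have hset : ∫ x in s, inner ℂ (p x) (G x) ∂μ = ∫ x, inner ℂ (p x) (G x) ∂μ := by
      refine setIntegral_eq_integral_of_ae_compl_eq_zero ?_
      filter_upwards [hoff] with x hx hxs
      rw [hx hxs, inner_zero_right]
    rw [L2.inner_def, L2.inner_def, ← hset]
    refine integral_congr_ae ?_
    filter_upwards [hR p, hR G] with x hp hg
    rw [hp, hg]
  have hRG : ‖R G‖ ≤ K * ‖R u‖ := by
    refine Lp.norm_le_mul_norm_of_ae_le_mul ?_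
    filter_upwards [hR u, hR G, ae_restrict_of_ae hG] with x hu hg hx
    rwa [hu, hg]
  rw [hinner]
  refine (norm_inner_le_norm _ _).trans ?_
  rw [mul_comm]
  exact mul_le_mul_of_nonneg_right hRG (norm_nonneg _)

variable {d : ℕ} {D Ω : Set (Pt d)} {a b : Pt d → Matrix (Fin d) (Fin d) ℝ}

/-- The restriction of `∇w` to `Ω ∩ D`, the quantity through which a perturbation of the
coefficients in `Ω` acts. -/
def X.dwOn (D Ω : Set (Pt d)) : X D →L[ℂ] Lp (CVec d) 2 ((leb D).restrict Ω) :=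
  LpToLpRestrictCLM (Pt d) (CVec d) ℂ (leb D) 2 Ω ∘L X.dw

theorem X.norm_dwOn_le (f : X D) : ‖X.dwOn D Ω f‖ ≤ ‖f‖ :=
  (norm_Lp_toLp_restrict_le Ω (X.dw f)).trans
    ((sq_le_sq₀ (norm_nonneg _) (norm_nonneg _)).1 (X.norm_dw_sq_le f))

theorem X.norm_dwOn_sq_le_of_ae {C : ℝ} (hΩ_fin : volume Ω ≠ ⊤) (hC : 0 ≤ C)
    {f : X D} (hf : ∀ᵐ x, x ∈ Ω → ‖X.dw f x‖ ^ 2 ≤ C) :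
    ‖X.dwOn D Ω f‖ ^ 2 ≤ C * volume.real Ω := by
  have hle : ∀ᵐ x ∂leb D, x ∈ Ω → ‖‖X.dw f x‖ ^ 2‖ ≤ C := by
    filter_upwards [ae_restrict_of_ae hf] with x hx hxΩ
    rw [Real.norm_of_nonneg (sq_nonneg _)]
    exact hx hxΩ
  have hvol : (leb D) Ω ≤ volume Ω := Measure.restrict_apply_le D Ω
  calc ‖X.dwOn D Ω f‖ ^ 2 = ∫ x in Ω, ‖X.dw f x‖ ^ 2 ∂leb D := by
        rw [Lp_norm_sq_eq_integral]
        refine integral_congr_ae ?_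
        filter_upwards [LpToLpRestrictCLM_coeFn ℂ Ω (X.dw f)] with x hx
        rw [← hx]
        rfl
    _ ≤ ‖∫ x in Ω, ‖X.dw f x‖ ^ 2 ∂leb D‖ := Real.le_norm_self _
    _ ≤ C * (leb D).real Ω :=
        norm_setIntegral_le_of_norm_le_const_ae' (hvol.trans_lt hΩ_fin.lt_top) hle
    _ ≤ C * volume.real Ω := mul_le_mul_of_nonneg_left (ENNReal.toReal_mono hΩ_fin hvol) hC

theorem IsCoeffField.norm_inner_opA_sub_le (ha : IsCoeffField a) (hb : IsCoeffField b)
    (hoff : ∀ x ∉ Ω, a x = b x) {K : ℝ}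
    (hK : ∀ x ξ, ‖matVec (a x - b x) ξ‖ ≤ K * ‖ξ‖) (κ : ℝ) (φ f : X D) :
    ‖inner ℂ φ ((opA D a κ - opA D b κ) f)‖ ≤ K * ‖X.dwOn D Ω f‖ * ‖X.dwOn D Ω φ‖ := by
  have hG : ha.mulField D (X.dw f) - hb.mulField D (X.dw f) =ᵐ[leb D]
      fun x => matVec (a x - b x) (X.dw f x) := by
    filter_upwards [Lp.coeFn_sub (ha.mulField D (X.dw f)) (hb.mulField D (X.dw f)),
      ha.coeFn_mulField (X.dw f), hb.coeFn_mulField (X.dw f)] with x hsub hax hbx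
    rw [hsub, Pi.sub_apply, hax, hbx, sub_matVec]
  have hinner : inner ℂ φ ((opA D a κ - opA D b κ) f) =
      inner ℂ (X.dw φ) (ha.mulField D (X.dw f) - hb.mulField D (X.dw f)) := by
    rw [sub_apply, inner_sub_right, ha.inner_opA, hb.inner_opA,
      inner_sub_right]
    ring
  rw [hinner]
  refine norm_inner_le_of_ae_norm_le ?_ ?_
  · filter_upwards [hG] with x hx hxΩ
    rw [hx, hoff x hxΩ, sub_self]
    ext i
    simp [matVec]
  · filter_upwards [hG] with x hx
    rw [hx]
    exact hK x _

theorem exists_ae_le_of_isCompact {α ι : Type*} [TopologicalSpace α] [MeasurableSpace α]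
    {μ : Measure α} {F : ι → α → ℝ} {W : ι → ℝ} (hW : ∀ i, 0 ≤ W i) {K : Set α} (hK : IsCompact K)
    (h : ∀ z ∈ K, ∃ U ∈ 𝓝 z, ∃ C : ℝ, 0 ≤ C ∧ ∀ i, ∀ᵐ x ∂μ, x ∈ U → F i x ≤ C * W i) :
    ∃ C : ℝ, 0 ≤ C ∧ ∀ i, ∀ᵐ x ∂μ, x ∈ K → F i x ≤ C * W i := by
  refine hK.induction_on
    (p := fun s => ∃ C : ℝ, 0 ≤ C ∧ ∀ i, ∀ᵐ x ∂μ, x ∈ s → F i x ≤ C * W i) ?_ ?_ ?_ ?_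
  · exact ⟨0, le_rfl, fun i => .of_forall fun x hx => hx.elim⟩
  · rintro s t hst ⟨C, hC, hF⟩
    exact ⟨C, hC, fun i => (hF i).mono fun x hx hxs => hx (hst hxs)⟩
  · rintro s t ⟨C, hC, hF⟩ ⟨C', -, hF'⟩
    refine ⟨max C C', hC.trans (le_max_left _ _), fun i => ?_⟩
    filter_upwards [hF i, hF' i] with x hs ht hx
    rcases hx with hx | hx
    · exact (hs hx).trans (mul_le_mul_of_nonneg_right (le_max_left _ _) (hW i))
    · exact (ht hx).trans (mul_le_mul_of_nonneg_right (le_max_right _ _) (hW i))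
  · intro z hz
    obtain ⟨U, hU, hF⟩ := h z hz
    exact ⟨U, mem_nhdsWithin_of_mem_nhds hU, hF⟩

theorem exists_norm_dwOn_inverse_le (hd : d ≤ 3) {A : Matrix (Fin d) (Fin d) ℝ}
    (hA : 0 < lowerBd A) {κ : ℝ} (hκ : 0 < κ) (hD : IsOpen D)
    (hinv : (opA D (fun _ => A) κ).IsInvertible) {K : Set (Pt d)} (hK : IsCompact K) (hKD : K ⊆ D)
    (n : ℝ) (s : ℂ) :
    ∃ C : ℝ, 0 ≤ C ∧ ∀ Ω ⊆ K, ∀ g : X D,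
      ‖X.dwOn D Ω ((opA D (fun _ => A) κ).inverse ((opB D n + s • opC D κ) g))‖ ≤
        C * √(volume.real Ω) * ‖g‖ := by
  set T := (opA D (fun _ => A) κ).inverse ∘L (opB D n + s • opC D κ)
  have hT : ∀ g, opA D (fun _ => A) κ (T g) = opB D n g + s • opC D κ g := fun g =>
    hinv.self_apply_inverse _
  obtain ⟨C, hC, hgrad⟩ := exists_ae_le_of_isCompact (μ := volume)
    (F := fun g x => ‖X.dw (T g) x‖ ^ 2) (W := fun g => ‖T g‖ ^ 2 + ‖g‖ ^ 2)
    (fun g => by positivity) hK fun z hz => by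
      obtain ⟨R, hR, hRD⟩ := Metric.isOpen_iff.1 hD z (hKD hz)
      obtain ⟨C, hC, h⟩ := exists_ae_norm_dw_sq_le hd hA hκ (half_pos hR) (half_lt_self hR) hRD n s
      exact ⟨_, Metric.closedBall_mem_nhds z (half_pos hR), C, hC, fun g => h _ g (hT g)⟩
  refine ⟨√(C * (‖T‖ ^ 2 + 1)), Real.sqrt_nonneg _, fun Ω hΩ g => ?_⟩
  have hTg : ‖T g‖ ^ 2 + ‖g‖ ^ 2 ≤ (‖T‖ ^ 2 + 1) * ‖g‖ ^ 2 := by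
    rw [add_one_mul, ← mul_pow]
    gcongr
    exact T.le_opNorm g
  have hsq : ‖X.dwOn D Ω (T g)‖ ^ 2 ≤ C * ((‖T‖ ^ 2 + 1) * ‖g‖ ^ 2) * volume.real Ω := by
    refine X.norm_dwOn_sq_le_of_ae (measure_ne_top_of_subset hΩ hK.measure_ne_top)
      (by positivity) ?_
    filter_upwards [hgrad g] with x hx hxΩ
    exact (hx (hΩ hxΩ)).trans (mul_le_mul_of_nonneg_left hTg hC)
  refine le_of_sq_le_sq ?_ (by positivity)
  rw [mul_pow, mul_pow, Real.sq_sqrt (by positivity), Real.sq_sqrt measureReal_nonneg]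
  exact hsq.trans_eq (by ring)

theorem exists_norm_dwOn_le_of_contDiffOn (hd : d ≤ 3) {A : Matrix (Fin d) (Fin d) ℝ}
    (hA : 0 < lowerBd A) {κ : ℝ} (hκ : 0 < κ) (hD : IsOpen D) {K : Set (Pt d)} (hK : IsCompact K)
    (hKD : K ⊆ D) {u φ : X D} (hu : opA D (fun _ => A) κ u = φ) {f : Pt d → ℂ}
    (hf : ContDiffOn ℝ ∞ f D) (hφ : X.w φ =ᵐ[leb D] f) :
    ∃ C : ℝ, 0 ≤ C ∧ ∀ Ω ⊆ K, ‖X.dwOn D Ω u‖ ≤ C * √(volume.real Ω) := by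
  obtain ⟨C, hC, hgrad⟩ := exists_ae_le_of_isCompact (μ := volume) (ι := Unit)
    (F := fun _ x => ‖X.dw u x‖ ^ 2) (W := fun _ => 1) (fun _ => zero_le_one) hK fun z hz => by
      obtain ⟨R, hR, hRD⟩ := Metric.nhds_basis_closedBall.mem_iff.1 (hD.mem_nhds (hKD hz))
      obtain ⟨C, hC, h⟩ := exists_ae_norm_dw_sq_le_of_contDiffOn hd hA hκ hD (half_pos hR)
        (half_lt_self hR) hRD hu hf hφ
      exact ⟨_, Metric.closedBall_mem_nhds z (half_pos hR), C, hC, fun _ => by simpa using h⟩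
  refine ⟨√C, Real.sqrt_nonneg _, fun Ω hΩ => le_of_sq_le_sq ?_ (by positivity)⟩
  rw [mul_pow, Real.sq_sqrt hC, Real.sq_sqrt measureReal_nonneg]
  refine X.norm_dwOn_sq_le_of_ae (measure_ne_top_of_subset hΩ hK.measure_ne_top) hC ?_
  filter_upwards [hgrad ()] with x hx hxΩ
  simpa using hx (hΩ hxΩ)

theorem exists_norm_matVec_sub_le {𝒮 : Set (Matrix (Fin d) (Fin d) ℝ)} (h𝒮 : 𝒮.Finite)
    (A : Matrix (Fin d) (Fin d) ℝ) :
    ∃ K : ℝ, 0 ≤ K ∧ ∀ N ∈ 𝒮, ∀ ξ, ‖matVec (N - A) ξ‖ ≤ K * ‖ξ‖ := by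
  choose K _ hK using fun N => exists_norm_matVec_le (N - A)
  obtain ⟨K', hK'⟩ := (h𝒮.image K).bddAbove
  refine ⟨max K' 0, le_max_right _ _, fun N hN ξ => (hK N ξ).trans ?_⟩
  gcongr
  exact (hK' ⟨N, hN, rfl⟩).trans (le_max_left _ _)

theorem exists_norm_adjoint_sub_le_volume (hd : d ≤ 3) {A : Matrix (Fin d) (Fin d) ℝ}
    (hA : A.IsSymm) {𝒮 : Set (Matrix (Fin d) (Fin d) ℝ)} (h𝒮 : 𝒮.Finite) (hA𝒮 : A ∈ 𝒮) {κ : ℝ}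
    (hcontrast : OneSidedContrast κ 𝒮) (hD : IsOpen D) {K : Set (Pt d)} (hK : IsCompact K)
    (hKD : K ⊆ D) (n : ℝ) (s : ℂ) {φ : X D} {f : Pt d → ℂ} (hf : ContDiffOn ℝ ∞ f D)
    (hφ : X.w φ =ᵐ[leb D] f) :
    ∃ L : ℝ, 0 ≤ L ∧ ∀ a, IsCoeffField a → (∀ x, a x ∈ 𝒮) → ∀ Ω ⊆ K, (∀ x ∉ Ω, a x = A) →
      ‖((opA D a κ).inverse ∘L (opB D n + s • opC D κ)).adjoint φ -
          ((opA D (fun _ => A) κ).inverse ∘L (opB D n + s • opC D κ)).adjoint φ‖ ≤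
        L * volume.real Ω := by
  obtain ⟨c, hc, hbound⟩ := exists_norm_le_opA (D := D) h𝒮 hcontrast
  have hconst := isCoeffField_const (d := d) hA
  have hinvA := hconst.isInvertible_opA (D := D) h𝒮 hcontrast fun _ => hA𝒮
  have hA0 : 0 < lowerBd A := hcontrast.lowerBd_pos hA𝒮
  obtain ⟨k, hk, hdiff⟩ := exists_norm_matVec_sub_le h𝒮 A
  obtain ⟨C₁, hC₁, hsource⟩ :=
    exists_norm_dwOn_inverse_le hd hA0 hcontrast.pos hD hinvA hK hKD n s
  obtain ⟨C₂, hC₂, hφgrad⟩ := exists_norm_dwOn_le_of_contDiffOn hd hA0 hcontrast.pos hD hK hKD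
    (hinvA.self_apply_inverse φ) hf hφ
  refine ⟨k * (1 + c * k) * C₁ * C₂, by positivity, fun a ha ha𝒮 Ω hΩ hoff =>
    norm_le_of_forall_norm_inner_le (by positivity) fun g => ?_⟩
  refine (norm_inner_adjoint_sub_le (hconst.isSymmetric_opA κ) hinvA
    (ha.isInvertible_opA h𝒮 hcontrast ha𝒮) hc hk (hbound a ha ha𝒮) X.norm_dwOn_le
    (ha.norm_inner_opA_sub_le hconst hoff (fun x => hdiff _ (ha𝒮 x)) κ) g φ).trans ?_
  calc _ ≤ k * (1 + c * k) * (C₁ * √(volume.real Ω) * ‖g‖) * (C₂ * √(volume.real Ω)) := by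
        gcongr
        exacts [hsource Ω hΩ g, hφgrad Ω hΩ]
    _ = k * (1 + c * k) * C₁ * C₂ * (√(volume.real Ω) * √(volume.real Ω)) * ‖g‖ := by ring
    _ = _ := by rw [Real.mul_self_sqrt measureReal_nonneg]

end perturbation

section defects

variable {d M : ℕ} {D K : Set (Pt d)} {a b : Pt d → Matrix (Fin d) (Fin d) ℝ}
  {A : Matrix (Fin d) (Fin d) ℝ} {Am : Fin M → Matrix (Fin d) (Fin d) ℝ} {z : Fin M → Pt d}
  {B : Fin M → Set (Pt d)} {ε : ℝ}

theorem IsCoeffField.add (ha : IsCoeffField a) (hb : IsCoeffField b) :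
    IsCoeffField fun x => a x + b x := by
  obtain ⟨ha_meas, ⟨k, hk⟩, ha_symm⟩ := ha
  obtain ⟨hb_meas, ⟨l, hl⟩, hb_symm⟩ := hb
  exact ⟨fun i j => (ha_meas i j).add (hb_meas i j),
    ⟨k + l, fun x i j => (abs_add_le _ _).trans (add_le_add (hk x i j) (hl x i j))⟩,
    fun x => (ha_symm x).add (hb_symm x)⟩

theorem isCoeffField_sum {ι : Type*} {t : Finset ι} {a : ι → Pt d → Matrix (Fin d) (Fin d) ℝ}
    (ha : ∀ i ∈ t, IsCoeffField (a i)) : IsCoeffField fun x => ∑ i ∈ t, a i x := by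
  classical
  induction t using Finset.induction_on with
  | empty => simpa using isCoeffField_const (Matrix.isSymm_zero (n := Fin d) (α := ℝ))
  | insert i t hi ih =>
    simp only [Finset.sum_insert hi]
    exact (ha i (t.mem_insert_self i)).add (ih fun j hj => ha j (Finset.mem_insert_of_mem hj))

theorem IsCoeffField.indicator (ha : IsCoeffField a) {Ω : Set (Pt d)} (hΩ : MeasurableSet Ω) :
    IsCoeffField (Ω.indicator a) := by
  classical
  obtain ⟨ha_meas, ⟨k, hk⟩, ha_symm⟩ := ha
  refine ⟨fun i j => ?_, ⟨k, fun x i j => ?_⟩, fun x => ?_⟩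
  · convert (ha_meas i j).indicator hΩ using 2 with x
    simp only [Set.indicator_apply]
    split_ifs <;> rfl
  · by_cases hx : x ∈ Ω
    · simpa only [Set.indicator_of_mem hx] using hk x i j
    · simpa only [Set.indicator_of_notMem hx, Matrix.zero_apply, abs_zero] using
        (abs_nonneg _).trans (hk x i j)
  · by_cases hx : x ∈ Ω
    · simpa only [Set.indicator_of_mem hx] using ha_symm x
    · simpa only [Set.indicator_of_notMem hx] using Matrix.isSymm_zero

theorem defect_eq_vadd_smul (z : Pt d) (B : Set (Pt d)) (ε : ℝ) : defect z B ε = z +ᵥ ε • B := by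
  rw [← Set.image_vadd, ← Set.image_smul, Set.image_image]
  rfl

theorem isCoeffField_coeff (hA : A.IsSymm) (hAm : ∀ m, (Am m).IsSymm)
    (hB : ∀ m, MeasurableSet (B m)) (ε : ℝ) : IsCoeffField (coeff A Am z B ε) := by
  refine (isCoeffField_const hA).add (isCoeffField_sum fun m _ =>
    (isCoeffField_const ((hAm m).sub hA)).indicator ?_)
  rw [defect_eq_vadd_smul]
  exact ((hB m).const_smul₀ ε).const_vadd (z m)

theorem coeff_eq_of_notMem_iUnion {x : Pt d} (hx : x ∉ ⋃ m, defect (z m) (B m) ε) :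
    coeff A Am z B ε x = A := by
  rw [Set.mem_iUnion, not_exists] at hx
  rw [coeff, Finset.sum_eq_zero fun m _ => Set.indicator_of_notMem (hx m) _, add_zero]

theorem coeff_mem_insert_range
    (hdisj : Pairwise fun i j => Disjoint (defect (z i) (B i) ε) (defect (z j) (B j) ε))
    (x : Pt d) : coeff A Am z B ε x ∈ insert A (Set.range Am) := by
  by_cases hx : x ∈ ⋃ m, defect (z m) (B m) ε
  · obtain ⟨m, hm⟩ := Set.mem_iUnion.1 hx
    have hother : ∀ m' ∈ Finset.univ, m' ≠ m →
        (defect (z m') (B m') ε).indicator (fun _ => Am m' - A) x = 0 := fun m' _ hne =>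
      Set.indicator_of_notMem (fun hm' => (hdisj hne).notMem_of_mem_left hm' hm) _
    refine .inr ⟨m, ?_⟩
    rw [coeff, Finset.sum_eq_single_of_mem m (Finset.mem_univ m) hother, Set.indicator_of_mem hm,
      add_sub_cancel]
  · exact .inl (coeff_eq_of_notMem_iUnion hx)

theorem eventually_defect_subset {z : Pt d} {B U : Set (Pt d)} (hB : Bornology.IsBounded B)
    (hU : U ∈ 𝓝 z) : ∀ᶠ ε in 𝓝 (0 : ℝ), defect z B ε ⊆ U := by
  filter_upwards [eventually_singleton_add_smul_subset hB hU] with ε hε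
  rw [Set.singleton_add] at hε
  rwa [defect_eq_vadd_smul, ← Set.image_vadd]

theorem eventually_pairwise_disjoint_defect (hz : Function.Injective z)
    (hB : ∀ m, Bornology.IsBounded (B m)) :
    ∀ᶠ ε in 𝓝 (0 : ℝ),
      Pairwise fun i j => Disjoint (defect (z i) (B i) ε) (defect (z j) (B j) ε) := by
  refine eventually_all.2 fun i => eventually_all.2 fun j => ?_
  by_cases hij : i = j
  · exact .of_forall fun ε hne => absurd hij hne
  · obtain ⟨U, V, hU, hV, hUV⟩ := t2_separation_nhds (hz.ne hij)
    filter_upwards [eventually_defect_subset (hB i) hU, eventually_defect_subset (hB j) hV]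
      with ε hi hj _
    exact hUV.mono hi hj

theorem volume_iUnion_defect_le (z : Fin M → Pt d) (B : Fin M → Set (Pt d)) (hε : 0 ≤ ε) :
    volume.real (⋃ m, defect (z m) (B m) ε) ≤ (∑ m, volume.real (B m)) * ε ^ d := by
  refine (measureReal_iUnion_fintype_le _).trans_eq ?_
  rw [Finset.sum_mul]
  refine Finset.sum_congr rfl fun m _ => ?_
  rw [defect_eq_vadd_smul, measureReal_def, measure_vadd, Measure.addHaar_smul_of_nonneg _ hε,
    finrank_euclideanSpace_fin, ENNReal.toReal_mul, ENNReal.toReal_ofReal (by positivity),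
    mul_comm, measureReal_def]

theorem IsSmoothBall.measurableSet {B : Set (Pt d)} (hB : IsSmoothBall B) : MeasurableSet B := by
  obtain ⟨Φ, r, -, -, -, rfl⟩ := hB
  exact (Φ.isOpenMap _ Metric.isOpen_ball).measurableSet

theorem IsSmoothBall.isBounded {B : Set (Pt d)} (hB : IsSmoothBall B) :
    Bornology.IsBounded B := by
  obtain ⟨Φ, r, -, -, -, rfl⟩ := hB
  exact ((isCompact_closedBall 0 r).image Φ.continuous).isBounded.subset
    (Set.image_mono Metric.ball_subset_closedBall)

end defects

theorem oneSidedContrast_insert_range {d : ℕ} [NeZero d] {ι : Type*} {A : Matrix (Fin d) (Fin d) ℝ}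
    {Am : ι → Matrix (Fin d) (Fin d) ℝ} (hA : 0 < lowerBd A) (hAm : ∀ m, 0 < lowerBd (Am m))
    {κ : ℝ} (hκ : (1 < lowerBd A ∧ (∀ m, 1 < lowerBd (Am m)) ∧ κ = lowerBd A) ∨
      (upperBd A < 1 ∧ (∀ m, upperBd (Am m) < 1) ∧ κ = upperBd A)) :
    OneSidedContrast κ (insert A (Set.range Am)) := by
  rcases hκ with ⟨hA1, hAm1, rfl⟩ | ⟨hA1, hAm1, rfl⟩
  · exact .inl ⟨hA1, Set.forall_mem_insert.2 ⟨hA1, Set.forall_mem_range.2 hAm1⟩⟩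
  · exact .inr ⟨hA.trans_le (lowerBd_le_upperBd A), hA1,
      Set.forall_mem_insert.2 ⟨⟨hA, hA1⟩, Set.forall_mem_range.2 fun m => ⟨hAm m, hAm1 m⟩⟩⟩

theorem opT_eq {d : ℕ} (D : Set (Pt d)) (a : Pt d → Matrix (Fin d) (Fin d) ℝ) (κ n : ℝ) (τ : ℂ) :
    opT D a κ n τ = (opA D a κ).inverse ∘L (opB D n + (1 / τ) • opC D κ) := by
  rw [opT, ContinuousLinearMap.comp_add, ContinuousLinearMap.comp_smul]

theorem isBigO_pow_rpow {d : ℕ} (hd : 2 ≤ d) :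
    (fun ε : ℝ => ε ^ d) =O[𝓝[>] 0] fun ε : ℝ => ε ^ ((d : ℝ) / 2 + 1) := by
  refine IsBigO.of_bound 1 ?_
  filter_upwards [Ioo_mem_nhdsGT zero_lt_one] with ε ⟨hε0, hε1⟩
  have hexp : (d : ℝ) / 2 + 1 ≤ d := by
    have : (2 : ℝ) ≤ d := by exact_mod_cast hd
    linarith
  rw [one_mul, Real.norm_of_nonneg (by positivity), Real.norm_of_nonneg (by positivity),
    ← Real.rpow_natCast]
  exact Real.rpow_le_rpow_of_exponent_ge hε0 hε1.le hexp

end TransmissionEig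

end

open TransmissionEig in
theorem mainTheorem10_general {d : ℕ} (hd : d ≤ 3) {D : Set (Pt d)} (hD : IsOpen D)
    {A : Matrix (Fin d) (Fin d) ℝ} (hA : A.IsSymm) {M : ℕ}
    {Am : Fin M → Matrix (Fin d) (Fin d) ℝ} (hAm : ∀ m, (Am m).IsSymm) {z : Fin M → Pt d}
    (hzD : ∀ m, z m ∈ D) (hz : Function.Injective z) {B : Fin M → Set (Pt d)}
    (hB_meas : ∀ m, MeasurableSet (B m)) (hB_bdd : ∀ m, Bornology.IsBounded (B m)) {κ : ℝ}
    (hκ : OneSidedContrast κ (insert A (Set.range Am))) (n : ℝ) (s : ℂ) {φ : X D} {f : Pt d → ℂ}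
    (hf : ContDiffOn ℝ ∞ f D) (hφ : X.w φ =ᵐ[leb D] f) :
    (opA D (fun _ => A) κ).IsInvertible ∧
    (∀ᶠ ε in 𝓝[>] (0 : ℝ), (opA D (coeff A Am z B ε) κ).IsInvertible) ∧
    (fun ε : ℝ => ‖((opA D (coeff A Am z B ε) κ).inverse ∘L (opB D n + s • opC D κ)).adjoint φ -
        ((opA D (fun _ => A) κ).inverse ∘L (opB D n + s • opC D κ)).adjoint φ‖)
      =O[𝓝[>] (0 : ℝ)] fun ε : ℝ => ε ^ d := by
  have hfin : (insert A (Set.range Am)).Finite := (Set.finite_range Am).insert A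
  have hcoeff := fun ε => isCoeffField_coeff (z := z) hA hAm hB_meas ε
  obtain ⟨K, hK, hzK, hKD⟩ := exists_compact_between (Set.finite_range z).isCompact hD
    (Set.range_subset_iff.2 hzD)
  have hmem : ∀ᶠ ε in 𝓝[>] (0 : ℝ), ∀ x, coeff A Am z B ε x ∈ insert A (Set.range Am) :=
    ((eventually_pairwise_disjoint_defect hz hB_bdd).filter_mono nhdsWithin_le_nhds).mono
      fun _ => coeff_mem_insert_range
  have hsub : ∀ᶠ ε in 𝓝[>] (0 : ℝ), ∀ m, defect (z m) (B m) ε ⊆ K :=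
    (eventually_all.2 fun m => eventually_defect_subset (hB_bdd m)
      (mem_interior_iff_mem_nhds.1 (hzK ⟨m, rfl⟩))).filter_mono nhdsWithin_le_nhds
  refine ⟨(isCoeffField_const hA).isInvertible_opA hfin hκ fun _ => .inl rfl,
    hmem.mono fun ε => (hcoeff ε).isInvertible_opA hfin hκ, ?_⟩
  obtain ⟨L, hL, hLbound⟩ := exists_norm_adjoint_sub_le_volume hd hA hfin (.inl rfl) hκ hD hK hKD
    n s hf hφ
  refine IsBigO.of_bound (L * ∑ m, volume.real (B m)) ?_
  filter_upwards [hmem, hsub, eventually_mem_nhdsWithin] with ε hε_mem hε_sub (hε : 0 < ε)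
  rw [norm_norm, Real.norm_of_nonneg (by positivity), mul_assoc]
  exact (hLbound _ (hcoeff ε) hε_mem _ (Set.iUnion_subset hε_sub) fun x =>
    coeff_eq_of_notMem_iUnion).trans
      (mul_le_mul_of_nonneg_left (volume_iUnion_defect_le z B hε.le) hL)

open TransmissionEig in
theorem mainTheorem10
    {d : ℕ} (hd : d = 2 ∨ d = 3)
    -- the bounded domain `D`
    {D : Set (Pt d)} (hDo : IsOpen D) (hDc : IsConnected D) (hDb : Bornology.IsBounded D)
    -- the constant coefficients of the unperturbed medium
    (A : Matrix (Fin d) (Fin d) ℝ) (hA : A.IsSymm) (hA0 : 0 < lowerBd A)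
    (n : ℝ) (hn : 0 < n)
    -- the small defects `z_m + ε B_m` with constant coefficients `A_m`
    {M : ℕ} (Am : Fin M → Matrix (Fin d) (Fin d) ℝ)
    (hAm : ∀ m, (Am m).IsSymm) (hAm0 : ∀ m, 0 < lowerBd (Am m))
    (z : Fin M → Pt d) (B : Fin M → Set (Pt d)) (hB : ∀ m, IsSmoothBall (B m))
    (c₀ : ℝ) (hc₀ : 0 < c₀) (hzD : ∀ m, z m ∈ D)
    (hz : ∀ i j, i ≠ j → c₀ ≤ dist (z i) (z j))
    (hzb : ∀ m, c₀ ≤ Metric.infDist (z m) (frontier D))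
    -- either `A_min, a_min > 1` and `κ = A_min`, or `A_max, a_max < 1` and `κ = A_max`
    (κ : ℝ)
    (hκ : (1 < lowerBd A ∧ (∀ m, 1 < lowerBd (Am m)) ∧ κ = lowerBd A) ∨
      (upperBd A < 1 ∧ (∀ m, upperBd (Am m) < 1) ∧ κ = upperBd A))
    -- the eigenvalue `τ` and the smooth eigenfunction `φ = (w_τ, v_τ)`
    (τ : ℂ) (hτ : τ ≠ 0) (φ : X D) (hφ0 : φ ≠ 0)
    (hφ : τ • opT D (fun _ => A) κ n τ φ = φ)
    (hw : ∃ f : Pt d → ℂ, ContDiffOn ℝ ∞ f D ∧ X.w φ =ᵐ[leb D] f)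
    (hv : ∃ f : Pt d → ℂ, ContDiffOn ℝ ∞ f D ∧ X.v φ =ᵐ[leb D] f) :
    (opA D (fun _ => A) κ).IsInvertible ∧
    (∀ᶠ ε in 𝓝[>] (0 : ℝ), (opA D (coeff A Am z B ε) κ).IsInvertible) ∧
    (fun ε : ℝ => ‖(opT D (coeff A Am z B ε) κ n τ).adjoint φ -
        (opT D (fun _ => A) κ n τ).adjoint φ‖)
      =O[𝓝[>] (0 : ℝ)] fun ε : ℝ => ε ^ ((d : ℝ) / 2 + 1) := by
  have : NeZero d := ⟨by omega⟩
  obtain ⟨f, hf, hφf⟩ := hw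
  have hz_inj : Function.Injective z := fun i j hij => by_contra fun hne =>
    hc₀.not_ge ((hz i j hne).trans_eq (dist_eq_zero.2 hij))
  obtain ⟨hinv, hinv_coeff, hbigO⟩ := mainTheorem10_general (by omega) hDo hA hAm hzD hz_inj
    (fun m => (hB m).measurableSet) (fun m => (hB m).isBounded)
    (oneSidedContrast_insert_range hA0 hAm0 hκ) n (1 / τ) hf hφf
  simp only [opT_eq]
  exact ⟨hinv, hinv_coeff, hbigO.trans (isBigO_pow_rpow (by omega))⟩
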